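/- **Definitions.** A plane convex body (compact, convex, nonempty interior) has constant width $1$ if its two supporting lines orthogonal to $\nu$ are at distance $1$ for every unit vector $\nu$. Its inradius is the largest radius of an open disk contained in it. A Reuleaux polygon of width $1$ with $2n+1$ sides is a convex body of constant width $1$ whose boundary consists of $2n+1$ arcs $\Gamma_k=\{P_k+e^{it}: t\in[\alpha_k,\beta_k]\}$, $\alpha_k<\beta_k$, $k\in\mathbb Z/(2n+1)$, where the vertices $P_k$ are distinct and $P_{k+1}=P_k+e^{i\alpha_k}$, $P_{k-1}=P_k+e^{i\beta_k}$ (so $\Gamma_k$ is the side opposite to $P_k$); it is regular if all sides have the same length. If it has inradius $r$, its incircle and outercircle are the concentric circles of radii $r$ and $1-r$. A side is extremal if it is tangent to the incircle and both its endpoints lie on the outercircle. Three sides $\Gamma_{k-1},\Gamma_k,\Gamma_{k+1}$ form a cluster if $\Gamma_{k\pm1}$ are tangent to the incircle, their common point $P_k$ lies strictly between the two circles, and $P_{k\pm2}$ lie on the outercircle. A Blaschke deformation moves one vertex $P_k$ along the unit circle centered at $P_{k-1}$, and $P_{k+1}$ accordingly, keeping all other vertices fixed, so that the result is again a Reuleaux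 polygon of width $1$. A Reuleaux polygon of width $1$ and inradius $r$ is rigid if no Blaschke deformation preserving the inradius decreases the area. For $1-\frac1{\sqrt3}\le r\le\frac12$ let $$\ell(r)=2\arctan\sqrt{4(1-r)^2-1},\qquad N(r)=\left\lceil\frac{\pi}{2\ell(r)}-\frac12\right\rceil\quad(N(\tfrac12)=+\infty),\qquad r_{2n+1}=1-\frac1{2\cos\frac{\pi}{2(2n+1)}}.$$ For $r<\frac12$ let $\Omega(r)$ be the regular Reuleaux polygon of width $1$ with $2N(r)+1$ sides if $r=r_{2N(r)+1}$, and otherwise the rigid Reuleaux polygon of width $1$ and inradius $r$ with $2N(r)+1$ sides whose boundary consists of exactly one cluster and of extremal sides. **Theorem.** Let $1-\frac1{\sqrt3}\le r\le\frac12$ and let $N\ge1$ be an integer. If $N<N(r)$, there is no Reuleaux polygon of width $1$ and inradius $r$ with at most $2N+1$ sides. If $N\ge N(r)$ (so $r<\frac12$), then $\Omega(r)$ exists and is unique up to rigid motion, and it is the unique minimizer, up to rigid motion, of the area among the Reuleaux polygons of width $1$ and inradius $r$ with at most $2N+1$ sides. -/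

import Mathlib

open MeasureTheory

noncomputable section

/- The Euclidean plane is `ℂ`: its norm, real inner product and `volume` are those of `ℝ²`. -/

/-- Width of `Ω` in the direction `ν`: the distance between the two supporting lines of `Ω`
orthogonal to the unit vector `ν`. -/
def widthIn (ν : ℂ) (Ω : Set ℂ) : ℝ :=
  sSup ((fun x => inner ℝ ν x) '' Ω) - sInf ((fun x => inner ℝ ν x) '' Ω)

/-- A convex body (compact, convex, with nonempty interior) of constant width `1`. -/
structure IsBodyOfWidthOne (Ω : Set ℂ) : Prop where
  isCompact : IsCompact Ω
  convex : Convex ℝ Ω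
  interior_nonempty : (interior Ω).Nonempty
  width_eq : ∀ ν : ℂ, ‖ν‖ = 1 → widthIn ν Ω = 1

/-- `r` is the inradius of `Ω`: the largest radius of an open disk contained in `Ω`. -/
def HasInradius (Ω : Set ℂ) (r : ℝ) : Prop :=
  IsGreatest {ρ : ℝ | ∃ c : ℂ, Metric.ball c ρ ⊆ Ω} r

/-- The circular arc `{p + e^{it} : t ∈ [a, b]}` of radius `1` centered at `p`. -/
def unitArc (p : ℂ) (a b : ℝ) : Set ℂ :=
  (fun t : ℝ => p + Complex.exp (t * Complex.I)) '' Set.Icc a b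

/-- A Reuleaux polygon of width `1` with `2n+1` sides: a convex body of constant width `1` whose
boundary consists of `2n+1` arcs `Γ_k = {P_k + e^{it} : t ∈ [α_k, β_k]}` of circles of radius `1`,
where `Γ_k` is opposite to the vertex `P_k` and goes counterclockwise from the vertex `P_{k+1}` to
the vertex `P_{k-1}`. Indices are modulo `2n+1`; the vertices are distinct, so that no side is
counted twice. -/
structure ReuleauxPolygon (n : ℕ) where
  body : Set ℂ
  vertex : ZMod (2 * n + 1) → ℂ
  α : ZMod (2 * n + 1) → ℝ
  β : ZMod (2 * n + 1) → ℝ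
  isBody : IsBodyOfWidthOne body
  vertex_injective : Function.Injective vertex
  α_lt_β : ∀ k, α k < β k
  vertex_succ : ∀ k, vertex (k + 1) = vertex k + Complex.exp (α k * Complex.I)
  vertex_pred : ∀ k, vertex (k - 1) = vertex k + Complex.exp (β k * Complex.I)
  frontier_eq : frontier body = ⋃ k, unitArc (vertex k) (α k) (β k)

namespace ReuleauxPolygon

variable {n : ℕ}

/-- The side `Γ_k`, opposite to the vertex `P_k`. -/
def side (P : ReuleauxPolygon n) (k : ZMod (2 * n + 1)) : Set ℂ :=
  unitArc (P.vertex k) (P.α k) (P.β k)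

/-- All sides have the same length. -/
def IsRegular (P : ReuleauxPolygon n) : Prop :=
  ∀ j k, P.β j - P.α j = P.β k - P.α k

/-- The side `Γ_k` is tangent to the circle of center `c` and radius `r`. It is used when the open
disk bounded by this circle is contained in the body; as `Γ_k` is a boundary arc, it is then
tangent to the circle as soon as it meets it. -/
def IsTangentSide (P : ReuleauxPolygon n) (c : ℂ) (r : ℝ) (k : ZMod (2 * n + 1)) : Prop :=
  (P.side k ∩ Metric.sphere c r).Nonempty

/-- The side `Γ_k` is extremal: tangent to the incircle (center `c`, radius `r`), with both
endpoints `P_{k+1}`, `P_{k-1}` on the outercircle (center `c`, radius `1 - r`). -/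
def IsExtremalSide (P : ReuleauxPolygon n) (c : ℂ) (r : ℝ) (k : ZMod (2 * n + 1)) : Prop :=
  P.IsTangentSide c r k ∧
    P.vertex (k + 1) ∈ Metric.sphere c (1 - r) ∧ P.vertex (k - 1) ∈ Metric.sphere c (1 - r)

/-- The sides `Γ_{k-1}`, `Γ_k`, `Γ_{k+1}` form a cluster: `Γ_{k-1}` and `Γ_{k+1}` are tangent to
the incircle, their common point `P_k` is in the interior of the annulus, and their other
endpoints `P_{k-2}`, `P_{k+2}` are on the outercircle. -/
def IsCluster (P : ReuleauxPolygon n) (c : ℂ) (r : ℝ) (k : ZMod (2 * n + 1)) : Prop :=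
  P.IsTangentSide c r (k - 1) ∧ P.IsTangentSide c r (k + 1) ∧
    r < dist (P.vertex k) c ∧ dist (P.vertex k) c < 1 - r ∧
    P.vertex (k - 2) ∈ Metric.sphere c (1 - r) ∧ P.vertex (k + 2) ∈ Metric.sphere c (1 - r)

/-- The boundary is made of exactly one cluster and of extremal sides (`c` is the center of the
incircle when `r` is the inradius). -/
def HasOneCluster (P : ReuleauxPolygon n) (r : ℝ) : Prop :=
  ∃ c : ℂ, Metric.ball c r ⊆ P.body ∧
    ∃ k, P.IsCluster c r k ∧ (∀ j, P.IsCluster c r j → j = k) ∧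
      ∀ j, j ≠ k - 1 → j ≠ k → j ≠ k + 1 → P.IsExtremalSide c r j

/-- `P'` is obtained from `P` by the Blaschke deformation acting on the vertex `P_k`: the vertex
`P_k` moves on the circle of the side `Γ_{k-1}` (it stays at distance `1` from `P_{k-1}`), the
vertex `P_{k+1}` moves accordingly, all other vertices stay fixed, and the result is again a
Reuleaux polygon. -/
def IsBlaschkeDeformation (P P' : ReuleauxPolygon n) (k : ZMod (2 * n + 1)) : Prop :=
  ∀ j, j ≠ k → j ≠ k + 1 → P'.vertex j = P.vertex j

/-- Rigidity: no Blaschke deformation that keeps the inradius equal to `r` decreases the area. -/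
def IsRigid (P : ReuleauxPolygon n) (r : ℝ) : Prop :=
  ∀ (P' : ReuleauxPolygon n) (k : ZMod (2 * n + 1)), P.IsBlaschkeDeformation P' k →
    HasInradius P'.body r → volume P.body ≤ volume P'.body

end ReuleauxPolygon

/-- Admissible shapes: Reuleaux polygons of width `1` and inradius `r` with at most `2N+1`
sides. -/
def IsAdmissible (N : ℕ) (r : ℝ) (Ω : Set ℂ) : Prop :=
  HasInradius Ω r ∧ ∃ n ≤ N, ∃ P : ReuleauxPolygon n, P.body = Ω

/-- Minimizers of the area among the admissible shapes. -/
def IsAreaMinimizer (N : ℕ) (r : ℝ) (Ω : Set ℂ) : Prop :=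
  IsAdmissible N r Ω ∧ ∀ Ω' : Set ℂ, IsAdmissible N r Ω' → volume Ω ≤ volume Ω'

/-- `ℓ(r) = 2 arctan √(4(1-r)² - 1)`. -/
def extremalLength (r : ℝ) : ℝ :=
  2 * Real.arctan (Real.sqrt (4 * (1 - r) ^ 2 - 1))

/-- `N(r) = ⌈π / (2ℓ(r)) - 1/2⌉`, for `1 - 1/√3 ≤ r < 1/2` (then the number under the ceiling is
at least `1`). -/
def sideNumber (r : ℝ) : ℕ :=
  ⌈Real.pi / (2 * extremalLength r) - 1 / 2⌉₊

/-- The inradius `r_{2n+1}` of the regular Reuleaux polygon with `2n+1` sides. -/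
def regularInradius (n : ℕ) : ℝ :=
  1 - 1 / (2 * Real.cos (Real.pi / (2 * (2 * n + 1))))

/-- `Ω` is (a copy of) the shape `Ω(r)`: the regular Reuleaux polygon with `2N(r)+1` sides if
`r = r_{2N(r)+1}`, and otherwise the rigid shape of inradius `r` with `2N(r)+1` sides and exactly
one cluster. -/
def IsOmega (r : ℝ) (Ω : Set ℂ) : Prop :=
  ∃ P : ReuleauxPolygon (sideNumber r), P.body = Ω ∧
    ((r = regularInradius (sideNumber r) ∧ P.IsRegular) ∨
      (r ≠ regularInradius (sideNumber r) ∧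
        HasInradius P.body r ∧ P.IsRigid r ∧ P.HasOneCluster r))

/-- `Ω'` is the image of `Ω` under an orientation-preserving rigid motion of the plane. -/
def IsRigidMotionImage (Ω Ω' : Set ℂ) : Prop :=
  ∃ u v : ℂ, ‖u‖ = 1 ∧ Ω' = (fun z => u * z + v) '' Ω

end

/-! Put R = 1 - r and let ℓ = `chordAngle R`. Seen from the center of a disk of radius r contained
in the body, all vertices lie in the closed disk of radius R. Joined in order by unit edges they
form a closed star-shaped chain whose angles are the angular lengths of the sides, with sum π
(`sum_chainAngle`, `isStarChain`). Cutting the body into cones over its sides gives the area as π/2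
- `crossSum`, where `crossSum` is twice the algebraic area of the chain (`volume_body`). The theorem
becomes an isoperimetric problem: maximize the area enclosed by a star chain in a disk of radius R.

Over each edge stands a triangle whose apex is the center. Its signed height is the contribution of
the edge to `crossSum`, and the sum of its base angles is its defect; the defects add up to π
(`defect_sum`). Every angle of the chain is at most ℓ, so (2n+1)ℓ ≥ π, which excludes N < N(r).

A maximizing chain exists by compactness. If one of its angles vanishes, two edges cancel and n can
be lowered (`exists_remove`). Otherwise two consecutive vertices are never both in the open disk,
since the linkage of three edges through them could be moved so as to enclose more area
(`exists_larger_linkage`). Hence each triangle has a leg of length R, and its height is a strictly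
convex function of its defect (`strictConvexOn_height`). The two triangles at an inner vertex are
mirror images, so defects can be attached to vertices. Convexity then pushes all vertex defects but
one to the extreme value ℓ. This yields `crossSum_le`, with equality only if at most one vertex is
off the circle and n = N(r) (`exists_hasAtMostOneInner`).

Such a chain is unique up to rotation and relabeling, because its triangles are determined
(`exists_rotation`). It exists: the prescribed triangles are laid side by side (`exists_of_apex`),
and the unit disks centered at the vertices intersect in a Reuleaux polygon
(`exists_reuleauxPolygon`). The inradius is r because three consecutive vertices on the circle have
the center in their convex hull (`radius_le_of_norm_sub_le`). Finally the minimizers and the shapes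
Ω(r) are both identified with the polygons having all vertices but at most one on the outercircle
(`isAreaMinimizer_iff`, `isOmega_iff`); rigidity holds because the area is globally minimal. -/

/-! ### The extremal angle and the lens of admissible triangle apexes -/

/-- The apex defect of an isosceles triangle with unit base and legs `R`. -/
noncomputable def chordAngle (R : ℝ) : ℝ := 2 * Real.arctan (Real.sqrt (4 * R ^ 2 - 1))

theorem chordAngle_nonneg (R : ℝ) : 0 ≤ chordAngle R := by
  have := Real.arctan_nonneg.2 (Real.sqrt_nonneg (4 * R ^ 2 - 1))
  unfold chordAngle; linarith

theorem chordAngle_lt_pi (R : ℝ) : chordAngle R < Real.pi := by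
  have := Real.arctan_lt_pi_div_two (Real.sqrt (4 * R ^ 2 - 1))
  unfold chordAngle; linarith

theorem cos_half_chordAngle {R : ℝ} (hR : 1 / 2 ≤ R) : Real.cos (chordAngle R / 2) = 1 / (2 * R) := by
  have h : chordAngle R / 2 = Real.arctan (Real.sqrt (4 * R ^ 2 - 1)) := by unfold chordAngle; ring
  rw [h, Real.cos_arctan, Real.sq_sqrt (by nlinarith)]
  have : (1 + (4 * R ^ 2 - 1) : ℝ) = (2 * R) ^ 2 := by ring
  rw [this, Real.sqrt_sq (by linarith)]

theorem chordAngle_pos {R : ℝ} (hR : 1 / 2 < R) : 0 < chordAngle R := by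
  have : 0 < Real.arctan (Real.sqrt (4 * R ^ 2 - 1)) :=
    Real.arctan_pos.2 (Real.sqrt_pos.2 (by nlinarith))
  unfold chordAngle; linarith

/-- The bound 3R² ≤ 1 is the lower bound on r, with equality for the Reuleaux triangle. It keeps all
base angles within π/6 of 0, which later removes every ambiguity modulo 2π. -/
theorem chordAngle_le {R : ℝ} (hR : 1 / 2 ≤ R) (hR3 : 3 * R ^ 2 ≤ 1) :
    chordAngle R ≤ Real.pi / 3 := by
  have h1 := cos_half_chordAngle hR
  have h2 : Real.cos (Real.pi / 6) ≤ Real.cos (chordAngle R / 2) := by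
    rw [h1, Real.cos_pi_div_six, div_le_div_iff₀ (by norm_num) (by linarith)]
    have : (Real.sqrt 3 * R) ^ 2 ≤ 1 ^ 2 := by
      rw [mul_pow, Real.sq_sqrt (by norm_num)]; linarith
    have := abs_le_of_sq_le_sq this (by norm_num)
    nlinarith [(abs_le.1 this).2]
  have h3 : chordAngle R / 2 ≤ Real.pi / 6 := by
    by_contra h
    push Not at h
    have := Real.cos_lt_cos_of_nonneg_of_le_pi (by positivity)
      (by have := chordAngle_lt_pi R; have := chordAngle_nonneg R; linarith) h
    linarith
  linarith

theorem chordAngle_zero_half : chordAngle (1 / 2) = 0 := by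
  unfold chordAngle; norm_num

/-- The lens of points at distance at most `R` from `0` and `1`. -/
def lens (R : ℝ) : Set ℂ := {z | ‖z‖ ≤ R ∧ ‖1 - z‖ ≤ R}

theorem Complex.sq_norm_eq (z : ℂ) : ‖z‖ ^ 2 = z.re ^ 2 + z.im ^ 2 := by
  rw [Complex.sq_norm, Complex.normSq_apply]; ring

theorem Complex.sq_norm_one_sub (z : ℂ) : ‖1 - z‖ ^ 2 = 1 - 2 * z.re + ‖z‖ ^ 2 := by
  rw [Complex.sq_norm_eq, Complex.sq_norm_eq]; simp; ring

theorem lens_one_sub {R : ℝ} {z : ℂ} (hz : z ∈ lens R) : 1 - z ∈ lens R :=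
  ⟨hz.2, by simpa using hz.1⟩

theorem lens_re_pos {R : ℝ} (hR3 : 3 * R ^ 2 ≤ 1) {z : ℂ} (hz : z ∈ lens R) : 0 < z.re := by
  have h1 := Complex.sq_norm_one_sub z
  have h2 : ‖1 - z‖ ^ 2 ≤ R ^ 2 := pow_le_pow_left₀ (norm_nonneg _) hz.2 2
  nlinarith [sq_nonneg ‖z‖]

theorem lens_norm_pos {R : ℝ} (hR3 : 3 * R ^ 2 ≤ 1) {z : ℂ} (hz : z ∈ lens R) : 0 < ‖z‖ :=
  lt_of_lt_of_le (lens_re_pos hR3 hz) (Complex.re_le_norm z)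

theorem lens_ne_zero {R : ℝ} (hR3 : 3 * R ^ 2 ≤ 1) {z : ℂ} (hz : z ∈ lens R) : z ≠ 0 :=
  norm_pos_iff.1 (lens_norm_pos hR3 hz)

/-- In terms of the argument this is cos(arg z) ≥ 1/(2R) = cos(ℓ/2): seen from 0, the corners of the
lens are its extreme directions. -/
theorem lens_norm_le_re {R : ℝ} (hR : 1 / 2 ≤ R) (hR3 : 3 * R ^ 2 ≤ 1) {z : ℂ} (hz : z ∈ lens R) :
    ‖z‖ ≤ 2 * R * z.re := by
  have h1 := Complex.sq_norm_one_sub z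
  have h2 : ‖1 - z‖ ^ 2 ≤ R ^ 2 := pow_le_pow_left₀ (norm_nonneg _) hz.2 2
  have h3 := hz.1
  have h4 := norm_nonneg z
  -- The product is R(1 + ‖z‖² - R²) - ‖z‖ in factored form, while ‖1 - z‖ ≤ R says 2 re z ≥ 1 +
  -- ‖z‖² - R². The second factor is at least 1 - 2R² > 0.
  have h5 : 0 ≤ (R - ‖z‖) * ((1 - R ^ 2) - R * ‖z‖) :=
    mul_nonneg (by linarith) (by nlinarith)
  nlinarith

theorem lens_norm_eq_of_re_le {R : ℝ} (hR : 1 / 2 ≤ R) (hR3 : 3 * R ^ 2 ≤ 1) {z : ℂ}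
    (hz : z ∈ lens R) (h : 2 * R * z.re ≤ ‖z‖) : ‖z‖ = R := by
  by_contra hne
  have h1 := Complex.sq_norm_one_sub z
  have h2 : ‖1 - z‖ ^ 2 ≤ R ^ 2 := pow_le_pow_left₀ (norm_nonneg _) hz.2 2
  have h3 := lt_of_le_of_ne hz.1 hne
  have h4 := norm_nonneg z
  have h5 : 0 < (R - ‖z‖) * ((1 - R ^ 2) - R * ‖z‖) :=
    mul_pos (by linarith) (by nlinarith)
  nlinarith

theorem lens_abs_arg_le {R : ℝ} (hR : 1 / 2 ≤ R) (hR3 : 3 * R ^ 2 ≤ 1) {z : ℂ} (hz : z ∈ lens R) :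
    |Complex.arg z| ≤ chordAngle R / 2 := by
  have h0 := lens_ne_zero hR3 hz
  have hn := lens_norm_pos hR3 hz
  have h1 : Real.cos (chordAngle R / 2) ≤ Real.cos |Complex.arg z| := by
    rw [cos_half_chordAngle hR, Real.cos_abs, Complex.cos_arg h0,
      div_le_div_iff₀ (by linarith) hn]
    have := lens_norm_le_re hR hR3 hz
    linarith
  by_contra h
  push Not at h
  have := Real.cos_lt_cos_of_nonneg_of_le_pi (by have := chordAngle_nonneg R; linarith)
    (Complex.abs_arg_le_pi z) h
  linarith

theorem lens_norm_eq_of_arg {R : ℝ} (hR : 1 / 2 ≤ R) (hR3 : 3 * R ^ 2 ≤ 1) {z : ℂ}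
    (hz : z ∈ lens R) (h : Complex.arg z = chordAngle R / 2) : ‖z‖ = R := by
  have h0 := lens_ne_zero hR3 hz
  have hn := lens_norm_pos hR3 hz
  have h1 := Complex.cos_arg h0
  rw [h, cos_half_chordAngle hR, div_eq_div_iff (by linarith) hn.ne'] at h1
  exact lens_norm_eq_of_re_le hR hR3 hz (by linarith)

/-- The apex defect of the triangle with vertices `0`, `1`, `z`: the sum of the signed base
angles. -/
noncomputable def defect (z : ℂ) : ℝ := Complex.arg z - Complex.arg (1 - z)

/-- The height of a triangle with unit base and one leg `R`, as a function of the apex defect. -/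
noncomputable def height (R x : ℝ) : ℝ := R * Real.sin (x - Real.arcsin (R * Real.sin x))

/-- The map is the reflection in the line re = 1/2, which exchanges the two base angles. Positivity
of the real parts avoids the branch cut of `arg`. -/
theorem defect_one_sub_conj {z : ℂ} (h : 0 < z.re) (h' : 0 < (1 - z).re) :
    defect (1 - (starRingEnd ℂ) z) = defect z := by
  unfold defect
  have h1 : (1 : ℂ) - (starRingEnd ℂ) z = (starRingEnd ℂ) (1 - z) := by simp
  have h2 : (1 : ℂ) - (1 - (starRingEnd ℂ) z) = (starRingEnd ℂ) z := by ring
  rw [h2, h1, Complex.arg_conj, Complex.arg_conj, if_neg, if_neg]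
  · ring
  · intro h3; rw [Complex.arg_eq_pi_iff] at h3; linarith [h3.1]
  · intro h3; rw [Complex.arg_eq_pi_iff] at h3; linarith [h3.1]

/-- Law of sines: the leg R is opposite to the base angle w at 1, and the unit base is opposite to
the apex angle, whose sine is that of the defect. Thus sin w = R sin(defect), and |w| ≤ π/2 lets
`arcsin` recover w. -/
theorem im_eq_height_of_norm_eq {R : ℝ} (hR3 : 3 * R ^ 2 ≤ 1) {z : ℂ}
    (hz : z ∈ lens R) (h : ‖z‖ = R) : z.im = height R (defect z) := by
  set u := Complex.arg z with hu
  set w := -Complex.arg (1 - z) with hw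
  have h0 := lens_ne_zero hR3 hz
  have h0' := lens_ne_zero hR3 (lens_one_sub hz)
  have c1 : ‖z‖ * Real.cos u = z.re := Complex.norm_mul_cos_arg z
  have s1 : ‖z‖ * Real.sin u = z.im := Complex.norm_mul_sin_arg z
  have c2 : ‖1 - z‖ * Real.cos w = 1 - z.re := by
    rw [hw, Real.cos_neg, Complex.norm_mul_cos_arg]; simp
  have s2 : ‖1 - z‖ * Real.sin w = z.im := by
    rw [hw, Real.sin_neg, mul_neg, Complex.norm_mul_sin_arg]; simp
  have hsin : R * Real.sin (defect z) = Real.sin w := by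
    have hd : defect z = u + w := by rw [hu, hw, defect]; ring
    rw [hd, Real.sin_add, ← h]
    have e : ‖z‖ * (Real.sin u * Real.cos w + Real.cos u * Real.sin w)
        = (‖z‖ * Real.sin u) * Real.cos w + (‖z‖ * Real.cos u) * Real.sin w := by ring
    rw [e, s1, c1, ← s2]
    calc ‖1 - z‖ * Real.sin w * Real.cos w + z.re * Real.sin w
        = (‖1 - z‖ * Real.cos w + z.re) * Real.sin w := by ring
      _ = _ := by rw [c2]; ring
  have hwr : |w| ≤ Real.pi / 2 := by
    rw [hw, abs_neg, Complex.abs_arg_le_pi_div_two_iff]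
    exact (lens_re_pos hR3 (lens_one_sub hz)).le
  rw [abs_le] at hwr
  have : defect z - w = u := by rw [hu, hw, defect]; ring
  rw [height, hsin, Real.arcsin_sin hwr.1 hwr.2, this, ← h, s1]

theorem im_eq_height {R : ℝ} (hR3 : 3 * R ^ 2 ≤ 1) {z : ℂ}
    (hz : z ∈ lens R) (h : ‖z‖ = R ∨ ‖1 - z‖ = R) : z.im = height R (defect z) := by
  rcases h with h | h
  · exact im_eq_height_of_norm_eq hR3 hz h
  · have hz' : 1 - (starRingEnd ℂ) z ∈ lens R := by
      have e : (1 : ℂ) - (starRingEnd ℂ) z = (starRingEnd ℂ) (1 - z) := by simp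
      refine ⟨?_, ?_⟩
      · rw [e, Complex.norm_conj]; exact hz.2
      · rw [e]; have : (1 : ℂ) - (starRingEnd ℂ) (1 - z) = (starRingEnd ℂ) z := by simp
        rw [this, Complex.norm_conj]; exact hz.1
    have hn : ‖1 - (starRingEnd ℂ) z‖ = R := by
      have e : (1 : ℂ) - (starRingEnd ℂ) z = (starRingEnd ℂ) (1 - z) := by simp
      rw [e, Complex.norm_conj]; exact h
    have := im_eq_height_of_norm_eq hR3 hz' hn
    rw [defect_one_sub_conj (lens_re_pos hR3 hz) (lens_re_pos hR3 (lens_one_sub hz))] at this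
    rw [← this]; simp

theorem defect_lt {R : ℝ} (hR : 1 / 2 ≤ R) (hR3 : 3 * R ^ 2 ≤ 1) {z : ℂ} (hz : z ∈ lens R)
    (h : ‖z‖ < R) : defect z < chordAngle R := by
  have h1 := abs_le.1 (lens_abs_arg_le hR hR3 hz)
  have h2 := abs_le.1 (lens_abs_arg_le hR hR3 (lens_one_sub hz))
  have h3 : Complex.arg z ≠ chordAngle R / 2 := fun h' =>
    h.ne (lens_norm_eq_of_arg hR hR3 hz h')
  have h4 := lt_of_le_of_ne h1.2 h3
  unfold defect; linarith [h2.1]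

theorem defect_pos {z : ℂ} (h : 0 < z.im) : 0 < defect z := by
  have h1 : 0 < Complex.arg z := by
    have := Complex.arg_nonneg_iff.2 h.le
    refine lt_of_le_of_ne this fun h' => ?_
    have := Complex.norm_mul_sin_arg z
    rw [← h', Real.sin_zero, mul_zero] at this
    linarith
  have h2 : Complex.arg (1 - z) < 0 := Complex.arg_neg_iff.2 (by simpa using h)
  unfold defect; linarith

theorem defect_eq_of_norm_eq {R : ℝ} (hR : 1 / 2 ≤ R) {z : ℂ}
    (h : ‖z‖ = R) (h' : ‖1 - z‖ = R) (him : 0 < z.im) : Complex.arg z = chordAngle R / 2 ∧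
      Complex.arg (1 - z) = - (chordAngle R / 2) := by
  have h1 := Complex.sq_norm_one_sub z
  have hre : z.re = 1 / 2 := by rw [h, h'] at h1; linarith
  have hz0 : z ≠ 0 := by intro h0; simp [h0] at him
  have hz1 : 1 - z ≠ 0 := by
    intro h0; have := congrArg Complex.im h0; simp at this; linarith
  have e1 : Real.cos (Complex.arg z) = Real.cos (chordAngle R / 2) := by
    rw [Complex.cos_arg hz0, hre, h, cos_half_chordAngle hR, div_div]
  have e2 : Real.cos (-Complex.arg (1 - z)) = Real.cos (chordAngle R / 2) := by
    rw [Real.cos_neg, Complex.cos_arg hz1, h', cos_half_chordAngle hR]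
    simp [hre]; norm_num; ring
  have hc1 := chordAngle_nonneg R
  have hc2 := chordAngle_lt_pi R
  have a1 := Complex.arg_nonneg_iff.2 him.le
  have a2 : Complex.arg (1 - z) < 0 := Complex.arg_neg_iff.2 (by simpa using him)
  have b1 := Real.injOn_cos ⟨a1, Complex.arg_le_pi z⟩ ⟨by linarith, by linarith⟩ e1
  have b2 := Real.injOn_cos ⟨by linarith, by linarith [Complex.neg_pi_lt_arg (1 - z)]⟩
    ⟨by linarith, by linarith⟩ e2
  exact ⟨b1, by linarith⟩

/-! ### Strict convexity of the height -/

/-- The base angle at the vertex at distance `R` from the apex. -/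
noncomputable def baseAngle (R x : ℝ) : ℝ := x - Real.arcsin (R * Real.sin x)

theorem height_eq (R x : ℝ) : height R x = R * Real.sin (baseAngle R x) := rfl

theorem baseAngle_zero (R : ℝ) : baseAngle R 0 = 0 := by simp [baseAngle]

theorem height_zero (R : ℝ) : height R 0 = 0 := by simp [height_eq, baseAngle_zero]

theorem baseAngle_chordAngle {R : ℝ} (hR : 1 / 2 ≤ R) :
    baseAngle R (chordAngle R) = chordAngle R / 2 := by
  have hc := cos_half_chordAngle hR
  have h1 := chordAngle_nonneg R
  have h2 := chordAngle_lt_pi R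
  have : R * Real.sin (chordAngle R) = Real.sin (chordAngle R / 2) := by
    have e : chordAngle R = 2 * (chordAngle R / 2) := by ring
    rw [e, Real.sin_two_mul, hc]
    have : (R : ℝ) ≠ 0 := by linarith
    field_simp
  rw [baseAngle, this, Real.arcsin_sin (by linarith) (by linarith)]; ring

theorem sin_arcsin_mul {R : ℝ} (hR0 : 0 ≤ R) (hR1 : R < 1) (x : ℝ) :
    Real.sin (Real.arcsin (R * Real.sin x)) = R * Real.sin x := by
  have := Real.neg_one_le_sin x
  have := Real.sin_le_one x
  exact Real.sin_arcsin (by nlinarith) (by nlinarith)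

theorem cos_arcsin_mul_pos {R : ℝ} (hR0 : 0 ≤ R) (hR1 : R < 1) (x : ℝ) :
    0 < Real.cos (Real.arcsin (R * Real.sin x)) := by
  rw [Real.cos_arcsin]
  apply Real.sqrt_pos.2
  have := Real.sin_sq_le_one x
  rw [mul_pow]
  nlinarith [sq_nonneg (Real.sin x)]

theorem hasDerivAt_baseAngle {R : ℝ} (hR0 : 0 ≤ R) (hR1 : R < 1) (x : ℝ) :
    HasDerivAt (baseAngle R)
      (1 - R * Real.cos x / Real.cos (Real.arcsin (R * Real.sin x))) x := by
  have h1 := Real.neg_one_le_sin x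
  have h2 := Real.sin_le_one x
  have h := (Real.hasDerivAt_arcsin (x := R * Real.sin x) (by nlinarith) (by nlinarith)).comp x
    ((Real.hasDerivAt_sin x).const_mul R)
  have h3 := (hasDerivAt_id x).sub h
  have e : 1 - R * Real.cos x / Real.cos (Real.arcsin (R * Real.sin x))
      = 1 - 1 / √(1 - (R * Real.sin x) ^ 2) * (R * Real.cos x) := by
    rw [Real.cos_arcsin]; ring
  rw [e]
  exact h3

theorem deriv_baseAngle_pos {R : ℝ} (hR0 : 0 ≤ R) (hR1 : R < 1) (x : ℝ) :
    0 < 1 - R * Real.cos x / Real.cos (Real.arcsin (R * Real.sin x)) := by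
  have hc := cos_arcsin_mul_pos hR0 hR1 x
  rw [sub_pos, div_lt_one hc, Real.cos_arcsin]
  apply Real.lt_sqrt_of_sq_lt
  have h1 := Real.sin_sq_add_cos_sq x
  have h2 : (R * Real.cos x) ^ 2 + (R * Real.sin x) ^ 2 = R ^ 2 := by
    linear_combination R ^ 2 * h1
  nlinarith

theorem strictMono_baseAngle {R : ℝ} (hR0 : 0 ≤ R) (hR1 : R < 1) : StrictMono (baseAngle R) :=
  strictMono_of_hasDerivAt_pos (fun x => hasDerivAt_baseAngle hR0 hR1 x)
    (fun x => deriv_baseAngle_pos hR0 hR1 x)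

/-- With X = R cos v the abscissa of the apex, the derivative is X(1 + R² - 2X)/(1 - X), a function
of X alone. The law of sines (k1, k2) and the law of cosines for the other leg, of square 1 + R² -
2X (k3), eliminate x after multiplication by sin² x; hence the hypothesis on sin x. -/
theorem deriv_height {R : ℝ} (hR0 : 0 ≤ R) (hR1 : R < 1) {x : ℝ} (hx : Real.sin x ≠ 0) :
    deriv (height R) x = (R * Real.cos (baseAngle R x)) *
      (1 + R ^ 2 - 2 * (R * Real.cos (baseAngle R x))) / (1 - R * Real.cos (baseAngle R x)) := by
  have hd : HasDerivAt (height R) (R * (Real.cos (baseAngle R x) *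
      (1 - R * Real.cos x / Real.cos (Real.arcsin (R * Real.sin x))))) x :=
    ((hasDerivAt_baseAngle hR0 hR1 x).sin).const_mul R
  rw [hd.deriv]
  set u := Real.arcsin (R * Real.sin x) with hu
  have hcu : 0 < Real.cos u := cos_arcsin_mul_pos hR0 hR1 x
  have hsu : Real.sin u = R * Real.sin x := sin_arcsin_mul hR0 hR1 x
  set v := baseAngle R x with hv
  have hxv : x = u + v := by rw [hv, baseAngle, ← hu]; ring
  have h1 : (1 - R * Real.cos v) ≠ 0 := by
    have := Real.cos_le_one v
    nlinarith
  have k1 : Real.sin x * (1 - R * Real.cos v) = Real.cos u * Real.sin v := by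
    have : Real.sin x = Real.sin u * Real.cos v + Real.cos u * Real.sin v := by
      rw [hxv, Real.sin_add]
    linear_combination (1 : ℝ) * this + Real.cos v * hsu
  have k2 : Real.sin x * (Real.cos u - R * Real.cos x) = Real.sin v := by
    have hvx : v = x - u := by linarith
    rw [hvx, Real.sin_sub, hsu]; ring
  have k3 : Real.sin v ^ 2 = Real.sin x ^ 2 * (1 + R ^ 2 - 2 * (R * Real.cos v)) := by
    have hvx : v = x - u := by linarith
    have c1 := Real.sin_sq_add_cos_sq x
    have c2 := Real.sin_sq_add_cos_sq u
    rw [hvx, Real.sin_sub, Real.cos_sub]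
    have hR2 : Real.sin x ^ 2 * R ^ 2 = Real.sin u ^ 2 := by rw [hsu]; ring
    have e1 : Real.sin x ^ 2 * (1 + R ^ 2 - 2 * (R * (Real.cos x * Real.cos u + Real.sin x * Real.sin u)))
      = Real.sin x ^ 2 + Real.sin u ^ 2 - 2 * Real.sin x * Real.sin u * (Real.cos x * Real.cos u + Real.sin x * Real.sin u) := by
      rw [hsu]; ring
    rw [e1]
    have c1' : Real.cos x ^ 2 = 1 - Real.sin x ^ 2 := by linarith
    have c2' : Real.cos u ^ 2 = 1 - Real.sin u ^ 2 := by linarith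
    ring_nf
    rw [c1', c2']; ring
  have key : (Real.cos u - R * Real.cos x) * (1 - R * Real.cos v)
      = (1 + R ^ 2 - 2 * (R * Real.cos v)) * Real.cos u := by
    have hs2 : Real.sin x ^ 2 ≠ 0 := pow_ne_zero 2 hx
    apply mul_left_cancel₀ hs2
    calc _ = (Real.sin x * (Real.cos u - R * Real.cos x)) * (Real.sin x * (1 - R * Real.cos v)) := by ring
      _ = Real.sin v ^ 2 * Real.cos u := by rw [k1, k2]; ring
      _ = _ := by rw [k3]; ring
  rw [eq_div_iff h1]
  have : (1 - R * Real.cos x / Real.cos u) * (1 - R * Real.cos v) = 1 + R ^ 2 - 2 * (R * Real.cos v) := by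
    have : (1 - R * Real.cos x / Real.cos u) = (Real.cos u - R * Real.cos x) / Real.cos u := by
      field_simp
    rw [this, div_mul_eq_mul_div, key]; field_simp
  calc _ = R * Real.cos v * ((1 - R * Real.cos x / Real.cos u) * (1 - R * Real.cos v)) := by ring
    _ = _ := by rw [this]

theorem strictConvexOn_height {R : ℝ} (hR : 1 / 2 ≤ R) (hR3 : 3 * R ^ 2 ≤ 1) :
    StrictConvexOn ℝ (Set.Icc 0 (chordAngle R)) (height R) := by
  have hR0 : 0 ≤ R := by linarith
  have hR1 : R < 1 := by nlinarith
  refine StrictMonoOn.strictConvexOn_of_deriv (convex_Icc _ _) ?_ ?_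
  · apply Continuous.continuousOn
    unfold height
    fun_prop
  · rw [interior_Icc]
    have hl := chordAngle_lt_pi R
    have hmono := strictMono_baseAngle hR0 hR1
    have aux : ∀ x ∈ Set.Ioo 0 (chordAngle R), 0 ≤ baseAngle R x ∧ baseAngle R x ≤ chordAngle R / 2 ∧
        Real.sin x ≠ 0 := by
      intro x hx
      refine ⟨?_, ?_, (Real.sin_pos_of_pos_of_lt_pi hx.1 (by linarith [hx.2])).ne'⟩
      · rw [← baseAngle_zero R]; exact (hmono hx.1).le
      · rw [← baseAngle_chordAngle hR]; exact (hmono hx.2).le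
    intro x hx y hy hxy
    obtain ⟨x1, x2, x3⟩ := aux x hx
    obtain ⟨y1, y2, y3⟩ := aux y hy
    rw [deriv_height hR0 hR1 x3, deriv_height hR0 hR1 y3]
    have hcos : Real.cos (baseAngle R y) < Real.cos (baseAngle R x) :=
      Real.cos_lt_cos_of_nonneg_of_le_pi x1 (by linarith) (hmono hxy)
    have hcy : 1 / (2 * R) ≤ Real.cos (baseAngle R y) := by
      rw [← cos_half_chordAngle hR]
      exact Real.cos_le_cos_of_nonneg_of_le_pi y1 (by linarith) y2
    have hRp : 0 < R := by linarith
    have hY : 1 / 2 ≤ R * Real.cos (baseAngle R y) := by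
      rw [div_le_iff₀ (by linarith)] at hcy; linarith
    have hXY : R * Real.cos (baseAngle R y) < R * Real.cos (baseAngle R x) :=
      mul_lt_mul_of_pos_left hcos hRp
    have hX : R * Real.cos (baseAngle R x) < 1 := by
      have := Real.cos_le_one (baseAngle R x); nlinarith
    generalize R * Real.cos (baseAngle R y) = Y at *
    generalize R * Real.cos (baseAngle R x) = X at *
    rw [div_lt_div_iff₀ (by linarith) (by linarith)]
    -- As x grows, X decreases and stays at least 1/2. The cross-multiplied difference of the two
    -- derivatives is (X - Y)(2(1 - X)(1 - Y) - (1 - R²)), and the second factor is negative because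
    -- 2(1 - X)(1 - Y) < 1/2 < 2/3 ≤ 1 - R².
    have hb : 2 * (1 - X) * (1 - Y) - (1 - R ^ 2) < 0 := by nlinarith
    nlinarith [mul_pos (sub_pos.2 hXY) (neg_pos.2 hb)]

/-! ### A rearrangement inequality for convex functions -/

/-- Spreading two points apart with fixed sum increases the sum of a strictly convex function: x and
y are the convex combinations of w and z with exchanged weights. -/
theorem StrictConvexOn.add_lt_of_add_eq {f : ℝ → ℝ} {a b : ℝ} (hf : StrictConvexOn ℝ (Set.Icc a b) f)
    {w x y z : ℝ} (hw : a ≤ w) (hz : z ≤ b) (hwx : w < x) (hxz : x < z) (h : w + z = x + y) :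
    f x + f y < f w + f z := by
  have hwz : w < z := hwx.trans hxz
  set t := (z - x) / (z - w) with ht
  have h0 : 0 < t := div_pos (by linarith) (by linarith)
  have h1 : 0 < 1 - t := by
    rw [ht, sub_pos, div_lt_one (by linarith)]; linarith
  have e1 : t * w + (1 - t) * z = x := by
    rw [ht]; have : z - w ≠ 0 := by linarith
    field_simp; ring
  have e2 : (1 - t) * w + t * z = y := by
    linarith
  have a1 := hf.2 (x := w) ⟨hw, by linarith⟩ (y := z) ⟨by linarith, hz⟩ hwz.ne h0 h1 (by ring)
  have a2 := hf.2 (x := w) ⟨hw, by linarith⟩ (y := z) ⟨by linarith, hz⟩ hwz.ne h1 h0 (by ring)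
  simp only [smul_eq_mul] at a1 a2
  rw [e1] at a1; rw [e2] at a2
  linarith

theorem StrictConvexOn.add_le_of_add_eq {f : ℝ → ℝ} {a b : ℝ} (hf : StrictConvexOn ℝ (Set.Icc a b) f)
    {w x y z : ℝ} (hw : a ≤ w) (hz : z ≤ b) (hwx : w ≤ x) (hxz : x ≤ z) (h : w + z = x + y) :
    f x + f y ≤ f w + f z := by
  rcases hwx.eq_or_lt with rfl | h1
  · have : y = z := by linarith
    rw [this]
  rcases hxz.eq_or_lt with rfl | h2
  · have : y = w := by linarith
    rw [this, add_comm]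
  exact (hf.add_lt_of_add_eq hw hz h1 h2 h).le

/-- Among finite families in `[0, l]` of given sum, a strictly convex function vanishing at `0` has
the largest sum when at most one member is different from `0` and `l`. -/
theorem StrictConvexOn.sum_map_le {f : ℝ → ℝ} {l : ℝ} (hf : StrictConvexOn ℝ (Set.Icc 0 l) f)
    (h0 : f 0 = 0) (S : Multiset ℝ) (hS : ∀ x ∈ S, x ∈ Set.Icc 0 l) :
    ∀ (q : ℕ) (e : ℝ), 0 ≤ e → e ≤ l → S.sum = q * l + e → (S.map f).sum ≤ q * f l + f e := by
  induction S using Multiset.induction_on with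
  | empty =>
    intro q e he hel h
    simp only [Multiset.sum_zero, Multiset.map_zero] at h ⊢
    have h1 : 0 ≤ (q : ℝ) * l := mul_nonneg (Nat.cast_nonneg _) (he.trans hel)
    have h2 : e = 0 := by linarith
    rw [h2] at h ⊢
    have h3 : (q : ℝ) * l = 0 := by linarith
    rcases mul_eq_zero.1 h3 with h4 | h4
    · rw [h4, h0]; simp
    · rw [h4, h0]; simp
  | cons x S ih =>
    intro q e he hel h
    have hx := hS x (Multiset.mem_cons_self x S)
    have hS' : ∀ y ∈ S, y ∈ Set.Icc 0 l := fun y hy => hS y (Multiset.mem_cons_of_mem hy)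
    rw [Multiset.sum_cons] at h
    rw [Multiset.map_cons, Multiset.sum_cons]
    by_cases hxe : x ≤ e
    · have := ih hS' q (e - x) (by linarith) (by linarith [hx.1]) (by linarith)
      have h2 := hf.add_le_of_add_eq (w := 0) (x := x) (y := e - x) (z := e) le_rfl hel hx.1 hxe
        (by ring)
      linarith
    · push Not at hxe
      have hq : q ≠ 0 := by
        rintro rfl
        have : 0 ≤ S.sum := Multiset.sum_nonneg fun y hy => (hS' y hy).1
        simp at h; linarith
      obtain ⟨q, rfl⟩ := Nat.exists_eq_succ_of_ne_zero hq
      push_cast at h ⊢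
      -- Here x exceeds the remainder, so it is taken out of l + e, using up one full copy of l; the
      -- pair (x, l + e - x) is then spread to (e, l).
      have := ih hS' q (l + e - x) (by linarith [hx.2]) (by linarith) (by linarith)
      have h2 := hf.add_le_of_add_eq (w := e) (x := x) (y := l + e - x) (z := l) he le_rfl hxe.le
        hx.2 (by ring)
      linarith

/-- Two members strictly between 0 and l can be replaced by 0 and x + y, or by l and x + y - l,
whichever stays in [0, l]. This gains strictly, and the weak inequality applies to the new family.
-/
theorem StrictConvexOn.sum_map_lt {f : ℝ → ℝ} {l : ℝ} (hf : StrictConvexOn ℝ (Set.Icc 0 l) f)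
    (h0 : f 0 = 0) (S : Multiset ℝ) (hS : ∀ x ∈ S, x ∈ Set.Icc 0 l) {x y : ℝ}
    (hx : x ∈ Set.Ioo 0 l) (hy : y ∈ Set.Ioo 0 l)
    (q : ℕ) (e : ℝ) (he : 0 ≤ e) (hel : e ≤ l) (h : (x ::ₘ y ::ₘ S).sum = q * l + e) :
    ((x ::ₘ y ::ₘ S).map f).sum < q * f l + f e := by
  simp only [Multiset.map_cons, Multiset.sum_cons] at h ⊢
  rcases le_total (x + y) l with hl | hl
  · have h1 := hf.sum_map_le h0 ((x + y) ::ₘ S) (by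
      intro w hw
      rcases Multiset.mem_cons.1 hw with rfl | hw
      · exact ⟨by linarith [hx.1, hy.1], hl⟩
      · exact hS w hw) q e he hel (by rw [Multiset.sum_cons]; linarith)
    rw [Multiset.map_cons, Multiset.sum_cons] at h1
    have h2 := hf.add_lt_of_add_eq (w := 0) (x := x) (y := y) (z := x + y) le_rfl hl hx.1
      (by linarith [hy.1]) (by ring)
    linarith
  · have h1 := hf.sum_map_le h0 (l ::ₘ (x + y - l) ::ₘ S) (by
      intro w hw
      rcases Multiset.mem_cons.1 hw with rfl | hw
      · exact ⟨by linarith [hx.1, hx.2], le_rfl⟩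
      rcases Multiset.mem_cons.1 hw with rfl | hw
      · exact ⟨by linarith, by linarith [hx.2, hy.2]⟩
      · exact hS w hw) q e he hel (by rw [Multiset.sum_cons, Multiset.sum_cons]; linarith)
    simp only [Multiset.map_cons, Multiset.sum_cons] at h1
    have h2 := hf.add_lt_of_add_eq (w := x + y - l) (x := x) (y := y) (z := l) (by linarith) le_rfl
      (by linarith [hy.2]) hx.2 (by ring)
    linarith

/-! ### Closed chains of unit edges -/

theorem sum_range_periodic_succ {M : Type*} [AddCommGroup M] {m : ℕ} {f : ℕ → M}
    (hf : ∀ k, f (k + m) = f k) :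
    ∑ k ∈ Finset.range m, f (k + 1) = ∑ k ∈ Finset.range m, f k := by
  have h1 := Finset.sum_range_succ f m
  have h2 := Finset.sum_range_succ' f m
  have h3 := hf 0
  rw [zero_add] at h3
  rw [h1, h3] at h2
  exact (add_right_cancel h2).symm

theorem sum_range_periodic_add {M : Type*} [AddCommGroup M] {m : ℕ} {f : ℕ → M}
    (hf : ∀ k, f (k + m) = f k) (j : ℕ) :
    ∑ k ∈ Finset.range m, f (k + j) = ∑ k ∈ Finset.range m, f k := by
  induction j with
  | zero => simp
  | succ j ih =>
    rw [← ih, ← sum_range_periodic_succ (f := fun k => f (k + j))]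
    · exact Finset.sum_congr rfl fun k _ => by congr 1; ring
    · intro k; rw [← hf (k + j)]; congr 1; ring

theorem periodic_mod {M : Type*} {m : ℕ} {f : ℕ → M}
    (hf : ∀ k, f (k + m) = f k) (k : ℕ) : f (k % m) = f k := by
  have : Function.Periodic f m := hf
  exact this.map_mod_nat k

/-- The cross product of two plane vectors. -/
def cross (z w : ℂ) : ℝ := z.re * w.im - z.im * w.re

/-- The edges of a polygonal chain. -/
def edge (Q : ℕ → ℂ) (k : ℕ) : ℂ := Q (k + 1) - Q k

/-- The position of the origin in the frame where `Q k` is `0` and `Q (k + 1)` is `1`. -/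
def apex (Q : ℕ → ℂ) (k : ℕ) : ℂ := -Q k * (starRingEnd ℂ) (edge Q k)

/-- Twice the algebraic area enclosed by a closed chain with `2 * n + 1` edges. -/
def crossSum (n : ℕ) (Q : ℕ → ℂ) : ℝ := ∑ k ∈ Finset.range (2 * n + 1), cross (Q k) (Q (k + 1))

/-- A closed star-shaped chain of `2 * n + 1` unit edges with vertices `Q k` in the disk of radius
`R`, whose angles at the vertices are `p k` with total `π`. -/
structure IsStarChain (n : ℕ) (R : ℝ) (Q : ℕ → ℂ) (p : ℕ → ℝ) : Prop where
  vertex_periodic : ∀ k, Q (k + (2 * n + 1)) = Q k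
  angle_periodic : ∀ k, p (k + (2 * n + 1)) = p k
  norm_edge : ∀ k, ‖Q (k + 1) - Q k‖ = 1
  turn : ∀ k, Q k - Q (k + 1) = Complex.exp (p (k + 1) * Complex.I) * (Q (k + 2) - Q (k + 1))
  angle_nonneg : ∀ k, 0 ≤ p k
  angle_sum : ∑ k ∈ Finset.range (2 * n + 1), p k = Real.pi
  norm_le : ∀ k, ‖Q k‖ ≤ R

theorem im_apex (Q : ℕ → ℂ) (k : ℕ) : (apex Q k).im = cross (Q k) (Q (k + 1)) := by
  simp [apex, edge, cross]; ring

theorem crossSum_eq (n : ℕ) (Q : ℕ → ℂ) :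
    crossSum n Q = ∑ k ∈ Finset.range (2 * n + 1), (apex Q k).im := by
  simp only [im_apex, crossSum]

namespace IsStarChain

variable {n : ℕ} {R : ℝ} {Q : ℕ → ℂ} {p : ℕ → ℝ}

theorem shift (h : IsStarChain n R Q p) (j : ℕ) : IsStarChain n R (fun k => Q (k + j)) (fun k => p (k + j)) where
  vertex_periodic k := by rw [← h.vertex_periodic (k + j)]; congr 1; ring
  angle_periodic k := by rw [← h.angle_periodic (k + j)]; congr 1; ring
  norm_edge k := by have := h.norm_edge (k + j); rwa [add_right_comm] at this
  turn k := by
    have := h.turn (k + j)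
    rw [add_right_comm, show k + j + 2 = k + 2 + j by ring] at this
    exact this
  angle_nonneg k := h.angle_nonneg _
  angle_sum := by rw [← h.angle_sum]; exact sum_range_periodic_add h.angle_periodic j
  norm_le k := h.norm_le _

theorem crossSum_shift (h : IsStarChain n R Q p) (j : ℕ) :
    crossSum n (fun k => Q (k + j)) = crossSum n Q := by
  unfold crossSum
  rw [← sum_range_periodic_add (f := fun k => cross (Q k) (Q (k + 1))) _ j]
  · refine Finset.sum_congr rfl fun k _ => ?_
    rw [add_right_comm]
  · intro k
    have h1 := h.vertex_periodic k
    have h2 := h.vertex_periodic (k + 1)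
    rw [add_right_comm] at h2
    simp only [h1, h2]

theorem apex_periodic (h : IsStarChain n R Q p) (k : ℕ) : apex Q (k + (2 * n + 1)) = apex Q k := by
  have h1 := h.vertex_periodic k
  have h2 := h.vertex_periodic (k + 1)
  rw [add_right_comm] at h2
  simp only [apex, edge, h1, h2]

theorem norm_edge' (h : IsStarChain n R Q p) (k : ℕ) : ‖edge Q k‖ = 1 := h.norm_edge k

theorem edge_mul_conj (h : IsStarChain n R Q p) (k : ℕ) : edge Q k * (starRingEnd ℂ) (edge Q k) = 1 := by
  rw [Complex.mul_conj, Complex.normSq_eq_norm_sq, h.norm_edge' k]; simp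

theorem edge_ne_zero (h : IsStarChain n R Q p) (k : ℕ) : edge Q k ≠ 0 :=
  norm_ne_zero_iff.1 (by rw [h.norm_edge' k]; exact one_ne_zero)

theorem vertex_eq (h : IsStarChain n R Q p) (k : ℕ) : Q k = -apex Q k * edge Q k := by
  have := h.edge_mul_conj k
  rw [apex]; linear_combination (-Q k) * this

theorem vertex_succ_eq (h : IsStarChain n R Q p) (k : ℕ) : Q (k + 1) = (1 - apex Q k) * edge Q k := by
  have h1 := h.vertex_eq k
  have h2 : Q (k + 1) = Q k + edge Q k := by rw [edge]; ring
  rw [h2]; linear_combination h1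

theorem norm_apex (h : IsStarChain n R Q p) (k : ℕ) : ‖apex Q k‖ = ‖Q k‖ := by
  rw [h.vertex_eq k, norm_mul, norm_neg, h.norm_edge' k, mul_one]

theorem norm_one_sub_apex (h : IsStarChain n R Q p) (k : ℕ) : ‖1 - apex Q k‖ = ‖Q (k + 1)‖ := by
  rw [h.vertex_succ_eq k, norm_mul, h.norm_edge' k, mul_one]

theorem apex_mem_lens (h : IsStarChain n R Q p) (k : ℕ) : apex Q k ∈ lens R :=
  ⟨by rw [h.norm_apex]; exact h.norm_le k, by rw [h.norm_one_sub_apex]; exact h.norm_le _⟩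

theorem edge_eq (h : IsStarChain n R Q p) (k : ℕ) :
    edge Q k = -Complex.exp (p (k + 1) * Complex.I) * edge Q (k + 1) := by
  have := h.turn k
  unfold edge; linear_combination -this

theorem apex_succ (h : IsStarChain n R Q p) (k : ℕ) :
    apex Q (k + 1) = Complex.exp (p (k + 1) * Complex.I) * (1 - apex Q k) := by
  have h1 := h.vertex_succ_eq k
  rw [h.vertex_eq (k + 1), h.edge_eq k] at h1
  apply mul_right_cancel₀ (h.edge_ne_zero (k + 1))
  linear_combination -h1

theorem angle_le_pi (h : IsStarChain n R Q p) (k : ℕ) : p k ≤ Real.pi := by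
  rw [← periodic_mod h.angle_periodic k, ← h.angle_sum]
  exact Finset.single_le_sum (f := p) (fun i _ => h.angle_nonneg i)
    (Finset.mem_range.2 (Nat.mod_lt _ (by omega)))

/-- The recursion `apex_succ` gives the identity modulo 2π. Both arguments are at most π/6 in
absolute value and p lies in [0, π], so the multiple of 2π is zero. -/
theorem angle_succ_eq (h : IsStarChain n R Q p) (hR : 1 / 2 ≤ R) (hR3 : 3 * R ^ 2 ≤ 1) (k : ℕ) :
    p (k + 1) = Complex.arg (apex Q (k + 1)) - Complex.arg (1 - apex Q k) := by
  have hl := chordAngle_le hR hR3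
  have hz := h.apex_mem_lens (k + 1)
  have hw := lens_one_sub (h.apex_mem_lens k)
  have a1 := abs_le.1 (lens_abs_arg_le hR hR3 hz)
  have a2 := abs_le.1 (lens_abs_arg_le hR hR3 hw)
  have e := h.apex_succ k
  rw [← Complex.norm_mul_exp_arg_mul_I (1 - apex Q k), h.norm_one_sub_apex] at e
  have hn : ((‖Q (k + 1)‖ : ℝ) : ℂ) ≠ 0 := by
    rw [← h.norm_apex]; exact_mod_cast (lens_norm_pos hR3 hz).ne'
  have e1 : Complex.exp (Complex.arg (apex Q (k + 1)) * Complex.I)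
      = Complex.exp (p (k + 1) * Complex.I) * Complex.exp (Complex.arg (1 - apex Q k) * Complex.I) := by
    apply mul_left_cancel₀ hn
    have e' := Complex.norm_mul_exp_arg_mul_I (apex Q (k + 1))
    rw [h.norm_apex] at e'
    rw [e', e]; ring
  rw [← Complex.exp_add] at e1
  obtain ⟨j, hj⟩ := Complex.exp_eq_exp_iff_exists_int.1 e1
  have hj' : Complex.arg (apex Q (k + 1)) = p (k + 1) + Complex.arg (1 - apex Q k) + j * (2 * Real.pi) := by
    have := congrArg Complex.im hj
    simpa using this
  have hp0 := h.angle_nonneg (k + 1)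
  have hp1 := h.angle_le_pi (k + 1)
  have hpi := Real.pi_pos
  have j0 : j = 0 := by
    have b1 : (j : ℝ) * (2 * Real.pi) < 1 * (2 * Real.pi) := by linarith
    have b2 : (-1 : ℝ) * (2 * Real.pi) < (j : ℝ) * (2 * Real.pi) := by linarith
    have b1' := lt_of_mul_lt_mul_right b1 (by positivity)
    have b2' := lt_of_mul_lt_mul_right b2 (by positivity)
    have c1 : j < 1 := by exact_mod_cast b1'
    have c2 : -1 < j := by exact_mod_cast b2'
    omega
  rw [j0] at hj'
  push_cast at hj'
  linarith

theorem angle_le (h : IsStarChain n R Q p) (hR : 1 / 2 ≤ R) (hR3 : 3 * R ^ 2 ≤ 1) (k : ℕ) :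
    p k ≤ chordAngle R := by
  rw [← h.angle_periodic k, ← add_assoc, h.angle_succ_eq hR hR3]
  have a1 := abs_le.1 (lens_abs_arg_le hR hR3 (h.apex_mem_lens (k + 2 * n + 1)))
  have a2 := abs_le.1 (lens_abs_arg_le hR hR3 (lens_one_sub (h.apex_mem_lens (k + 2 * n))))
  linarith [a1.2, a2.1]

theorem angle_lt (h : IsStarChain n R Q p) (hR : 1 / 2 ≤ R) (hR3 : 3 * R ^ 2 ≤ 1) {k : ℕ}
    (hk : ‖Q k‖ < R) : p k < chordAngle R := by
  rw [← h.angle_periodic k, ← add_assoc, h.angle_succ_eq hR hR3]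
  have hz := h.apex_mem_lens (k + 2 * n + 1)
  have a1 := abs_le.1 (lens_abs_arg_le hR hR3 hz)
  have a2 := abs_le.1 (lens_abs_arg_le hR hR3 (lens_one_sub (h.apex_mem_lens (k + 2 * n))))
  have a3 : Complex.arg (apex Q (k + 2 * n + 1)) ≠ chordAngle R / 2 := by
    intro h'
    have := lens_norm_eq_of_arg hR hR3 hz h'
    rw [h.norm_apex, add_assoc, h.vertex_periodic] at this
    exact hk.ne this
  have := lt_of_le_of_ne a1.2 a3
  linarith [a2.1]

/-- Summing by vertices or by edges regroups the same arguments: each chain angle is the sum of the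
base angles on its two sides. -/
theorem defect_sum (h : IsStarChain n R Q p) (hR : 1 / 2 ≤ R) (hR3 : 3 * R ^ 2 ≤ 1) :
    ∑ k ∈ Finset.range (2 * n + 1), defect (apex Q k) = Real.pi := by
  rw [← h.angle_sum, ← sum_range_periodic_succ h.angle_periodic]
  simp only [h.angle_succ_eq hR hR3, defect, Finset.sum_sub_distrib]
  rw [sum_range_periodic_succ (f := fun k => Complex.arg (apex Q k))]
  intro k
  simp only [h.apex_periodic]

theorem pi_le (h : IsStarChain n R Q p) (hR : 1 / 2 ≤ R) (hR3 : 3 * R ^ 2 ≤ 1) :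
    Real.pi ≤ (2 * n + 1) * chordAngle R := by
  rw [← h.angle_sum]
  have := Finset.sum_le_card_nsmul (Finset.range (2 * n + 1)) p (chordAngle R)
    (fun k _ => h.angle_le hR hR3 k)
  simpa using this

end IsStarChain

/-! ### Moving two consecutive vertices of a chain -/

/-- The sum of three consecutive edges with angles `p`, `q` between them, in units of the first. -/
noncomputable def threeEdgeSum (p q : ℝ) : ℂ :=
  1 - Complex.exp (-(p * Complex.I)) + Complex.exp (-(p * Complex.I)) * Complex.exp (-(q * Complex.I))

theorem exp_neg_mul_I (p : ℝ) : Complex.exp (-(p * Complex.I)) = Real.cos p - Real.sin p * Complex.I := by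
  rw [← neg_mul, Complex.exp_mul_I, Complex.cos_neg, Complex.sin_neg]; push_cast; ring

/-- In the half-sum s and half-difference t, the length of the closing chord and the enclosed area
(`sin_add_sin_sub_sin`) both involve t only through cos t - cos s. For a fixed chord, c = 2 cos s
(cos t - cos s) is constant and the area is c tan s, which increases with s. -/
theorem sq_norm_threeEdgeSum (s t : ℝ) :
    ‖threeEdgeSum (s + t) (s - t)‖ ^ 2 = 1 - 4 * Real.cos s * (Real.cos t - Real.cos s) := by
  have e1 : Real.cos (s + t) + Real.cos (s - t) = 2 * Real.cos s * Real.cos t := by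
    rw [Real.cos_add, Real.cos_sub]; ring
  have e2 : Real.cos (s + t) * Real.cos (s - t) - Real.sin (s + t) * Real.sin (s - t)
      = 2 * Real.cos s ^ 2 - 1 := by
    rw [← Real.cos_add, ← Real.cos_two_mul]; congr 1; ring
  have h1 := Real.sin_sq_add_cos_sq (s + t)
  have h2 := Real.sin_sq_add_cos_sq (s - t)
  rw [Complex.sq_norm_eq]
  simp only [threeEdgeSum, exp_neg_mul_I]
  generalize Real.cos (s + t) = a at *
  generalize Real.cos (s - t) = b at *
  generalize Real.sin (s + t) = c at *
  generalize Real.sin (s - t) = d at *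
  simp
  linear_combination (1 - 2 * b + b ^ 2 + d ^ 2) * h1 + h2 + 2 * e2 - 2 * e1

theorem sin_add_sin_sub_sin (s t : ℝ) : Real.sin (s + t) + Real.sin (s - t)
    - Real.sin ((s + t) + (s - t)) = 2 * Real.sin s * (Real.cos t - Real.cos s) := by
  have : (s + t) + (s - t) = 2 * s := by ring
  rw [this, Real.sin_two_mul, Real.sin_add, Real.sin_sub]; ring

open Filter Topology in
/-- A four-bar linkage with three unit bars can be moved slightly so that the enclosed area
grows. -/
theorem exists_larger_linkage {p q : ℝ} (hp : 0 < p) (hq : 0 < q) (hp3 : p < Real.pi / 3)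
    (hq3 : q < Real.pi / 3) {P : ℝ → ℝ → ℝ → Prop}
    (hP : ∀ᶠ x : ℝ × ℝ × ℝ in 𝓝 (p, q, 0), P x.1 x.2.1 x.2.2) :
    ∃ p' q' η : ℝ, P p' q' η ∧
      threeEdgeSum p q = Complex.exp (η * Complex.I) * threeEdgeSum p' q' ∧
      Real.sin p + Real.sin q - Real.sin (p + q) < Real.sin p' + Real.sin q' - Real.sin (p' + q') := by
  obtain ⟨s, hs⟩ : ∃ s, s = (p + q) / 2 := ⟨_, rfl⟩
  obtain ⟨t, ht⟩ : ∃ t, t = (p - q) / 2 := ⟨_, rfl⟩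
  have ep : p = s + t := by rw [hs, ht]; ring
  have eq : q = s - t := by rw [hs, ht]; ring
  have hs0 : 0 < s := by linarith
  have hs3 : s < Real.pi / 3 := by linarith
  have hpi := Real.pi_pos
  have hX : 1 / 2 < Real.cos s := by
    rw [← Real.cos_pi_div_three]
    exact Real.cos_lt_cos_of_nonneg_of_le_pi hs0.le (by linarith) hs3
  have hts : |t| < s := abs_lt.2 ⟨by linarith, by linarith⟩
  have hct : Real.cos s < Real.cos t := by
    rw [← Real.cos_abs t]
    exact Real.cos_lt_cos_of_nonneg_of_le_pi (abs_nonneg _) (by linarith) hts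
  have hct1 := Real.cos_le_one t
  set c := 2 * Real.cos s * (Real.cos t - Real.cos s) with hc
  have hc0 : 0 < c := mul_pos (by linarith) (by linarith)
  -- The sign selects the branch of `arccos` passing through t, so that the motion starts at the
  -- given linkage.
  obtain ⟨σ, hσ, hσt⟩ : ∃ σ : ℝ, (σ = 1 ∨ σ = -1) ∧ σ * Real.arccos (Real.cos t) = t := by
    rcases le_total 0 t with h | h
    · exact ⟨1, Or.inl rfl, by rw [Real.arccos_cos h (by linarith [le_abs_self t]), one_mul]⟩
    · refine ⟨-1, Or.inr rfl, ?_⟩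
      rw [← Real.cos_neg, Real.arccos_cos (by linarith) (by linarith [neg_abs_le t])]; ring
  -- The value that cos t must take at half-sum x for the chord to keep its length.
  set Y : ℝ → ℝ := fun x => Real.cos x + c / (2 * Real.cos x) with hY
  have hYs : Y s = Real.cos t := by
    simp only [hY, hc]
    field_simp; ring
  set τ : ℝ → ℝ := fun x => σ * Real.arccos (Y x) with hτ
  have hτs : τ s = t := by simp only [hτ, hYs, hσt]
  have hYc : ContinuousAt Y s := by
    simp only [hY]
    refine Real.continuous_cos.continuousAt.add ?_
    exact continuousAt_const.div (by fun_prop) (by linarith)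
  have hτc : ContinuousAt τ s := by
    simp only [hτ]
    exact continuousAt_const.mul (Real.continuous_arccos.continuousAt.comp hYc)
  set W : ℝ → ℂ := fun x => threeEdgeSum (x + τ x) (x - τ x) with hW
  have hWs : W s = threeEdgeSum p q := by simp only [hW, hτs, ← ep, ← eq]
  have hnW : ‖threeEdgeSum p q‖ ^ 2 = 1 - 2 * c := by
    rw [ep, eq, sq_norm_threeEdgeSum, hc]; ring
  have hW0 : threeEdgeSum p q ≠ 0 := by
    intro h0
    rw [h0, norm_zero, hc] at hnW
    nlinarith [sq_nonneg (2 * Real.cos s - 1)]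
  have hWc : ContinuousAt W s := by
    have : Continuous fun x : ℝ × ℝ => threeEdgeSum x.1 x.2 := by
      unfold threeEdgeSum; fun_prop
    exact this.continuousAt.comp (f := fun x => (x + τ x, x - τ x))
      ((continuousAt_id.add hτc).prodMk (continuousAt_id.sub hτc))
  -- Rotation that brings the new chord, of the same length, back onto the old one.
  set η : ℝ → ℝ := fun x => Complex.arg (threeEdgeSum p q / W x) with hη
  have hηs : η s = 0 := by simp only [hη, hWs, div_self hW0, Complex.arg_one]
  have hηc : ContinuousAt η s := by
    have h1 : ContinuousAt (fun x => threeEdgeSum p q / W x) s :=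
      continuousAt_const.div hWc (by rw [hWs]; exact hW0)
    have h2 : ContinuousAt Complex.arg (threeEdgeSum p q / W s) := by
      rw [hWs, div_self hW0]; exact Complex.continuousAt_arg Complex.one_mem_slitPlane
    exact ContinuousAt.comp (f := fun x => threeEdgeSum p q / W x) h2 h1
  have hall : Tendsto (fun x => (x + τ x, x - τ x, η x)) (𝓝 s) (𝓝 (p, q, 0)) := by
    have : ContinuousAt (fun x => (x + τ x, x - τ x, η x)) s :=
      (continuousAt_id.add hτc).prodMk ((continuousAt_id.sub hτc).prodMk hηc)
    have h2 := this.tendsto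
    simp only [hτs, hηs, ← ep, ← eq] at h2
    exact h2
  have e1 := hall.eventually hP
  -- At x = s this reads cos t < 2 cos s, true because cos s > 1/2. It ensures Y x ≤ cos t ≤ 1, so
  -- that the new value is a cosine.
  have e2 : ∀ᶠ x in 𝓝 s, Real.cos t < Real.cos s + Real.cos x := by
    have : ContinuousAt (fun x => Real.cos s + Real.cos x) s := by fun_prop
    exact this.eventually_const_lt (by linarith)
  have e3 : ∀ᶠ x in 𝓝 s, 1 / 2 < Real.cos x :=
    Real.continuous_cos.continuousAt.eventually_const_lt hX
  have e4 : ∀ᶠ x in 𝓝 s, x < Real.pi / 3 := eventually_lt_nhds hs3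
  have e5 := ((e1.and e2).and (e3.and e4)).filter_mono (nhdsWithin_le_nhds (s := Set.Ioi s))
  obtain ⟨x, ⟨⟨⟨h1, h2⟩, ⟨h3, h4⟩⟩, h5⟩⟩ := (e5.and self_mem_nhdsWithin).exists
  have hsx : s < x := h5
  have hcx : Real.cos x < Real.cos s :=
    Real.cos_lt_cos_of_nonneg_of_le_pi hs0.le (by linarith) hsx
  have hcτ : Real.cos (τ x) = Y x := by
    have b1 : Y x ≤ 1 := by
      refine le_trans ?_ hct1
      simp only [hY, hc]
      rw [← sub_nonneg]
      have : Real.cos t - (Real.cos x + 2 * Real.cos s * (Real.cos t - Real.cos s) / (2 * Real.cos x))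
        = (Real.cos s - Real.cos x) * (Real.cos s + Real.cos x - Real.cos t) / Real.cos x := by
        have : Real.cos x ≠ 0 := by linarith
        field_simp; ring
      rw [this]
      exact div_nonneg (mul_nonneg (by linarith) (by linarith)) (by linarith)
    have b2 : -1 ≤ Y x := by
      have : 0 < c / (2 * Real.cos x) := div_pos hc0 (by linarith)
      simp only [hY]; linarith
    simp only [hτ]
    rcases hσ with h | h
    · rw [h, one_mul, Real.cos_arccos b2 b1]
    · rw [h, neg_one_mul, Real.cos_neg, Real.cos_arccos b2 b1]
  have hdiff : Real.cos (τ x) - Real.cos x = c / (2 * Real.cos x) := by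
    rw [hcτ]; simp only [hY]; ring
  have hnWx : ‖W x‖ ^ 2 = ‖threeEdgeSum p q‖ ^ 2 := by
    rw [hnW]; simp only [hW]
    rw [sq_norm_threeEdgeSum, hdiff]
    have : Real.cos x ≠ 0 := by linarith
    field_simp; ring
  have hnWx' : ‖W x‖ = ‖threeEdgeSum p q‖ :=
    (pow_left_inj₀ (norm_nonneg _) (norm_nonneg _) two_ne_zero).1 hnWx
  have hWx0 : W x ≠ 0 := norm_ne_zero_iff.1 (by rw [hnWx']; exact norm_ne_zero_iff.2 hW0)
  refine ⟨x + τ x, x - τ x, η x, h1, ?_, ?_⟩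
  · have := Complex.norm_mul_exp_arg_mul_I (threeEdgeSum p q / W x)
    rw [norm_div, hnWx', div_self (norm_ne_zero_iff.2 hW0), Complex.ofReal_one, one_mul] at this
    simp only [hη]
    rw [this, div_mul_cancel₀ _ hWx0]
  · rw [sin_add_sin_sub_sin, hdiff, ep, eq, sin_add_sin_sub_sin]
    have l1 : 2 * Real.sin s * (Real.cos t - Real.cos s) = c * Real.tan s := by
      rw [Real.tan_eq_sin_div_cos, hc]; field_simp
    have l2 : 2 * Real.sin x * (c / (2 * Real.cos x)) = c * Real.tan x := by
      rw [Real.tan_eq_sin_div_cos]; field_simp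
    rw [l1, l2]
    exact mul_lt_mul_of_pos_left (Real.tan_lt_tan_of_nonneg_of_lt_pi_div_two hs0.le (by linarith) hsx) hc0

/-- Only the last bracket depends on the shape of the linkage; the term with the closing chord is
fixed when both ends are fixed. -/
theorem cross_threeEdge (A x : ℂ) (hx : ‖x‖ = 1) (p q : ℝ) :
    cross A (A + x) + cross (A + x) (A + x - Complex.exp (-(p * Complex.I)) * x)
      + cross (A + x - Complex.exp (-(p * Complex.I)) * x) (A + x * threeEdgeSum p q)
    = cross A (x * threeEdgeSum p q) + (Real.sin p + Real.sin q - Real.sin (p + q)) := by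
  have h1 : x.re ^ 2 + x.im ^ 2 = 1 := by rw [← Complex.sq_norm_eq, hx]; norm_num
  simp only [threeEdgeSum, exp_neg_mul_I, Real.sin_add, cross]
  have h2 := Real.sin_sq_add_cos_sq p
  generalize Real.sin p = a at *
  generalize Real.cos p = b at *
  generalize Real.sin q = c at *
  generalize Real.cos q = d at *
  simp
  generalize x.re = X at *
  generalize x.im = Y at *
  linear_combination (a - (a * d + b * c) + c * (a ^ 2 + b ^ 2)) * h1 + c * h2

theorem forall_of_lt_of_periodic {m : ℕ} (hm : 0 < m) {T : ℕ → Prop}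
    (hT : ∀ k, T (k % m) → T k) (h : ∀ k < m, T k) (k : ℕ) : T k :=
  hT k (h _ (Nat.mod_lt _ hm))

namespace IsStarChain

variable {n : ℕ} {R : ℝ} {Q : ℕ → ℂ} {p : ℕ → ℝ}

/-- To be a chain it is enough to satisfy the local conditions over one period. -/
theorem of_lt (hQ : ∀ k, Q (k + (2 * n + 1)) = Q k) (hp : ∀ k, p (k + (2 * n + 1)) = p k)
    (h1 : ∀ k < 2 * n + 1, ‖Q (k + 1) - Q k‖ = 1)
    (h2 : ∀ k < 2 * n + 1,
      Q k - Q (k + 1) = Complex.exp (p (k + 1) * Complex.I) * (Q (k + 2) - Q (k + 1)))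
    (h3 : ∀ k < 2 * n + 1, 0 ≤ p k) (h4 : ∑ k ∈ Finset.range (2 * n + 1), p k = Real.pi)
    (h5 : ∀ k < 2 * n + 1, ‖Q k‖ ≤ R) : IsStarChain n R Q p := by
  have hQm : ∀ k j, Q (k % (2 * n + 1) + j) = Q (k + j) := by
    intro k j
    rw [← periodic_mod hQ, ← periodic_mod hQ (k + j)]
    congr 1
    simp
  have hpm : ∀ k j, p (k % (2 * n + 1) + j) = p (k + j) := by
    intro k j
    rw [← periodic_mod hp, ← periodic_mod hp (k + j)]
    congr 1
    simp
  have hm : 0 < 2 * n + 1 := by omega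
  refine ⟨hQ, hp, ?_, ?_, ?_, h4, ?_⟩
  · refine forall_of_lt_of_periodic hm (fun k hk => ?_) h1
    rw [hQm, periodic_mod hQ] at hk; exact hk
  · refine forall_of_lt_of_periodic hm (fun k hk => ?_) h2
    rw [hQm, hQm, hpm, periodic_mod hQ] at hk; exact hk
  · refine forall_of_lt_of_periodic hm (fun k hk => ?_) h3
    rw [periodic_mod hp] at hk; exact hk
  · refine forall_of_lt_of_periodic hm (fun k hk => ?_) h5
    rw [periodic_mod hQ] at hk; exact hk

theorem one_le (h : IsStarChain n R Q p) : 1 ≤ n := by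
  by_contra hn
  have hn : n = 0 := by omega
  subst hn
  have h1 := h.norm_edge 0
  have h2 := h.vertex_periodic 0
  simp only [Nat.mul_zero, zero_add] at h1 h2
  rw [h2] at h1
  simp at h1

/-- In a triangle the three angles are at most π/3 with sum π, so none is strictly below ℓ. With at
least five vertices, the four angles changed by a linkage motion belong to distinct vertices. -/
theorem two_le_of_norm_lt (h : IsStarChain n R Q p) (hR : 1 / 2 ≤ R) (hR3 : 3 * R ^ 2 ≤ 1)
    {k : ℕ} (hk : ‖Q k‖ < R) : 2 ≤ n := by
  by_contra hn
  have hn : n = 1 := by have := h.one_le; omega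
  subst hn
  have h1 := (h.shift k).angle_sum
  have h2 := h.angle_lt hR hR3 hk
  have h3 := h.angle_le hR hR3 (1 + k)
  have h4 := h.angle_le hR hR3 (2 + k)
  have h5 := chordAngle_le hR hR3
  simp [Finset.sum_range_succ] at h1
  linarith

theorem edge_succ (h : IsStarChain n R Q p) (k : ℕ) :
    edge Q (k + 1) = -Complex.exp (-(p (k + 1) * Complex.I)) * edge Q k := by
  rw [h.edge_eq k, Complex.exp_neg]
  have := Complex.exp_ne_zero (p (k + 1) * Complex.I)
  field_simp

theorem vertex_one (Q : ℕ → ℂ) : Q 1 = Q 0 + edge Q 0 := by simp [edge]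

theorem vertex_two (h : IsStarChain n R Q p) :
    Q 2 = Q 0 + edge Q 0 - Complex.exp (-(p 1 * Complex.I)) * edge Q 0 := by
  have := h.edge_succ 0
  have e : Q 2 = Q 0 + edge Q 0 + edge Q 1 := by simp [edge]
  rw [e]; simp only [zero_add] at this; rw [this]; ring

theorem vertex_three (h : IsStarChain n R Q p) :
    Q 3 = Q 0 + edge Q 0 * threeEdgeSum (p 1) (p 2) := by
  have h1 := h.edge_succ 0
  have h2 := h.edge_succ 1
  simp only [zero_add, Nat.reduceAdd] at h1 h2
  have e : Q 3 = Q 0 + edge Q 0 + edge Q 1 + edge Q 2 := by simp [edge]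
  rw [e, h2, h1, threeEdgeSum]; ring

open Topology Filter in
/-- If two consecutive vertices are in the open disk then the enclosed area can be increased. -/
theorem exists_crossSum_lt (h : IsStarChain n R Q p) (hR : 1 / 2 ≤ R) (hR3 : 3 * R ^ 2 ≤ 1)
    (hpos : ∀ k, 0 < p k) (h1 : ‖Q 1‖ < R) (h2 : ‖Q 2‖ < R) :
    ∃ Q' p', IsStarChain n R Q' p' ∧ crossSum n Q < crossSum n Q' := by
  have hn := h.two_le_of_norm_lt hR hR3 h1
  have hl := chordAngle_le hR hR3
  have hev : ∀ᶠ x : ℝ × ℝ × ℝ in 𝓝 (p 1, p 2, 0),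
      (0 ≤ x.1 ∧ 0 ≤ x.2.1) ∧ (0 ≤ p 0 - x.2.2 ∧ 0 ≤ p 3 + x.2.2 + p 1 + p 2 - x.1 - x.2.1) ∧
      (‖Q 0 + Complex.exp (x.2.2 * Complex.I) * edge Q 0‖ ≤ R ∧
      ‖Q 0 + Complex.exp (x.2.2 * Complex.I) * edge Q 0
        - Complex.exp (-(x.1 * Complex.I)) * (Complex.exp (x.2.2 * Complex.I) * edge Q 0)‖ ≤ R) := by
    refine (Filter.Eventually.and ?_ ?_).and ((Filter.Eventually.and ?_ ?_).and
      (Filter.Eventually.and ?_ ?_))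
    · have : ContinuousAt (fun x : ℝ × ℝ × ℝ => x.1) (p 1, p 2, 0) := by fun_prop
      exact (this.eventually_const_lt (u := 0) (hpos 1)).mono fun _ h => h.le
    · have : ContinuousAt (fun x : ℝ × ℝ × ℝ => x.2.1) (p 1, p 2, 0) := by fun_prop
      exact (this.eventually_const_lt (u := 0) (hpos 2)).mono fun _ h => h.le
    · have : ContinuousAt (fun x : ℝ × ℝ × ℝ => p 0 - x.2.2) (p 1, p 2, 0) := by fun_prop
      exact (this.eventually_const_lt (u := 0) (by simpa using hpos 0)).mono fun _ h => h.le
    · have : ContinuousAt (fun x : ℝ × ℝ × ℝ => p 3 + x.2.2 + p 1 + p 2 - x.1 - x.2.1)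
        (p 1, p 2, 0) := by fun_prop
      refine (this.eventually_const_lt (u := 0) ?_).mono fun _ h => h.le
      have := hpos 3
      show 0 < p 3 + 0 + p 1 + p 2 - p 1 - p 2
      linarith
    · have : ContinuousAt (fun x : ℝ × ℝ × ℝ => ‖Q 0 + Complex.exp (x.2.2 * Complex.I) * edge Q 0‖)
        (p 1, p 2, 0) := by fun_prop
      refine (this.eventually_lt_const (u := R) ?_).mono fun _ h => h.le
      simpa [vertex_one Q] using h1
    · have : ContinuousAt (fun x : ℝ × ℝ × ℝ => ‖Q 0 + Complex.exp (x.2.2 * Complex.I) * edge Q 0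
        - Complex.exp (-(x.1 * Complex.I)) * (Complex.exp (x.2.2 * Complex.I) * edge Q 0)‖)
        (p 1, p 2, 0) := by fun_prop
      refine (this.eventually_lt_const (u := R) ?_).mono fun _ h => h.le
      rw [h.vertex_two] at h2
      simpa using h2
  obtain ⟨p', q', η, ⟨⟨hp', hq'⟩, ⟨h0', h3'⟩, hA, hC⟩, hW, hF⟩ := exists_larger_linkage (hpos 1) (hpos 2)
    ((h.angle_lt hR hR3 h1).trans_le hl) ((h.angle_lt hR hR3 h2).trans_le hl)
    (P := fun a b c => (0 ≤ a ∧ 0 ≤ b) ∧ (0 ≤ p 0 - c ∧ 0 ≤ p 3 + c + p 1 + p 2 - a - b) ∧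
      (‖Q 0 + Complex.exp (c * Complex.I) * edge Q 0‖ ≤ R ∧
      ‖Q 0 + Complex.exp (c * Complex.I) * edge Q 0
        - Complex.exp (-(a * Complex.I)) * (Complex.exp (c * Complex.I) * edge Q 0)‖ ≤ R)) hev
  set x := Complex.exp (η * Complex.I) * edge Q 0 with hx
  have hxn : ‖x‖ = 1 := by rw [hx, norm_mul, Complex.norm_exp_ofReal_mul_I, h.norm_edge', one_mul]
  set A := Q 0 + x with hAdef
  set C := A - Complex.exp (-(p' * Complex.I)) * x with hCdef
  have hQ3 : Q 3 = Q 0 + x * threeEdgeSum p' q' := by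
    rw [h.vertex_three, hW, hx]; ring
  have hQ3C : Q 3 - C = Complex.exp (-(p' * Complex.I)) * Complex.exp (-(q' * Complex.I)) * x := by
    rw [hQ3, hCdef, hAdef, threeEdgeSum]; ring
  set m := 2 * n + 1 with hm
  have hm5 : 5 ≤ m := by omega
  let Q' : ℕ → ℂ := fun k => if k % m = 1 then A else if k % m = 2 then C else Q k
  -- The first edge turns by η, which changes the angle at Q 0 by -η; the angle at Q 3 absorbs the
  -- rest, so that the total stays π and the edges beyond do not move.
  let P' : ℕ → ℝ := fun k => if k % m = 0 then p 0 - η else if k % m = 1 then p' else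
    if k % m = 2 then q' else if k % m = 3 then p 3 + η + p 1 + p 2 - p' - q' else p k
  have Q'1 : Q' 1 = A := by
    have : 1 % m = 1 := Nat.mod_eq_of_lt (by omega)
    simp [Q', this]
  have Q'2 : Q' 2 = C := by
    have : 2 % m = 2 := Nat.mod_eq_of_lt (by omega)
    simp [Q', this]
  have Q'0 : Q' 0 = Q 0 := by simp [Q']
  have Q'j : ∀ j, 3 ≤ j → j ≤ m → Q' j = Q j := by
    intro j h3 hj
    rcases hj.eq_or_lt with rfl | hj
    · simp [Q']
    · have : j % m = j := Nat.mod_eq_of_lt hj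
      simp only [Q', this]
      rw [if_neg (by omega), if_neg (by omega)]
  have Q'per : ∀ k, Q' (k + m) = Q' k := by
    intro k
    have hk := h.vertex_periodic k
    rw [← hm] at hk
    simp only [Q', Nat.add_mod_right, hk]
  have P'per : ∀ k, P' (k + m) = P' k := by
    intro k
    have hk := h.angle_periodic k
    rw [← hm] at hk
    simp only [P', Nat.add_mod_right, hk]
  have P'0 : P' 0 = p 0 - η := by simp [P']
  have P'1 : P' 1 = p' := by
    have : 1 % m = 1 := Nat.mod_eq_of_lt (by omega)
    simp [P', this]
  have P'2 : P' 2 = q' := by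
    have : 2 % m = 2 := Nat.mod_eq_of_lt (by omega)
    simp [P', this]
  have P'3 : P' 3 = p 3 + η + p 1 + p 2 - p' - q' := by
    have : 3 % m = 3 := Nat.mod_eq_of_lt (by omega)
    simp [P', this]
  have P'j : ∀ j, 4 ≤ j → j < m → P' j = p j := by
    intro j h3 hj
    have : j % m = j := Nat.mod_eq_of_lt hj
    simp only [P', this]
    rw [if_neg (by omega), if_neg (by omega), if_neg (by omega), if_neg (by omega)]
  have hsplit : ∀ k < m, k = 0 ∨ k = 1 ∨ k = 2 ∨ (3 ≤ k ∧ k + 2 ≤ m) ∨ k + 1 = m := by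
    intro k hk; omega
  have hQm : Q m = Q 0 := by have := h.vertex_periodic 0; rwa [zero_add] at this
  refine ⟨Q', P', of_lt Q'per P'per ?_ ?_ ?_ ?_ ?_, ?_⟩
  · intro k hk
    rcases hsplit k hk with rfl | rfl | rfl | hk' | hk'
    · rw [zero_add, Q'1, Q'0, hAdef]; simpa using hxn
    · rw [show 1 + 1 = 2 from rfl, Q'1, Q'2, hCdef]
      simp [hxn, ← neg_mul, Complex.norm_exp]
    · rw [show 2 + 1 = 3 from rfl, Q'2, Q'j 3 (by omega) (by omega), hQ3C]
      simp [hxn, ← neg_mul, Complex.norm_exp]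
    · rw [Q'j k (by omega) (by omega), Q'j (k + 1) (by omega) (by omega)]; exact h.norm_edge k
    · rw [Q'j k (by omega) (by omega), Q'j (k + 1) (by omega) (by omega)]; exact h.norm_edge k
  · intro k hk
    have hpp : Complex.exp (p' * Complex.I) * Complex.exp (-(p' * Complex.I)) = 1 := by
      rw [← Complex.exp_add]; simp
    have hqq : Complex.exp (q' * Complex.I) * Complex.exp (-(q' * Complex.I)) = 1 := by
      rw [← Complex.exp_add]; simp
    rcases hsplit k hk with rfl | rfl | rfl | hk' | hk'
    · rw [zero_add, zero_add, Q'1, Q'0, Q'2, P'1, hCdef, hAdef]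
      linear_combination x * hpp
    · rw [show 1 + 1 = 2 from rfl, show 1 + 2 = 3 from rfl, Q'1, Q'2, P'2,
        Q'j 3 (by omega) (by omega), hQ3C, hCdef]
      linear_combination -Complex.exp (-(p' * Complex.I)) * x * hqq
    · rw [show 2 + 1 = 3 from rfl, show 2 + 2 = 4 from rfl, Q'2, P'3,
        Q'j 3 (by omega) (by omega), Q'j 4 (by omega) (by omega), ← neg_sub, hQ3C]
      have e1 := h.edge_eq 2
      have e2 := h.edge_succ 1
      have e3 := h.edge_succ 0
      simp only [zero_add, Nat.reduceAdd] at e1 e2 e3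
      rw [e2, e3] at e1
      have e4 : Complex.exp (p 3 * Complex.I) * edge Q 3
          = -(Complex.exp (-(p 2 * Complex.I)) * Complex.exp (-(p 1 * Complex.I))) * edge Q 0 := by
        linear_combination e1
      have e5 : Q 4 - Q 3 = edge Q 3 := rfl
      have e6 : Complex.exp ((p 3 + η + p 1 + p 2 - p' - q' : ℝ) * Complex.I)
        = Complex.exp (η * Complex.I) * Complex.exp (-(p' * Complex.I)) *
          Complex.exp (-(q' * Complex.I)) * (Complex.exp (p 1 * Complex.I) *
          Complex.exp (p 2 * Complex.I)) * Complex.exp (p 3 * Complex.I) := by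
        simp only [← Complex.exp_add]; congr 1; push_cast; ring
      have e7 : Complex.exp (p 1 * Complex.I) * Complex.exp (-(p 1 * Complex.I)) = 1 := by
        rw [← Complex.exp_add]; simp
      have e8 : Complex.exp (p 2 * Complex.I) * Complex.exp (-(p 2 * Complex.I)) = 1 := by
        rw [← Complex.exp_add]; simp
      rw [e5, e6, hx]
      linear_combination (-Complex.exp (η * Complex.I) * Complex.exp (-(p' * Complex.I)) *
          Complex.exp (-(q' * Complex.I)) * Complex.exp (p 1 * Complex.I) *
          Complex.exp (p 2 * Complex.I)) * e4 + (Complex.exp (η * Complex.I) * Complex.exp (-(p' * Complex.I)) *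
          Complex.exp (-(q' * Complex.I)) * edge Q 0) * (Complex.exp (p 2 * Complex.I) *
          Complex.exp (-(p 2 * Complex.I)) * e7 + e8)
    · rw [Q'j k (by omega) (by omega), Q'j (k + 1) (by omega) (by omega),
        Q'j (k + 2) (by omega) (by omega), P'j (k + 1) (by omega) (by omega)]; exact h.turn k
    · have g1 : Q' (k + 2) = A := by
        rw [show k + 2 = 1 + m by omega, Q'per, Q'1]
      have g2 : P' (k + 1) = p 0 - η := by
        rw [hk', show m = 0 + m by omega, P'per, P'0]
      have g3 : Q (k + 2) = Q 1 := by
        rw [show k + 2 = 1 + m by omega, h.vertex_periodic]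
      have g4 : p (k + 1) = p 0 := by
        rw [hk', show m = 0 + m by omega, h.angle_periodic]
      rw [Q'j k (by omega) (by omega), Q'j (k + 1) (by omega) (by omega), g1, g2, h.turn k, g3, g4,
        hk', hQm, hAdef, hx, edge]
      have : Complex.exp ((p 0 - η : ℝ) * Complex.I) * Complex.exp (η * Complex.I)
          = Complex.exp (p 0 * Complex.I) := by
        rw [← Complex.exp_add]; congr 1; push_cast; ring
      simp only [zero_add]
      linear_combination -(Q 1 - Q 0) * this
  · intro k hk
    by_cases h4 : 4 ≤ k
    · rw [P'j k h4 hk]; exact h.angle_nonneg k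
    · have : k = 0 ∨ k = 1 ∨ k = 2 ∨ k = 3 := by omega
      rcases this with rfl | rfl | rfl | rfl
      · rw [P'0]; exact h0'
      · rw [P'1]; exact hp'
      · rw [P'2]; exact hq'
      · rw [P'3]; exact h3'
  · rw [← h.angle_sum, show 2 * n + 1 = 4 + (2 * n - 3) by omega, Finset.sum_range_add,
      Finset.sum_range_add]
    congr 1
    · simp only [Finset.sum_range_succ, Finset.sum_range_zero, P'0, P'1, P'2, P'3]; ring
    · refine Finset.sum_congr rfl fun k hk => ?_
      rw [Finset.mem_range] at hk
      exact P'j _ (by omega) (by omega)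
  · intro k hk
    by_cases h4 : 3 ≤ k
    · rw [Q'j k h4 hk.le]; exact h.norm_le k
    · have : k = 0 ∨ k = 1 ∨ k = 2 := by omega
      rcases this with rfl | rfl | rfl
      · rw [Q'0]; exact h.norm_le 0
      · rw [Q'1]; exact hA
      · rw [Q'2]; exact hC
  · unfold crossSum
    rw [show 2 * n + 1 = 3 + (2 * n - 2) by omega, Finset.sum_range_add, Finset.sum_range_add]
    have e1 : ∑ k ∈ Finset.range (2 * n - 2), cross (Q' (3 + k)) (Q' (3 + k + 1))
      = ∑ k ∈ Finset.range (2 * n - 2), cross (Q (3 + k)) (Q (3 + k + 1)) := by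
      refine Finset.sum_congr rfl fun k hk => ?_
      rw [Finset.mem_range] at hk
      rw [Q'j _ (by omega) (by omega), Q'j _ (by omega) (by omega)]
    rw [e1]
    apply add_lt_add_left
    simp only [Finset.sum_range_succ, Finset.sum_range_zero, zero_add, Nat.reduceAdd]
    rw [Q'0, Q'1, Q'2, Q'j 3 (by omega) (by omega)]
    have c1 := cross_threeEdge (Q 0) (edge Q 0) (h.norm_edge' 0) (p 1) (p 2)
    have c2 := cross_threeEdge (Q 0) x hxn p' q'
    rw [← h.vertex_two, ← h.vertex_three, ← vertex_one] at c1
    rw [← hAdef, ← hCdef, ← hQ3] at c2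
    have c3 : edge Q 0 * threeEdgeSum (p 1) (p 2) = x * threeEdgeSum p' q' := by
      rw [hW, hx]; ring
    rw [c1, c2, c3]
    linarith

end IsStarChain

namespace IsStarChain

variable {n : ℕ} {R : ℝ} {Q : ℕ → ℂ} {p : ℕ → ℝ}

/-! ### Removing a degenerate vertex -/

/-- At a zero angle the chain runs along an edge and back, so the two neighbors coincide. Dropping
both edges merges their angles, and the two cross products cancel by antisymmetry. -/
theorem exists_remove_last (h : IsStarChain (n + 1) R Q p) (h0 : p (2 * n + 2) = 0) :
    ∃ Q' p', IsStarChain n R Q' p' ∧ crossSum n Q' = crossSum (n + 1) Q := by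
  have hper := h.vertex_periodic 0
  rw [zero_add, show 2 * (n + 1) + 1 = 2 * n + 3 by ring] at hper
  have hb : Q (2 * n + 1) = Q 0 := by
    have := h.turn (2 * n + 1)
    rw [show 2 * n + 1 + 1 = 2 * n + 2 by ring, show 2 * n + 1 + 2 = 2 * n + 3 by ring, h0, hper] at this
    simpa using this
  set m := 2 * n + 1 with hm
  let Q' : ℕ → ℂ := fun k => Q (k % m)
  let p' : ℕ → ℝ := fun k => if k % m = 0 then p 0 + p m else p (k % m)
  have Q'j : ∀ j ≤ m, Q' j = Q j := by
    intro j hj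
    rcases hj.eq_or_lt with rfl | hj
    · simp [Q', hb]
    · simp only [Q', Nat.mod_eq_of_lt hj]
  have Q'per : ∀ k, Q' (k + m) = Q' k := fun k => by simp [Q']
  have p'per : ∀ k, p' (k + m) = p' k := fun k => by simp [p']
  have p'j : ∀ j, 0 < j → j < m → p' j = p j := by
    intro j h0 hj
    simp only [p', Nat.mod_eq_of_lt hj]
    rw [if_neg (by omega)]
  have p'0 : p' 0 = p 0 + p m := by simp [p']
  refine ⟨Q', p', of_lt Q'per p'per ?_ ?_ ?_ ?_ ?_, ?_⟩
  · intro k hk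
    rw [Q'j k (by omega), Q'j (k + 1) (by omega)]; exact h.norm_edge k
  · intro k hk
    by_cases hk2 : k + 2 ≤ m
    · rw [Q'j k (by omega), Q'j (k + 1) (by omega), Q'j (k + 2) (by omega), p'j _ (by omega) (by omega)]
      exact h.turn k
    · have hk1 : k + 1 = m := by omega
      have hQ' : Q' (k + 2) = Q 1 := by
        rw [show k + 2 = 1 + m by omega, Q'per, Q'j 1 (by omega)]
      have hp' : p' (k + 1) = p 0 + p m := by
        rw [hk1, ← p'0, ← p'per 0, zero_add]
      have t1 := h.turn k
      have t2 := h.turn (k + 2)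
      have g1 : Q (k + 2 + 1) = Q 0 := by rw [show k + 2 + 1 = 2 * n + 3 by omega, hper]
      have g2 : Q (k + 2 + 2) = Q 1 := by
        rw [show k + 2 + 2 = 1 + (2 * (n + 1) + 1) by omega, h.vertex_periodic]
      have g3 : p (k + 2 + 1) = p 0 := by
        rw [show k + 2 + 1 = 0 + (2 * (n + 1) + 1) by omega, h.angle_periodic]
      rw [g1, g2, g3] at t2
      rw [Q'j k (by omega), Q'j (k + 1) (by omega), hQ', hp', t1, hk1, hb, t2]
      rw [show ((p 0 + p m : ℝ) : ℂ) * Complex.I = p m * Complex.I + p 0 * Complex.I by push_cast; ring,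
        Complex.exp_add]
      ring
  · intro k hk
    by_cases hk0 : k = 0
    · rw [hk0, p'0]; exact add_nonneg (h.angle_nonneg _) (h.angle_nonneg _)
    · rw [p'j k (by omega) hk]; exact h.angle_nonneg k
  · have hs := h.angle_sum
    rw [show 2 * (n + 1) + 1 = m + 1 + 1 by omega, Finset.sum_range_succ, Finset.sum_range_succ,
      show m + 1 = 2 * n + 2 by omega, h0, hm, Finset.sum_range_succ'] at hs
    rw [Finset.sum_range_succ', p'0]
    rw [Finset.sum_congr rfl fun k hk => p'j (k + 1) (by omega) (by rw [Finset.mem_range] at hk; omega)]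
    rw [← hs]; ring
  · intro k hk
    rw [Q'j k (by omega)]; exact h.norm_le k
  · unfold crossSum
    rw [show 2 * (n + 1) + 1 = m + 1 + 1 by omega, Finset.sum_range_succ _ (m + 1),
      Finset.sum_range_succ _ m, hb]
    rw [show m + 1 + 1 = 2 * n + 3 by omega, hper]
    have hs : ∑ k ∈ Finset.range m, cross (Q' k) (Q' (k + 1))
        = ∑ k ∈ Finset.range m, cross (Q k) (Q (k + 1)) := by
      refine Finset.sum_congr rfl fun k hk => ?_
      rw [Finset.mem_range] at hk
      rw [Q'j k (by omega), Q'j (k + 1) (by omega)]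
    rw [← hm, hs]
    simp only [cross]; ring

theorem exists_remove (h : IsStarChain (n + 1) R Q p) {k : ℕ} (hk : p k = 0) :
    ∃ Q' p', IsStarChain n R Q' p' ∧ crossSum n Q' = crossSum (n + 1) Q := by
  obtain ⟨Q', p', h1, h2⟩ := (h.shift (k + 1)).exists_remove_last (by
    rw [show 2 * n + 2 + (k + 1) = k + (2 * (n + 1) + 1) by ring, h.angle_periodic, hk])
  exact ⟨Q', p', h1, by rw [h2, h.crossSum_shift]⟩

/-! ### Existence of a maximizer -/

/-- All conditions are closed, and vertices and angles range in a product of compact sets. Angles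
are only required to be nonnegative in `IsStarChain` for this reason. -/
theorem isCompact_setOf (n : ℕ) (R : ℝ) :
    IsCompact {x : (ℕ → ℂ) × (ℕ → ℝ) | IsStarChain n R x.1 x.2} := by
  have hK : IsCompact ((Set.univ.pi fun _ : ℕ => Metric.closedBall (0 : ℂ) R) ×ˢ
      (Set.univ.pi fun _ : ℕ => Set.Icc (0 : ℝ) Real.pi)) :=
    (isCompact_univ_pi fun _ => isCompact_closedBall 0 R).prod
      (isCompact_univ_pi fun _ => isCompact_Icc)
  refine hK.of_isClosed_subset ?_ ?_
  · have : {x : (ℕ → ℂ) × (ℕ → ℝ) | IsStarChain n R x.1 x.2} =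
        (⋂ k, {x | x.1 (k + (2 * n + 1)) = x.1 k}) ∩ (⋂ k, {x | x.2 (k + (2 * n + 1)) = x.2 k}) ∩
        (⋂ k, {x | ‖x.1 (k + 1) - x.1 k‖ = 1}) ∩
        (⋂ k, {x | x.1 k - x.1 (k + 1) =
          Complex.exp (x.2 (k + 1) * Complex.I) * (x.1 (k + 2) - x.1 (k + 1))}) ∩
        (⋂ k, {x | 0 ≤ x.2 k}) ∩ {x | ∑ k ∈ Finset.range (2 * n + 1), x.2 k = Real.pi} ∩
        (⋂ k, {x | ‖x.1 k‖ ≤ R}) := by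
      ext x
      simp only [Set.mem_ofPred_eq, Set.mem_inter_iff, Set.mem_iInter]
      exact ⟨fun h => ⟨⟨⟨⟨⟨⟨h.1, h.2⟩, h.3⟩, h.4⟩, h.5⟩, h.6⟩, h.7⟩,
        fun ⟨⟨⟨⟨⟨⟨h1, h2⟩, h3⟩, h4⟩, h5⟩, h6⟩, h7⟩ => ⟨h1, h2, h3, h4, h5, h6, h7⟩⟩
    rw [this]
    refine (((((IsClosed.inter ?_ ?_).inter ?_).inter ?_).inter ?_).inter ?_).inter ?_
    · exact isClosed_iInter fun k => isClosed_eq (by fun_prop) (by fun_prop)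
    · exact isClosed_iInter fun k => isClosed_eq (by fun_prop) (by fun_prop)
    · exact isClosed_iInter fun k => isClosed_eq (by fun_prop) (by fun_prop)
    · exact isClosed_iInter fun k => isClosed_eq (by fun_prop) (by fun_prop)
    · exact isClosed_iInter fun k => isClosed_le (by fun_prop) (by fun_prop)
    · exact isClosed_eq (by fun_prop) (by fun_prop)
    · exact isClosed_iInter fun k => isClosed_le (by fun_prop) (by fun_prop)
  · rintro x hx
    refine ⟨fun k _ => ?_, fun k _ => ⟨hx.angle_nonneg k, hx.angle_le_pi k⟩⟩
    rw [mem_closedBall_zero_iff]; exact hx.norm_le k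

theorem exists_maximizer (h : IsStarChain n R Q p) : ∃ Q' p', IsStarChain n R Q' p' ∧
    ∀ Q'' p'', IsStarChain n R Q'' p'' → crossSum n Q'' ≤ crossSum n Q' := by
  have hc : Continuous fun x : (ℕ → ℂ) × (ℕ → ℝ) => crossSum n x.1 := by
    unfold crossSum cross; fun_prop
  obtain ⟨x, hx, hmax⟩ := (isCompact_setOf n R).exists_isMaxOn ⟨(Q, p), h⟩ hc.continuousOn
  exact ⟨x.1, x.2, hx, fun Q'' p'' h'' => hmax (show (Q'', p'') ∈ _ from h'')⟩

/-- In a nondegenerate maximizing chain, no two consecutive vertices are in the open disk. -/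
theorem contact_of_forall_le (h : IsStarChain n R Q p) (hR : 1 / 2 ≤ R) (hR3 : 3 * R ^ 2 ≤ 1)
    (hpos : ∀ k, 0 < p k) (hmax : ∀ Q' p', IsStarChain n R Q' p' → crossSum n Q' ≤ crossSum n Q)
    (k : ℕ) : ‖Q k‖ = R ∨ ‖Q (k + 1)‖ = R := by
  by_contra hcon
  push Not at hcon
  have h1 := lt_of_le_of_ne (h.norm_le _) hcon.1
  have h2 := lt_of_le_of_ne (h.norm_le _) hcon.2
  have e1 : Q (1 + (k + 2 * n)) = Q k := by
    rw [show 1 + (k + 2 * n) = k + (2 * n + 1) by ring, h.vertex_periodic]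
  have e2 : Q (2 + (k + 2 * n)) = Q (k + 1) := by
    rw [show 2 + (k + 2 * n) = k + 1 + (2 * n + 1) by ring, h.vertex_periodic]
  -- A shift by k + 2n, which is k - 1 modulo 2n + 1, moves the vertices k and k + 1 to the
  -- positions 1 and 2.
  obtain ⟨Q', p', h', hlt⟩ := (h.shift (k + 2 * n)).exists_crossSum_lt hR hR3 (fun j => hpos _)
    (by rw [e1]; exact h1) (by rw [e2]; exact h2)
  rw [h.crossSum_shift] at hlt
  exact absurd (hmax Q' p' h') (not_le.2 hlt)

/-! ### The structure of chains without two consecutive inner vertices -/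

/-- The law of cosines at Q (k+1) compares the two outer distances through the angles under which
the origin is seen from the two edges. If the origin is not strictly to the left of edge k, the
positive turning makes the second angle larger, so Q (k+2) is farther away. -/
theorem norm_lt_of_im_apex_nonpos (h : IsStarChain n R Q p) (hR : 1 / 2 ≤ R) (hR3 : 3 * R ^ 2 ≤ 1)
    (hpos : ∀ k, 0 < p k) {k : ℕ} (him : (apex Q k).im ≤ 0) : ‖Q k‖ < ‖Q (k + 2)‖ := by
  have hp := h.angle_succ_eq hR hR3 k
  have hp0 := hpos (k + 1)
  have hv : 0 ≤ Complex.arg (1 - apex Q k) := Complex.arg_nonneg_iff.2 (by simpa using him)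
  have h1 := Complex.norm_mul_cos_arg (apex Q (k + 1))
  have h2 := Complex.norm_mul_cos_arg (1 - apex Q k)
  have hz := h.apex_mem_lens (k + 1)
  have hn := lens_norm_pos hR3 hz
  have hcos : Real.cos (Complex.arg (apex Q (k + 1))) < Real.cos (Complex.arg (1 - apex Q k)) :=
    Real.cos_lt_cos_of_nonneg_of_le_pi hv (Complex.arg_le_pi _) (by linarith)
  rw [h.norm_apex] at h1 hn
  rw [h.norm_one_sub_apex] at h2
  have h3 := mul_lt_mul_of_pos_left hcos hn
  have q1 := Complex.sq_norm_one_sub (apex Q (k + 1))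
  have q2 := Complex.sq_norm_one_sub (1 - apex Q k)
  rw [h.norm_apex, h.norm_one_sub_apex] at q1
  rw [sub_sub_cancel, h.norm_apex, h.norm_one_sub_apex] at q2
  have : ‖Q k‖ ^ 2 < ‖Q (k + 2)‖ ^ 2 := by
    rw [show k + 2 = k + 1 + 1 by ring, q1, q2]; linarith
  exact lt_of_pow_lt_pow_left₀ 2 (norm_nonneg _) this

theorem norm_lt_of_im_apex_succ_nonpos (h : IsStarChain n R Q p) (hR : 1 / 2 ≤ R) (hR3 : 3 * R ^ 2 ≤ 1)
    (hpos : ∀ k, 0 < p k) {k : ℕ} (him : (apex Q (k + 1)).im ≤ 0) : ‖Q (k + 2)‖ < ‖Q k‖ := by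
  have hp := h.angle_succ_eq hR hR3 k
  have hp0 := hpos (k + 1)
  have hz := h.apex_mem_lens (k + 1)
  have hv : Complex.arg (apex Q (k + 1)) ≤ 0 := by
    rcases him.lt_or_eq with h' | h'
    · exact (Complex.arg_neg_iff.2 h').le
    · exact (Complex.arg_eq_zero_iff.2 ⟨(lens_re_pos hR3 hz).le, h'⟩).le
  have h1 := Complex.norm_mul_cos_arg (apex Q (k + 1))
  have h2 := Complex.norm_mul_cos_arg (1 - apex Q k)
  have hn := lens_norm_pos hR3 hz
  have hcos : Real.cos (Complex.arg (1 - apex Q k)) < Real.cos (Complex.arg (apex Q (k + 1))) := by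
    rw [← Real.cos_neg, ← Real.cos_neg (Complex.arg (apex Q (k + 1)))]
    exact Real.cos_lt_cos_of_nonneg_of_le_pi (by linarith)
      (by linarith [Complex.neg_pi_lt_arg (1 - apex Q k)]) (by linarith)
  rw [h.norm_apex] at h1 hn
  rw [h.norm_one_sub_apex] at h2
  have h3 := mul_lt_mul_of_pos_left hcos hn
  have q1 := Complex.sq_norm_one_sub (apex Q (k + 1))
  have q2 := Complex.sq_norm_one_sub (1 - apex Q k)
  rw [h.norm_apex, h.norm_one_sub_apex] at q1
  rw [sub_sub_cancel, h.norm_apex, h.norm_one_sub_apex] at q2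
  have : ‖Q (k + 2)‖ ^ 2 < ‖Q k‖ ^ 2 := by
    rw [show k + 2 = k + 1 + 1 by ring, q1, q2]; linarith
  exact lt_of_pow_lt_pow_left₀ 2 (norm_nonneg _) this

/-- If an endpoint on the circle belonged to an edge of nonpositive height, the vertex at the other
side of that edge's second endpoint would be outside the disk. -/
theorem im_apex_pos (h : IsStarChain n R Q p) (hR : 1 / 2 ≤ R) (hR3 : 3 * R ^ 2 ≤ 1)
    (hpos : ∀ k, 0 < p k) {k : ℕ} (hk : ‖Q k‖ = R ∨ ‖Q (k + 1)‖ = R) : 0 < (apex Q k).im := by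
  by_contra him
  push Not at him
  rcases hk with hk | hk
  · have := h.norm_lt_of_im_apex_nonpos hR hR3 hpos him
    linarith [h.norm_le (k + 2)]
  · rw [← h.apex_periodic, ← add_assoc] at him
    have := h.norm_lt_of_im_apex_succ_nonpos hR hR3 hpos him
    rw [show k + 2 * n + 2 = k + 1 + (2 * n + 1) by ring, h.vertex_periodic, hk] at this
    linarith [h.norm_le (k + 2 * n)]

end IsStarChain

/-! ### Defects attached to the vertices -/

theorem eq_of_norm_eq_of_im_pos {z w : ℂ} (h1 : ‖z‖ = ‖w‖) (h2 : ‖1 - z‖ = ‖1 - w‖)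
    (hz : 0 < z.im) (hw : 0 < w.im) : z = w := by
  have a1 := Complex.sq_norm_one_sub z
  have a2 := Complex.sq_norm_one_sub w
  rw [h1, h2] at a1
  have hre : z.re = w.re := by linarith
  have b1 := Complex.sq_norm_eq z
  have b2 := Complex.sq_norm_eq w
  rw [h1, hre] at b1
  have : z.im ^ 2 = w.im ^ 2 := by linarith
  exact Complex.ext hre ((pow_left_inj₀ hz.le hw.le two_ne_zero).1 this)

/-- The apex defect attached to a vertex of a chain: that of the adjacent edges if the vertex is in
the open disk, and the extremal one otherwise. -/
noncomputable def vertexDefect (R : ℝ) (Q : ℕ → ℂ) (k : ℕ) : ℝ :=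
  open Classical in if ‖Q k‖ < R then defect (apex Q k) else chordAngle R

namespace IsStarChain

variable {n : ℕ} {R : ℝ} {Q : ℕ → ℂ} {p : ℕ → ℝ}

theorem vertexDefect_periodic (h : IsStarChain n R Q p) (k : ℕ) :
    vertexDefect R Q (k + (2 * n + 1)) = vertexDefect R Q k := by
  simp only [vertexDefect, h.vertex_periodic, h.apex_periodic]

theorem vertexDefect_of_lt {k : ℕ} (hk : ‖Q k‖ < R) : vertexDefect R Q k = defect (apex Q k) := by
  rw [vertexDefect, if_pos hk]

theorem vertexDefect_of_eq {k : ℕ} (hk : ‖Q k‖ = R) : vertexDefect R Q k = chordAngle R := by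
  rw [vertexDefect, if_neg (by rw [hk]; exact lt_irrefl _)]

theorem vertexDefect_lt (h : IsStarChain n R Q p) (hR : 1 / 2 ≤ R) (hR3 : 3 * R ^ 2 ≤ 1)
    {k : ℕ} (hk : ‖Q k‖ < R) : vertexDefect R Q k < chordAngle R := by
  rw [vertexDefect_of_lt hk]
  exact defect_lt hR hR3 (h.apex_mem_lens k) (by rw [h.norm_apex]; exact hk)

theorem vertexDefect_le (h : IsStarChain n R Q p) (hR : 1 / 2 ≤ R) (hR3 : 3 * R ^ 2 ≤ 1)
    (k : ℕ) : vertexDefect R Q k ≤ chordAngle R := by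
  rcases (h.norm_le k).lt_or_eq with hk | hk
  · exact (h.vertexDefect_lt hR hR3 hk).le
  · exact (vertexDefect_of_eq hk).le

theorem vertexDefect_pos (h : IsStarChain n R Q p) (hR : 1 / 2 < R) (hR3 : 3 * R ^ 2 ≤ 1)
    (hpos : ∀ k, 0 < p k) (hc : ∀ k, ‖Q k‖ = R ∨ ‖Q (k + 1)‖ = R) (k : ℕ) :
    0 < vertexDefect R Q k := by
  rcases (h.norm_le k).lt_or_eq with hk | hk
  · rw [vertexDefect_of_lt hk]; exact defect_pos (h.im_apex_pos hR.le hR3 hpos (hc k))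
  · rw [vertexDefect_of_eq hk]; exact chordAngle_pos hR

/-- The defect of an edge is that of its inner endpoint, if any. -/
theorem defect_apex_eq (h : IsStarChain n R Q p) (hR : 1 / 2 ≤ R) (hR3 : 3 * R ^ 2 ≤ 1)
    (hpos : ∀ k, 0 < p k) (hc : ∀ k, ‖Q k‖ = R ∨ ‖Q (k + 1)‖ = R) (k : ℕ) :
    (defect (apex Q k) = vertexDefect R Q k ∧ vertexDefect R Q (k + 1) = chordAngle R) ∨
    (defect (apex Q k) = vertexDefect R Q (k + 1) ∧ vertexDefect R Q k = chordAngle R) := by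
  have him := fun j => h.im_apex_pos hR hR3 hpos (hc j)
  rcases (h.norm_le k).lt_or_eq with hk | hk
  · left
    have hk1 : ‖Q (k + 1)‖ = R := (hc k).resolve_left hk.ne
    exact ⟨(vertexDefect_of_lt hk).symm, vertexDefect_of_eq hk1⟩
  · right
    refine ⟨?_, vertexDefect_of_eq hk⟩
    rcases (h.norm_le (k + 1)).lt_or_eq with hk1 | hk1
    · rw [vertexDefect_of_lt hk1]
      have hk2 : ‖Q (k + 2)‖ = R := (hc (k + 1)).resolve_left hk1.ne
      have hz := h.apex_mem_lens k
      -- At an inner vertex both outer neighbors are on the circle, so the triangles over the two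
      -- edges have the same legs in reverse order: they are mirror images.
      rw [← defect_one_sub_conj (lens_re_pos hR3 hz) (lens_re_pos hR3 (lens_one_sub hz))]
      congr 1
      have e : (1 : ℂ) - (starRingEnd ℂ) (apex Q k) = (starRingEnd ℂ) (1 - apex Q k) := by simp
      refine eq_of_norm_eq_of_im_pos ?_ ?_ ?_ (him _)
      · rw [e, Complex.norm_conj, h.norm_one_sub_apex, h.norm_apex]
      · rw [sub_sub_cancel, Complex.norm_conj, h.norm_one_sub_apex, h.norm_apex, hk, hk2]
      · simpa using him k
    · rw [vertexDefect_of_eq hk1]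
      have := defect_eq_of_norm_eq hR (by rw [h.norm_apex, hk]) (by rw [h.norm_one_sub_apex, hk1]) (him k)
      rw [defect, this.1, this.2]; ring

theorem im_apex_eq_height (h : IsStarChain n R Q p) (hR3 : 3 * R ^ 2 ≤ 1)
    (hc : ∀ k, ‖Q k‖ = R ∨ ‖Q (k + 1)‖ = R) (k : ℕ) :
    (apex Q k).im = height R (defect (apex Q k)) := by
  refine im_eq_height hR3 (h.apex_mem_lens k) ?_
  rw [h.norm_apex, h.norm_one_sub_apex]; exact hc k

/-- Since at least one endpoint of each edge has vertex defect ℓ, the defect of an edge is the sum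
of those of its endpoints minus ℓ. The same additive form holds for heights in
`crossSum_eq_sum_height`. -/
theorem sum_vertexDefect (h : IsStarChain n R Q p) (hR : 1 / 2 ≤ R) (hR3 : 3 * R ^ 2 ≤ 1)
    (hpos : ∀ k, 0 < p k) (hc : ∀ k, ‖Q k‖ = R ∨ ‖Q (k + 1)‖ = R) :
    2 * ∑ k ∈ Finset.range (2 * n + 1), vertexDefect R Q k
      = Real.pi + (2 * n + 1) * chordAngle R := by
  have h1 : ∀ k, defect (apex Q k) = vertexDefect R Q k + vertexDefect R Q (k + 1) - chordAngle R := by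
    intro k
    rcases h.defect_apex_eq hR hR3 hpos hc k with ⟨a, b⟩ | ⟨a, b⟩ <;> rw [a, b] <;> ring
  have h2 := h.defect_sum hR hR3
  simp only [h1, Finset.sum_sub_distrib, Finset.sum_add_distrib,
    sum_range_periodic_succ h.vertexDefect_periodic] at h2
  simp at h2
  linarith

theorem crossSum_eq_sum_height (h : IsStarChain n R Q p) (hR : 1 / 2 ≤ R) (hR3 : 3 * R ^ 2 ≤ 1)
    (hpos : ∀ k, 0 < p k) (hc : ∀ k, ‖Q k‖ = R ∨ ‖Q (k + 1)‖ = R) :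
    2 * ∑ k ∈ Finset.range (2 * n + 1), height R (vertexDefect R Q k)
      = crossSum n Q + (2 * n + 1) * height R (chordAngle R) := by
  have h1 : ∀ k, (apex Q k).im = height R (vertexDefect R Q k) + height R (vertexDefect R Q (k + 1))
      - height R (chordAngle R) := by
    intro k
    rw [h.im_apex_eq_height hR3 hc]
    rcases h.defect_apex_eq hR hR3 hpos hc k with ⟨a, b⟩ | ⟨a, b⟩ <;> rw [a, b] <;> ring
  rw [crossSum_eq]
  simp only [h1, Finset.sum_sub_distrib, Finset.sum_add_distrib]
  rw [sum_range_periodic_succ (f := fun k => height R (vertexDefect R Q k))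
    (fun k => by simp only [h.vertexDefect_periodic])]
  simp
  ring

/-! ### The isoperimetric bound -/

/-- By the choice of N and e the vertex defects have sum (n + N)ℓ + e, so the convex rearrangement
inequality bounds the sum of their heights. The number n cancels from the final bound. -/
theorem crossSum_le_of_contact (h : IsStarChain n R Q p) (hR : 1 / 2 < R) (hR3 : 3 * R ^ 2 ≤ 1)
    (hpos : ∀ k, 0 < p k) (hc : ∀ k, ‖Q k‖ = R ∨ ‖Q (k + 1)‖ = R) {N : ℕ} {e : ℝ}
    (he : 0 ≤ e) (he' : e ≤ chordAngle R) (hN : Real.pi + chordAngle R = 2 * N * chordAngle R + 2 * e) :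
    crossSum n Q ≤ (2 * N - 1) * height R (chordAngle R) + 2 * height R e := by
  have h1 := h.sum_vertexDefect hR.le hR3 hpos hc
  have h2 := h.crossSum_eq_sum_height hR.le hR3 hpos hc
  have h3 := (strictConvexOn_height hR.le hR3).sum_map_le (height_zero R)
    ((Finset.range (2 * n + 1)).val.map (vertexDefect R Q)) (by
      intro x hx
      obtain ⟨k, -, rfl⟩ := Multiset.mem_map.1 hx
      exact ⟨(h.vertexDefect_pos hR hR3 hpos hc k).le, h.vertexDefect_le hR.le hR3 k⟩)
    (n + N) e he he' (by
      change ∑ k ∈ Finset.range (2 * n + 1), vertexDefect R Q k = _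
      push_cast; linarith)
  rw [Multiset.map_map] at h3
  change ∑ k ∈ Finset.range (2 * n + 1), height R (vertexDefect R Q k) ≤ _ at h3
  push_cast at h3
  linarith

theorem crossSum_lt_of_contact (h : IsStarChain n R Q p) (hR : 1 / 2 < R) (hR3 : 3 * R ^ 2 ≤ 1)
    (hpos : ∀ k, 0 < p k) (hc : ∀ k, ‖Q k‖ = R ∨ ‖Q (k + 1)‖ = R) {N : ℕ} {e : ℝ}
    (he : 0 ≤ e) (he' : e ≤ chordAngle R) (hN : Real.pi + chordAngle R = 2 * N * chordAngle R + 2 * e)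
    {i j : ℕ} (hi : i < 2 * n + 1) (hj : j < 2 * n + 1) (hij : i ≠ j) (hQi : ‖Q i‖ < R)
    (hQj : ‖Q j‖ < R) :
    crossSum n Q < (2 * N - 1) * height R (chordAngle R) + 2 * height R e := by
  have h1 := h.sum_vertexDefect hR.le hR3 hpos hc
  have h2 := h.crossSum_eq_sum_height hR.le hR3 hpos hc
  have hS : (Finset.range (2 * n + 1)).val = i ::ₘ j ::ₘ (((Finset.range (2 * n + 1)).erase i).erase j).val := by
    rw [Finset.erase_val, Finset.erase_val, Multiset.cons_erase, Multiset.cons_erase]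
    · exact Finset.mem_range.2 hi
    · exact (Multiset.mem_erase_of_ne hij.symm).2 (Finset.mem_range.2 hj)
  have h3 := (strictConvexOn_height hR.le hR3).sum_map_lt (height_zero R)
    ((((Finset.range (2 * n + 1)).erase i).erase j).val.map (vertexDefect R Q)) (by
      intro x hx
      obtain ⟨k, -, rfl⟩ := Multiset.mem_map.1 hx
      exact ⟨(h.vertexDefect_pos hR hR3 hpos hc k).le, h.vertexDefect_le hR.le hR3 k⟩)
    ⟨h.vertexDefect_pos hR hR3 hpos hc i, h.vertexDefect_lt hR.le hR3 hQi⟩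
    ⟨h.vertexDefect_pos hR hR3 hpos hc j, h.vertexDefect_lt hR.le hR3 hQj⟩
    (n + N) e he he' (by
      rw [← Multiset.map_cons, ← Multiset.map_cons, ← hS]
      change ∑ k ∈ Finset.range (2 * n + 1), vertexDefect R Q k = _
      push_cast; linarith)
  rw [← Multiset.map_cons, ← Multiset.map_cons, ← hS, Multiset.map_map] at h3
  change ∑ k ∈ Finset.range (2 * n + 1), height R (vertexDefect R Q k) < _ at h3
  push_cast at h3
  linarith

/-- Induction on n: a maximizer either has a zero angle, and loses two edges, or satisfies the
contact condition. The bound being independent of n makes the induction close. -/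
theorem crossSum_le (hR : 1 / 2 < R) (hR3 : 3 * R ^ 2 ≤ 1) {N : ℕ} {e : ℝ}
    (he : 0 ≤ e) (he' : e ≤ chordAngle R) (hN : Real.pi + chordAngle R = 2 * N * chordAngle R + 2 * e) :
    ∀ (n : ℕ) (Q : ℕ → ℂ) (p : ℕ → ℝ), IsStarChain n R Q p →
      crossSum n Q ≤ (2 * N - 1) * height R (chordAngle R) + 2 * height R e := by
  intro n
  induction n with
  | zero => intro Q p h; exact absurd h.one_le (by norm_num)
  | succ n ih =>
    intro Q p h
    obtain ⟨Q', p', h', hmax⟩ := h.exists_maximizer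
    refine (hmax Q p h).trans ?_
    by_cases hz : ∃ k, p' k = 0
    · obtain ⟨k, hk⟩ := hz
      obtain ⟨Q'', p'', h'', heq⟩ := h'.exists_remove hk
      rw [← heq]
      exact ih Q'' p'' h''
    · push Not at hz
      have hpos : ∀ k, 0 < p' k := fun k => lt_of_le_of_ne (h'.angle_nonneg k) (hz k).symm
      exact h'.crossSum_le_of_contact hR hR3 hpos (h'.contact_of_forall_le hR.le hR3 hpos hmax) he he' hN

end IsStarChain

/-! ### The equality case: chains with at most one inner vertex -/

theorem sum_range_eq_of_ne {m : ℕ} {f : ℕ → ℝ} {c : ℝ} {k₀ : ℕ} (hk₀ : k₀ < m)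
    (hf : ∀ k < m, k ≠ k₀ → f k = c) : ∑ k ∈ Finset.range m, f k = f k₀ + (m - 1) * c := by
  rw [← Finset.add_sum_erase _ f (Finset.mem_range.2 hk₀)]
  congr 1
  rw [Finset.sum_congr rfl (g := fun _ => c) (fun k hk => ?_)]
  · rw [Finset.sum_const, Finset.card_erase_of_mem (Finset.mem_range.2 hk₀), Finset.card_range,
      nsmul_eq_mul, Nat.cast_sub (by omega)]
    simp
  · rw [Finset.mem_erase, Finset.mem_range] at hk
    exact hf k hk.2 hk.1

/-- All vertices of the chain are on the circle of radius `R`, except possibly the one of index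
`k₀`. -/
structure HasAtMostOneInner (n : ℕ) (R : ℝ) (Q : ℕ → ℂ) (k₀ : ℕ) : Prop where
  lt : k₀ < 2 * n + 1
  norm_eq : ∀ j, j % (2 * n + 1) ≠ k₀ → ‖Q j‖ = R

namespace IsStarChain

variable {n : ℕ} {R : ℝ} {Q : ℕ → ℂ} {p : ℕ → ℝ}

theorem contact_of_hasAtMostOneInner (h : IsStarChain n R Q p) {k₀ : ℕ}
    (h₀ : HasAtMostOneInner n R Q k₀) (k : ℕ) : ‖Q k‖ = R ∨ ‖Q (k + 1)‖ = R := by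
  have hn := h.one_le
  by_cases hk : k % (2 * n + 1) = k₀
  · right
    refine h₀.norm_eq _ fun hk' => ?_
    have h1 : (k + 1) % (2 * n + 1) = (k + 0) % (2 * n + 1) := by rw [hk', add_zero, hk]
    have h2 : 1 ≡ 0 [MOD (2 * n + 1)] := Nat.ModEq.add_left_cancel' k h1
    rw [Nat.ModEq, Nat.zero_mod, Nat.mod_eq_of_lt (by omega)] at h2
    omega
  · left; exact h₀.norm_eq _ hk

theorem sum_of_hasAtMostOneInner {k₀ : ℕ} (h₀ : HasAtMostOneInner n R Q k₀) (f : ℝ → ℝ) :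
    ∑ k ∈ Finset.range (2 * n + 1), f (vertexDefect R Q k)
      = f (vertexDefect R Q k₀) + 2 * n * f (chordAngle R) := by
  rw [sum_range_eq_of_ne (f := fun k => f (vertexDefect R Q k)) (c := f (chordAngle R)) h₀.lt]
  · push_cast; ring
  · intro k hk hne
    rw [vertexDefect_of_eq (h₀.norm_eq k (by rwa [Nat.mod_eq_of_lt hk]))]

variable {N : ℕ} {e : ℝ}

theorem exists_hasAtMostOneInner (h : IsStarChain n R Q p) (hR : 1 / 2 < R) (hR3 : 3 * R ^ 2 ≤ 1)
    (hpos : ∀ k, 0 < p k) (he : 0 < e) (he' : e ≤ chordAngle R)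
    (hN : Real.pi + chordAngle R = 2 * N * chordAngle R + 2 * e)
    (heq : crossSum n Q = (2 * N - 1) * height R (chordAngle R) + 2 * height R e) :
    n = N ∧ ∃ k₀, HasAtMostOneInner n R Q k₀ ∧ vertexDefect R Q k₀ = e := by
  have hc := h.contact_of_forall_le hR.le hR3 hpos (fun Q' p' h' => by
    rw [heq]; exact crossSum_le hR hR3 he.le he' hN n Q' p' h')
  obtain ⟨k₀, h₀⟩ : ∃ k₀, HasAtMostOneInner n R Q k₀ := by
    by_cases hex : ∃ i < 2 * n + 1, ‖Q i‖ < R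
    · obtain ⟨i, hi, hQi⟩ := hex
      refine ⟨i, hi, fun j hj => ?_⟩
      by_contra hne
      have hQj : ‖Q (j % (2 * n + 1))‖ < R := by
        rw [periodic_mod h.vertex_periodic]; exact lt_of_le_of_ne (h.norm_le j) hne
      have := h.crossSum_lt_of_contact hR hR3 hpos hc he.le he' hN hi
        (Nat.mod_lt j (by omega)) (Ne.symm hj) hQi hQj
      exact absurd heq this.ne
    · push Not at hex
      refine ⟨0, by omega, fun j _ => ?_⟩
      rw [← periodic_mod h.vertex_periodic j]
      exact le_antisymm (h.norm_le _) (hex _ (Nat.mod_lt _ (by omega)))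
  have h1 := h.sum_vertexDefect hR.le hR3 hpos hc
  rw [sum_of_hasAtMostOneInner h₀ (fun x => x)] at h1
  have h2 := h.vertexDefect_pos hR hR3 hpos hc k₀
  have h3 := h.vertexDefect_le hR.le hR3 k₀
  have hl := chordAngle_pos hR
  -- Both the vertex defect and e lie in (0, ℓ], so their difference is less than ℓ in absolute
  -- value; this forces n = N.
  have key : (N : ℝ) * chordAngle R - n * chordAngle R = vertexDefect R Q k₀ - e := by linarith
  have hnN : n = N := by
    have a1 : ((N : ℝ) - n) * chordAngle R < 1 * chordAngle R := by linarith
    have a2 : (-1 : ℝ) * chordAngle R < ((N : ℝ) - n) * chordAngle R := by linarith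
    have b1 := lt_of_mul_lt_mul_right a1 hl.le
    have b2 := lt_of_mul_lt_mul_right a2 hl.le
    have c1 : (N : ℝ) < n + 1 := by linarith
    have c2 : (n : ℝ) < N + 1 := by linarith
    have d1 : N < n + 1 := by exact_mod_cast c1
    have d2 : n < N + 1 := by exact_mod_cast c2
    omega
  refine ⟨hnN, k₀, h₀, ?_⟩
  rw [hnN] at key; linarith

theorem vertexDefect_eq_of_hasAtMostOneInner (h : IsStarChain N R Q p) (hR : 1 / 2 < R)
    (hR3 : 3 * R ^ 2 ≤ 1) (hpos : ∀ k, 0 < p k)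
    (hN : Real.pi + chordAngle R = 2 * N * chordAngle R + 2 * e)
    {k₀ : ℕ} (h₀ : HasAtMostOneInner N R Q k₀) : vertexDefect R Q k₀ = e := by
  have h1 := h.sum_vertexDefect hR.le hR3 hpos (h.contact_of_hasAtMostOneInner h₀)
  rw [sum_of_hasAtMostOneInner h₀ (fun x => x)] at h1
  linarith

theorem crossSum_eq_of_hasAtMostOneInner (h : IsStarChain N R Q p) (hR : 1 / 2 < R)
    (hR3 : 3 * R ^ 2 ≤ 1) (hpos : ∀ k, 0 < p k)
    (hN : Real.pi + chordAngle R = 2 * N * chordAngle R + 2 * e)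
    {k₀ : ℕ} (h₀ : HasAtMostOneInner N R Q k₀) :
    crossSum N Q = (2 * N - 1) * height R (chordAngle R) + 2 * height R e := by
  have h1 := h.crossSum_eq_sum_height hR.le hR3 hpos (h.contact_of_hasAtMostOneInner h₀)
  rw [sum_of_hasAtMostOneInner h₀, h.vertexDefect_eq_of_hasAtMostOneInner hR hR3 hpos hN h₀] at h1
  linarith

/-! ### Congruence of extremal chains -/

theorem hasAtMostOneInner_shift {k₀ : ℕ} (h₀ : HasAtMostOneInner n R Q k₀) :
    HasAtMostOneInner n R (fun k => Q (k + k₀)) 0 := by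
  refine ⟨by omega, fun j hj => h₀.norm_eq _ fun h' => hj ?_⟩
  have h1 : (j + k₀) % (2 * n + 1) = (0 + k₀) % (2 * n + 1) := by
    rw [h', zero_add, Nat.mod_eq_of_lt h₀.lt]
  have h2 : j ≡ 0 [MOD (2 * n + 1)] := Nat.ModEq.add_right_cancel' k₀ h1
  simpa [Nat.ModEq] using h2

theorem norm_eq_of_hasAtMostOneInner_zero (h₀ : HasAtMostOneInner n R Q 0) {k : ℕ} (hk : 0 < k)
    (hk' : k < 2 * n + 1) : ‖Q k‖ = R :=
  h₀.norm_eq k (by rw [Nat.mod_eq_of_lt hk']; omega)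

/-- The remaining vertex defect is forced by the total, so all edge defects and then all heights
agree. A leg of length R and the positive real part fix the apex; at the possibly inner index 0 the
leg at Q 1 is used. -/
theorem apex_eq_of_hasAtMostOneInner {Q' : ℕ → ℂ} {p' : ℕ → ℝ} (h : IsStarChain N R Q p)
    (h' : IsStarChain N R Q' p') (hR : 1 / 2 < R) (hR3 : 3 * R ^ 2 ≤ 1) (hpos : ∀ k, 0 < p k)
    (hpos' : ∀ k, 0 < p' k) (h₀ : HasAtMostOneInner N R Q 0) (h₀' : HasAtMostOneInner N R Q' 0) :
    ∀ k, apex Q k = apex Q' k := by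
  obtain ⟨e, hN⟩ : ∃ e, Real.pi + chordAngle R = 2 * N * chordAngle R + 2 * e :=
    ⟨(Real.pi + chordAngle R - 2 * N * chordAngle R) / 2, by ring⟩
  have hc := h.contact_of_hasAtMostOneInner h₀
  have hc' := h'.contact_of_hasAtMostOneInner h₀'
  have him := fun j => h.im_apex_pos hR.le hR3 hpos (hc j)
  have him' := fun j => h'.im_apex_pos hR.le hR3 hpos' (hc' j)
  have hd := h.vertexDefect_eq_of_hasAtMostOneInner hR hR3 hpos hN h₀
  have hd' := h'.vertexDefect_eq_of_hasAtMostOneInner hR hR3 hpos' hN h₀'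
  have hn := h.one_le
  have hvd : ∀ k < 2 * N + 1, vertexDefect R Q k = vertexDefect R Q' k := by
    intro k hk
    rcases Nat.eq_zero_or_pos k with rfl | hk0
    · rw [hd, hd']
    · rw [vertexDefect_of_eq (norm_eq_of_hasAtMostOneInner_zero h₀ hk0 hk),
        vertexDefect_of_eq (norm_eq_of_hasAtMostOneInner_zero h₀' hk0 hk)]
  have hvd2 : ∀ k, vertexDefect R Q k = vertexDefect R Q' k := by
    intro k
    rw [← periodic_mod h.vertexDefect_periodic, ← periodic_mod h'.vertexDefect_periodic k]
    exact hvd _ (Nat.mod_lt _ (by omega))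
  have himeq : ∀ k, (apex Q k).im = (apex Q' k).im := by
    intro k
    have e1 : defect (apex Q k) = vertexDefect R Q k + vertexDefect R Q (k + 1) - chordAngle R := by
      rcases h.defect_apex_eq hR.le hR3 hpos hc k with ⟨a, b⟩ | ⟨a, b⟩ <;> rw [a, b] <;> ring
    have e2 : defect (apex Q' k) = vertexDefect R Q' k + vertexDefect R Q' (k + 1) - chordAngle R := by
      rcases h'.defect_apex_eq hR.le hR3 hpos' hc' k with ⟨a, b⟩ | ⟨a, b⟩ <;> rw [a, b] <;> ring
    rw [h.im_apex_eq_height hR3 hc, h'.im_apex_eq_height hR3 hc', e1, e2, hvd2, hvd2]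
  have aux : ∀ {z w : ℂ}, ‖z‖ = R → ‖w‖ = R → 0 < z.re → 0 < w.re → z.im = w.im → z = w := by
    intro z w h1 h2 h3 h4 h5
    have b1 := Complex.sq_norm_eq z
    have b2 := Complex.sq_norm_eq w
    rw [h1, h5] at b1; rw [h2] at b2
    exact Complex.ext ((pow_left_inj₀ h3.le h4.le two_ne_zero).1 (by linarith)) h5
  have hlt : ∀ k < 2 * N + 1, apex Q k = apex Q' k := by
    intro k hk
    rcases Nat.eq_zero_or_pos k with rfl | hk0
    · have h1 := norm_eq_of_hasAtMostOneInner_zero h₀ one_pos (by omega)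
      have h2 := norm_eq_of_hasAtMostOneInner_zero h₀' one_pos (by omega)
      have := aux (z := 1 - apex Q 0) (w := 1 - apex Q' 0) (by rw [h.norm_one_sub_apex]; exact h1)
        (by rw [h'.norm_one_sub_apex]; exact h2) (lens_re_pos hR3 (lens_one_sub (h.apex_mem_lens 0)))
        (lens_re_pos hR3 (lens_one_sub (h'.apex_mem_lens 0))) (by simp [himeq 0])
      linear_combination -this
    · exact aux (by rw [h.norm_apex]; exact norm_eq_of_hasAtMostOneInner_zero h₀ hk0 hk)
        (by rw [h'.norm_apex]; exact norm_eq_of_hasAtMostOneInner_zero h₀' hk0 hk)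
        (lens_re_pos hR3 (h.apex_mem_lens k)) (lens_re_pos hR3 (h'.apex_mem_lens k)) (himeq k)
  intro k
  rw [← periodic_mod h.apex_periodic, ← periodic_mod h'.apex_periodic k]
  exact hlt _ (Nat.mod_lt _ (by omega))

/-- Two consecutive edges are related by their apices, since both express the common vertex. Equal
apices therefore keep the ratio of corresponding edges constant. -/
theorem exists_rotation_of_apex_eq {Q' : ℕ → ℂ} {p' : ℕ → ℝ} (h : IsStarChain n R Q p)
    (h' : IsStarChain n R Q' p') (hR3 : 3 * R ^ 2 ≤ 1) (ha : ∀ k, apex Q k = apex Q' k) :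
    ∃ u : ℂ, ‖u‖ = 1 ∧ ∀ k, Q' k = u * Q k := by
  refine ⟨edge Q' 0 / edge Q 0, by rw [norm_div, h.norm_edge', h'.norm_edge', div_one], ?_⟩
  have he : ∀ k, edge Q' k = edge Q' 0 / edge Q 0 * edge Q k := by
    intro k
    induction k with
    | zero => rw [div_mul_cancel₀ _ (h.edge_ne_zero 0)]
    | succ k ih =>
      have h1 := h.vertex_succ_eq k
      have h2 := h'.vertex_succ_eq k
      rw [h.vertex_eq (k + 1)] at h1
      rw [h'.vertex_eq (k + 1), ← ha, ← ha, ih] at h2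
      apply mul_left_cancel₀ (lens_ne_zero hR3 (h.apex_mem_lens (k + 1)))
      linear_combination (edge Q' 0 / edge Q 0) * h1 - h2
  intro k
  rw [h.vertex_eq k, h'.vertex_eq k, he k, ← ha k]; ring

/-- Two nondegenerate extremal chains coincide up to a rotation and a shift of the indices. -/
theorem exists_rotation {Q' : ℕ → ℂ} {p' : ℕ → ℝ} (h : IsStarChain N R Q p)
    (h' : IsStarChain N R Q' p') (hR : 1 / 2 < R) (hR3 : 3 * R ^ 2 ≤ 1) (hpos : ∀ k, 0 < p k)
    (hpos' : ∀ k, 0 < p' k) {k₀ k₀' : ℕ} (h₀ : HasAtMostOneInner N R Q k₀)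
    (h₀' : HasAtMostOneInner N R Q' k₀') :
    ∃ u : ℂ, ‖u‖ = 1 ∧ ∀ k, Q' (k + k₀') = u * Q (k + k₀) :=
  (h.shift k₀).exists_rotation_of_apex_eq (h'.shift k₀') hR3
    ((h.shift k₀).apex_eq_of_hasAtMostOneInner (h'.shift k₀') hR hR3 (fun _ => hpos _)
      (fun _ => hpos' _) (hasAtMostOneInner_shift h₀) (hasAtMostOneInner_shift h₀'))

end IsStarChain

/-! ### The area of the cone over a circular arc -/

/-- The component of `w` in the direction `e^{it}`. -/
noncomputable def proj (t : ℝ) (w : ℂ) : ℝ := w.re * Real.cos t + w.im * Real.sin t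

theorem proj_add (t : ℝ) (z w : ℂ) : proj t (z + w) = proj t z + proj t w := by
  simp [proj]; ring

theorem proj_sub (t : ℝ) (z w : ℂ) : proj t (z - w) = proj t z - proj t w := by
  simp [proj]; ring

theorem proj_smul (t s : ℝ) (w : ℂ) : proj t (s • w) = s * proj t w := by
  simp [proj]; ring

theorem exp_mul_I_re (t : ℝ) : (Complex.exp (t * Complex.I)).re = Real.cos t :=
  Complex.exp_ofReal_mul_I_re t

theorem exp_mul_I_im (t : ℝ) : (Complex.exp (t * Complex.I)).im = Real.sin t :=
  Complex.exp_ofReal_mul_I_im t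

theorem proj_exp (t s : ℝ) : proj t (Complex.exp (s * Complex.I)) = Real.cos (s - t) := by
  rw [proj, exp_mul_I_re, exp_mul_I_im, Real.cos_sub]

theorem proj_exp_self (t : ℝ) : proj t (Complex.exp (t * Complex.I)) = 1 := by simp [proj_exp]

theorem sq_norm_sub_exp (t : ℝ) (w : ℂ) :
    ‖w - Complex.exp (t * Complex.I)‖ ^ 2 = ‖w‖ ^ 2 - 2 * proj t w + 1 := by
  rw [Complex.sq_norm_eq, Complex.sq_norm_eq, Complex.sub_re, Complex.sub_im, exp_mul_I_re,
    exp_mul_I_im, proj]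
  linear_combination Real.sin_sq_add_cos_sq t

theorem proj_le_norm (t : ℝ) (w : ℂ) : proj t w ≤ ‖w‖ := by
  have h1 := Complex.sq_norm_eq w
  have h2 := Real.sin_sq_add_cos_sq t
  refine le_of_sq_le_sq ?_ (norm_nonneg w)
  rw [h1, proj]
  nlinarith [sq_nonneg (w.re * Real.sin t - w.im * Real.cos t)]

theorem eq_exp_of_proj_ge {t : ℝ} {w : ℂ} (hw : ‖w‖ ≤ 1) (h : 1 ≤ proj t w) :
    w = Complex.exp (t * Complex.I) := by
  have h1 := sq_norm_sub_exp t w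
  have h2 : ‖w‖ ^ 2 ≤ 1 := by nlinarith [norm_nonneg w]
  have h3 : ‖w - Complex.exp (t * Complex.I)‖ ^ 2 = 0 :=
    le_antisymm (by linarith) (sq_nonneg _)
  rw [sq_eq_zero_iff, norm_eq_zero, sub_eq_zero] at h3
  exact h3

/-- The cone with apex `0` over the unit circle centered at `w`. -/
noncomputable def coneMap (w : ℂ) (x : ℝ × ℝ) : ℂ := x.1 • (w + Complex.exp (x.2 * Complex.I))

/-- The area of the cone with apex `0` over an arc of the unit circle centered at `w`. -/
noncomputable def coneArea (w : ℂ) (a b : ℝ) : ℝ :=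
  (b - a + w.re * (Real.sin b - Real.sin a) + w.im * (Real.cos a - Real.cos b)) / 2

theorem hasFDerivAt_realCone (c d : ℝ) (p : ℝ × ℝ) :
    HasFDerivAt (fun x : ℝ × ℝ => (x.1 * (c + Real.cos x.2), x.1 * (d + Real.sin x.2)))
      (LinearMap.toContinuousLinearMap (Matrix.toLin (.finTwoProd ℝ) (.finTwoProd ℝ)
        !![c + Real.cos p.2, -p.1 * Real.sin p.2; d + Real.sin p.2, p.1 * Real.cos p.2])) p := by
  rw [Matrix.toLin_finTwoProd_toContinuousLinearMap]
  have h1 := (hasFDerivAt_fst (𝕜 := ℝ) (p := p)).mul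
    (((Real.hasDerivAt_cos p.2).comp_hasFDerivAt p hasFDerivAt_snd).const_add c)
  have h2 := (hasFDerivAt_fst (𝕜 := ℝ) (p := p)).mul
    (((Real.hasDerivAt_sin p.2).comp_hasFDerivAt p hasFDerivAt_snd).const_add d)
  convert! HasFDerivAt.prodMk (𝕜 := ℝ) h1 h2 using 2 <;>
  simp [smul_smul, add_comm, neg_mul, smul_neg, neg_smul _ (ContinuousLinearMap.snd ℝ ℝ ℝ)]

/-- The Jacobian of the cone map at (s, t) is s(1 + proj t w). The sets I and J are left general to
cover open rectangles, where injectivity gives the exact area, and closed ones, where only an upper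
bound is needed. -/
theorem lintegral_cone {w : ℂ} {a b : ℝ} (hab : a ≤ b) (hpos : ∀ t ∈ Set.Icc a b, 0 ≤ 1 + proj t w)
    {I J : Set ℝ} (hI : MeasurableSet I) (hJ : MeasurableSet J) (hIs : I ⊆ Set.Icc 0 1)
    (hJs : J ⊆ Set.Icc a b) (hIr : (volume.restrict I : Measure ℝ) = volume.restrict (Set.Ioc 0 1))
    (hJr : (volume.restrict J : Measure ℝ) = volume.restrict (Set.Ioc a b)) :
    ∫⁻ p in I ×ˢ J, ENNReal.ofReal |(LinearMap.toContinuousLinearMap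
      (Matrix.toLin (.finTwoProd ℝ) (.finTwoProd ℝ)
        !![w.re + Real.cos p.2, -p.1 * Real.sin p.2; w.im + Real.sin p.2, p.1 * Real.cos p.2])).det|
      = ENNReal.ofReal (coneArea w a b) := by
  have hdet : ∀ p : ℝ × ℝ, (LinearMap.toContinuousLinearMap
      (Matrix.toLin (.finTwoProd ℝ) (.finTwoProd ℝ)
        !![w.re + Real.cos p.2, -p.1 * Real.sin p.2; w.im + Real.sin p.2, p.1 * Real.cos p.2])).det
      = p.1 * (1 + proj p.2 w) := by
    intro p
    simp only [neg_mul, LinearMap.det_toContinuousLinearMap, LinearMap.det_toLin,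
      Matrix.det_fin_two_of, sub_neg_eq_add, proj]
    linear_combination p.1 * Real.sin_sq_add_cos_sq p.2
  rw [setLIntegral_congr_fun (g := fun p : ℝ × ℝ => ENNReal.ofReal p.1 * ENNReal.ofReal (1 + proj p.2 w))
    (hI.prod hJ)]
  swap
  · intro p hp
    have h1 := (hIs hp.1).1
    have h2 := hpos _ (hJs hp.2)
    simp only [hdet]
    rw [abs_of_nonneg (mul_nonneg h1 h2), ENNReal.ofReal_mul h1]
  have hcont : Continuous fun t : ℝ => 1 + proj t w := by unfold proj; fun_prop
  rw [Measure.volume_eq_prod, ← Measure.prod_restrict, hIr, hJr, lintegral_prod_mul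
    (f := fun s : ℝ => ENNReal.ofReal s) (g := fun t : ℝ => ENNReal.ofReal (1 + proj t w))
    (ENNReal.measurable_ofReal.comp measurable_id).aemeasurable
    (ENNReal.measurable_ofReal.comp hcont.measurable).aemeasurable]
  rw [← ofReal_integral_eq_lintegral_ofReal, ← ofReal_integral_eq_lintegral_ofReal,
    ← ENNReal.ofReal_mul]
  · rw [← intervalIntegral.integral_of_le hab, ← intervalIntegral.integral_of_le zero_le_one]
    congr 1
    have e1 : ∫ x in (0 : ℝ)..1, id x = 1 / 2 := by simp
    have e2 : ∫ t in a..b, (1 + proj t w) = b - a + w.re * (Real.sin b - Real.sin a)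
        + w.im * (Real.cos a - Real.cos b) := by
      unfold proj
      rw [intervalIntegral.integral_add (by simp) (Continuous.intervalIntegrable (by fun_prop) _ _),
        intervalIntegral.integral_add (Continuous.intervalIntegrable (by fun_prop) _ _)
          (Continuous.intervalIntegrable (by fun_prop) _ _)]
      simp
      ring
    have e1' : ∫ x in (0 : ℝ)..1, x = 1 / 2 := e1
    rw [e1', e2, coneArea]; ring
  · exact setIntegral_nonneg measurableSet_Ioc fun t ht => ht.1.le
  · exact (hcont.integrableOn_Icc (a := a) (b := b)).mono_set Set.Ioc_subset_Icc_self
  · exact (ae_restrict_iff' measurableSet_Ioc).2 (Filter.Eventually.of_forall fun t ht =>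
      hpos t (Set.Ioc_subset_Icc_self ht))
  · exact (continuous_id.integrableOn_Icc (a := 0) (b := 1)).mono_set Set.Ioc_subset_Icc_self
  · exact (ae_restrict_iff' measurableSet_Ioc).2 (Filter.Eventually.of_forall fun t ht => ht.1.le)

theorem volume_coneMap_image (w : ℂ) (S : Set (ℝ × ℝ)) :
    volume (coneMap w '' S) = volume
      ((fun x : ℝ × ℝ => (x.1 * (w.re + Real.cos x.2), x.1 * (w.im + Real.sin x.2))) '' S) := by
  rw [← Complex.volume_preserving_equiv_real_prod.measure_preimage_equiv]
  congr 1
  have : coneMap w = Complex.measurableEquivRealProd.symm ∘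
      fun x : ℝ × ℝ => (x.1 * (w.re + Real.cos x.2), x.1 * (w.im + Real.sin x.2)) := by
    funext x
    apply Complex.measurableEquivRealProd.injective
    simp [coneMap, Complex.measurableEquivRealProd_apply, mul_add]
  rw [this, Set.image_comp]
  exact Complex.measurableEquivRealProd.toEquiv.image_symm_eq_preimage _

theorem volume_openCone {w : ℂ} {a b : ℝ} (hab : a ≤ b)
    (hpos : ∀ t ∈ Set.Icc a b, 0 ≤ 1 + proj t w)
    (hinj : Set.InjOn (coneMap w) (Set.Ioo 0 1 ×ˢ Set.Ioo a b)) :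
    volume (coneMap w '' (Set.Ioo 0 1 ×ˢ Set.Ioo a b)) = ENNReal.ofReal (coneArea w a b) := by
  rw [volume_coneMap_image, ← lintegral_cone hab hpos measurableSet_Ioo measurableSet_Ioo
    Set.Ioo_subset_Icc_self Set.Ioo_subset_Icc_self restrict_Ioo_eq_restrict_Ioc
    restrict_Ioo_eq_restrict_Ioc]
  symm
  refine lintegral_abs_det_fderiv_eq_addHaar_image volume (measurableSet_Ioo.prod measurableSet_Ioo)
    (fun p _ => (hasFDerivAt_realCone w.re w.im p).hasFDerivWithinAt) ?_
  intro x hx y hy hxy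
  refine hinj hx hy ?_
  have h1 := congrArg Prod.fst hxy
  have h2 := congrArg Prod.snd hxy
  simp only at h1 h2
  apply Complex.ext
  · simpa [coneMap, exp_mul_I_re, mul_add] using h1
  · simpa [coneMap, exp_mul_I_im, mul_add] using h2

theorem volume_cone_le {w : ℂ} {a b : ℝ} (hab : a ≤ b)
    (hpos : ∀ t ∈ Set.Icc a b, 0 ≤ 1 + proj t w) :
    volume (coneMap w '' (Set.Icc 0 1 ×ˢ Set.Icc a b)) ≤ ENNReal.ofReal (coneArea w a b) := by
  rw [volume_coneMap_image, ← lintegral_cone hab hpos measurableSet_Icc measurableSet_Icc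
    subset_rfl subset_rfl (restrict_Ioc_eq_restrict_Icc).symm
    (restrict_Ioc_eq_restrict_Icc).symm]
  exact addHaar_image_le_lintegral_abs_det_fderiv volume (measurableSet_Icc.prod measurableSet_Icc)
    (fun p _ => (hasFDerivAt_realCone w.re w.im p).hasFDerivWithinAt)

/-! ### Geometry of Reuleaux polygons -/

/-- The width in the direction x - y is at least the distance of the two points. -/
theorem IsBodyOfWidthOne.norm_sub_le {Ω : Set ℂ} (h : IsBodyOfWidthOne Ω) {x y : ℂ} (hx : x ∈ Ω)
    (hy : y ∈ Ω) : ‖x - y‖ ≤ 1 := by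
  by_cases hxy : ‖x - y‖ = 0
  · rw [hxy]; exact zero_le_one
  set ν : ℂ := (‖x - y‖⁻¹ : ℝ) • (x - y) with hν
  have hn : ‖ν‖ = 1 := by
    rw [hν, norm_smul, norm_inv, norm_norm, inv_mul_cancel₀ hxy]
  have hw := h.width_eq ν hn
  have hc : IsCompact ((fun x : ℂ => inner ℝ ν x) '' Ω) :=
    h.isCompact.image (by fun_prop)
  have h1 := le_csSup hc.bddAbove (Set.mem_image_of_mem _ hx)
  have h2 := csInf_le hc.bddBelow (Set.mem_image_of_mem _ hy)
  have h3 : inner ℝ ν x - inner ℝ ν y = ‖x - y‖ := by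
    rw [← inner_sub_right, hν, real_inner_smul_left, real_inner_self_eq_norm_sq]
    field_simp
  unfold widthIn at hw
  linarith

theorem eq_of_exp_eq {s t : ℝ} (h : Complex.exp (s * Complex.I) = Complex.exp (t * Complex.I))
    (hst : |s - t| < 2 * Real.pi) : s = t := by
  obtain ⟨j, hj⟩ := Complex.exp_eq_exp_iff_exists_int.1 h
  have hj' : s = t + j * (2 * Real.pi) := by
    have := congrArg Complex.im hj
    simpa using this
  have hpi := Real.pi_pos
  rw [abs_lt] at hst
  have b1 : (j : ℝ) * (2 * Real.pi) < 1 * (2 * Real.pi) := by linarith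
  have b2 : (-1 : ℝ) * (2 * Real.pi) < (j : ℝ) * (2 * Real.pi) := by linarith
  have b1' := lt_of_mul_lt_mul_right b1 (by positivity)
  have b2' := lt_of_mul_lt_mul_right b2 (by positivity)
  have c1 : j < 1 := by exact_mod_cast b1'
  have c2 : -1 < j := by exact_mod_cast b2'
  have j0 : j = 0 := by omega
  rw [j0] at hj'; simpa using hj'

/-- The extreme points of the small disk lie in the direction pointing away from v. As the disk is
open, the bound is obtained for radii s < r and passed to the limit. -/
theorem norm_add_le_of_ball_subset {c v : ℂ} {r : ℝ} (hr : 0 < r)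
    (h : Metric.ball c r ⊆ Metric.closedBall v 1) : ‖v - c‖ + r ≤ 1 := by
  obtain ⟨u, hu, huv⟩ : ∃ u : ℂ, ‖u‖ = 1 ∧ ∀ s : ℝ, 0 ≤ s → ‖c - v + s • u‖ = ‖v - c‖ + s := by
    by_cases hcv : c - v = 0
    · refine ⟨1, norm_one, fun s hs => ?_⟩
      have : v - c = 0 := by linear_combination -hcv
      rw [hcv, this]; simp [abs_of_nonneg hs]
    · refine ⟨(‖c - v‖⁻¹ : ℝ) • (c - v), ?_, fun s hs => ?_⟩
      · rw [norm_smul, norm_inv, norm_norm, inv_mul_cancel₀ (norm_ne_zero_iff.2 hcv)]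
      · have hn := norm_ne_zero_iff.2 hcv
        have : c - v + s • ((‖c - v‖⁻¹ : ℝ) • (c - v)) = (1 + s * ‖c - v‖⁻¹ : ℝ) • (c - v) := by
          rw [add_smul, one_smul, smul_smul]
        rw [this, norm_smul, Real.norm_of_nonneg (by positivity), norm_sub_rev v c]
        field_simp
  have key : ∀ s, 0 ≤ s → s < r → s ≤ 1 - ‖v - c‖ := by
    intro s h0 hs
    have hm : c + s • u ∈ Metric.ball c r := by
      rw [mem_ball_iff_norm, add_sub_cancel_left, norm_smul, hu, mul_one, Real.norm_of_nonneg h0]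
      exact hs
    have := h hm
    rw [mem_closedBall_iff_norm, show c + s • u - v = c - v + s • u by ring, huv s h0] at this
    linarith
  have : r ≤ 1 - ‖v - c‖ := by
    refine le_of_forall_lt_imp_le_of_dense fun s hs => ?_
    rcases le_total 0 s with h0 | h0
    · exact key s h0 hs
    · exact h0.trans (key 0 le_rfl hr)
  linarith

/-- A ray from a point of a compact set has a last point in it, which is a frontier point. -/
theorem exists_last_mem_ray {K : Set ℂ} (hK : IsCompact K) {c x : ℂ} (hc : c ∈ K) (hx : x ≠ 0) :
    ∃ l : ℝ, 0 ≤ l ∧ c + l • x ∈ frontier K ∧ ∀ l', 0 ≤ l' → c + l' • x ∈ K → l' ≤ l := by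
  have hcont : Continuous fun l : ℝ => c + l • x := by fun_prop
  have hcl : IsClosed {l : ℝ | 0 ≤ l ∧ c + l • x ∈ K} :=
    (isClosed_le continuous_const continuous_id).inter (hK.isClosed.preimage hcont)
  obtain ⟨M, hM⟩ := hK.isBounded.exists_norm_le
  have hx' := norm_pos_iff.2 hx
  have hb : BddAbove {l : ℝ | 0 ≤ l ∧ c + l • x ∈ K} := by
    refine ⟨(M + ‖c‖) / ‖x‖, ?_⟩
    rintro l ⟨h0, hl⟩
    rw [le_div_iff₀ hx']
    have h1 := hM _ hl
    have h2 : ‖l • x‖ ≤ ‖c + l • x‖ + ‖c‖ := by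
      have := norm_sub_le (c + l • x) c
      rwa [add_sub_cancel_left] at this
    rw [norm_smul, Real.norm_of_nonneg h0] at h2
    linarith
  have hne : {l : ℝ | 0 ≤ l ∧ c + l • x ∈ K}.Nonempty := ⟨0, le_rfl, by simpa using hc⟩
  have hmem := hcl.csSup_mem hne hb
  set l := sSup {l : ℝ | 0 ≤ l ∧ c + l • x ∈ K} with hl
  refine ⟨l, hmem.1, ?_, fun l' h0 h' => le_csSup hb ⟨h0, h'⟩⟩
  rw [hK.isClosed.frontier_eq]
  refine ⟨hmem.2, fun hint => ?_⟩
  have hev : ∀ᶠ l' in nhds l, c + l' • x ∈ interior K :=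
    hcont.continuousAt.eventually_mem (isOpen_interior.mem_nhds hint)
  have hev2 := hev.filter_mono (nhdsWithin_le_nhds (s := Set.Ioi l))
  obtain ⟨l', h1, h2⟩ := (hev2.and self_mem_nhdsWithin).exists
  have h3 : l < l' := h2
  have := le_csSup hb (a := l') ⟨hmem.1.trans h3.le, interior_subset h1⟩
  linarith

theorem sum_zmod_eq_sum_range {M : Type*} [AddCommMonoid M] (n : ℕ) (f : ZMod (2 * n + 1) → M) :
    ∑ k, f k = ∑ j ∈ Finset.range (2 * n + 1), f (j : ZMod (2 * n + 1)) := by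
  refine Finset.sum_bij' (fun k _ => k.val) (fun j _ => (j : ZMod (2 * n + 1))) ?_ ?_ ?_ ?_ ?_
  · intro k _; exact Finset.mem_range.2 (ZMod.val_lt k)
  · intro j _; exact Finset.mem_univ _
  · intro k _; exact ZMod.natCast_zmod_val k
  · intro j hj; exact ZMod.val_cast_of_lt (Finset.mem_range.1 hj)
  · intro k _; rw [ZMod.natCast_zmod_val]

namespace ReuleauxPolygon

variable {n : ℕ} (P : ReuleauxPolygon n)

theorem one_le {n : ℕ} (P : ReuleauxPolygon n) : 1 ≤ n := by
  by_contra hn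
  have hn : n = 0 := by omega
  subst hn
  have h := P.vertex_succ 0
  have h1 : (0 + 1 : ZMod (2 * 0 + 1)) = 0 := Subsingleton.elim (α := ZMod 1) _ _
  rw [h1] at h
  exact Complex.exp_ne_zero _ (left_eq_add.1 h)

theorem sub_one_ne_add_one {n : ℕ} (P : ReuleauxPolygon n) (k : ZMod (2 * n + 1)) : k - 1 ≠ k + 1 := by
  intro h
  have hn := P.one_le
  have h2 : ((2 : ℕ) : ZMod (2 * n + 1)) = 0 := by push_cast; linear_combination -h
  rw [ZMod.natCast_eq_zero_iff] at h2
  have := Nat.le_of_dvd (by norm_num) h2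
  omega

theorem arc_mem {k : ZMod (2 * n + 1)} {t : ℝ} (ht : t ∈ Set.Icc (P.α k) (P.β k)) :
    P.vertex k + Complex.exp (t * Complex.I) ∈ P.body := by
  have h : P.vertex k + Complex.exp (t * Complex.I) ∈ frontier P.body := by
    rw [P.frontier_eq]
    exact Set.mem_iUnion.2 ⟨k, t, ht, rfl⟩
  rw [P.isBody.isCompact.isClosed.frontier_eq] at h
  exact h.1

theorem vertex_eq_add_beta (k : ZMod (2 * n + 1)) :
    P.vertex k = P.vertex (k + 1) + Complex.exp (P.β (k + 1) * Complex.I) := by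
  have := P.vertex_pred (k + 1)
  rwa [add_sub_cancel_right] at this

theorem vertex_eq_add_alpha (k : ZMod (2 * n + 1)) :
    P.vertex k = P.vertex (k - 1) + Complex.exp (P.α (k - 1) * Complex.I) := by
  have := P.vertex_succ (k - 1)
  rwa [sub_add_cancel] at this

theorem vertex_mem (k : ZMod (2 * n + 1)) : P.vertex k ∈ P.body := by
  rw [P.vertex_eq_add_beta]
  exact P.arc_mem ⟨(P.α_lt_β _).le, le_rfl⟩

theorem norm_sub_vertex_le {x : ℂ} (hx : x ∈ P.body) (k : ZMod (2 * n + 1)) :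
    ‖x - P.vertex k‖ ≤ 1 :=
  P.isBody.norm_sub_le hx (P.vertex_mem k)

theorem proj_le {x : ℂ} (hx : x ∈ P.body) (k : ZMod (2 * n + 1)) (t : ℝ) :
    proj t x ≤ proj t (P.vertex k) + 1 := by
  have h1 := proj_le_norm t (x - P.vertex k)
  have h2 := P.norm_sub_vertex_le hx k
  rw [proj_sub] at h1
  linarith

theorem beta_sub_alpha_lt (k : ZMod (2 * n + 1)) : P.β k - P.α k < Real.pi := by
  by_contra h
  push Not at h
  have h1 := P.arc_mem (k := k) (t := P.α k) ⟨le_rfl, (P.α_lt_β k).le⟩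
  have h2 := P.arc_mem (k := k) (t := P.α k + Real.pi) ⟨by linarith [Real.pi_pos], by linarith⟩
  have h3 := P.isBody.norm_sub_le h1 h2
  have e : P.vertex k + Complex.exp (P.α k * Complex.I) - (P.vertex k
      + Complex.exp ((P.α k + Real.pi : ℝ) * Complex.I)) = 2 * Complex.exp (P.α k * Complex.I) := by
    push_cast
    rw [add_mul, Complex.exp_add, Complex.exp_pi_mul_I]; ring
  rw [e, norm_mul, Complex.norm_exp_ofReal_mul_I] at h3
  norm_num at h3

/-- At a point inside an arc the outer normal is unique. -/
theorem exp_eq_of_normal {k : ZMod (2 * n + 1)} {t s : ℝ} (ht : t ∈ Set.Ioo (P.α k) (P.β k))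
    (h : ∀ x ∈ P.body, proj s x ≤ proj s (P.vertex k + Complex.exp (t * Complex.I))) :
    Complex.exp (s * Complex.I) = Complex.exp (t * Complex.I) := by
  have hle : ∀ u ∈ Set.Icc (P.α k) (P.β k), Real.cos (u - s) ≤ Real.cos (t - s) := by
    intro u hu
    have := h _ (P.arc_mem hu)
    rw [proj_add, proj_add, proj_exp, proj_exp] at this
    linarith
  have hmax : IsLocalMax (fun u => Real.cos (u - s)) t := by
    filter_upwards [Icc_mem_nhds ht.1 ht.2] with u hu using hle u hu
  have hd : HasDerivAt (fun u => Real.cos (u - s)) (-Real.sin (t - s) * 1) t :=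
    ((hasDerivAt_id t).sub_const s).cos
  have h0 := hmax.hasDerivAt_eq_zero hd
  have hsin : Real.sin (t - s) = 0 := by linarith
  have hcos : Real.cos (t - s) = 1 := by
    rcases Real.sin_eq_zero_iff_cos_eq.1 hsin with h1 | h1
    · exact h1
    -- The derivative also vanishes when s is opposite to t, but then the arc point would be a
    -- minimum, and the end of the arc would project farther.
    · exfalso
      have h2 := hle (P.α k) ⟨le_rfl, (P.α_lt_β k).le⟩
      have h4 : Real.cos (P.α k - s) = -Real.cos (P.α k - t) := by
        have : P.α k - s = (P.α k - t) + (t - s) := by ring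
        rw [this, Real.cos_add, hsin, h1]; ring
      have h5 : Real.cos (P.α k - t) < 1 := by
        rw [← Real.cos_neg, ← Real.cos_zero]
        exact Real.cos_lt_cos_of_nonneg_of_le_pi le_rfl
          (by linarith [P.beta_sub_alpha_lt k, ht.2]) (by linarith [ht.1])
      linarith
  have e1 : Real.cos s = Real.cos t := by
    have : s = t - (t - s) := by ring
    rw [this, Real.cos_sub t, hcos, hsin]; ring
  have e2 : Real.sin s = Real.sin t := by
    have : s = t - (t - s) := by ring
    rw [this, Real.sin_sub t, hcos, hsin]; ring
  apply Complex.ext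
  · rw [exp_mul_I_re, exp_mul_I_re, e1]
  · rw [exp_mul_I_im, exp_mul_I_im, e2]

theorem normal_arc {k : ZMod (2 * n + 1)} {t : ℝ} {x : ℂ} (hx : x ∈ P.body) :
    proj t x ≤ proj t (P.vertex k + Complex.exp (t * Complex.I)) := by
  rw [proj_add, proj_exp_self]; exact P.proj_le hx k t

theorem exp_alpha_ne_exp_beta (k : ZMod (2 * n + 1)) :
    P.vertex (k - 1) ≠ P.vertex (k + 1) := fun h =>
  P.sub_one_ne_add_one k (P.vertex_injective h)

/-- If two arcs share a normal direction, each of their points in that direction is extremal. The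
one on the second arc then lies in the unit disk about the first center at maximal projection, so
the points and hence the centers coincide. -/
theorem eq_of_exp_eq_exp {k j : ZMod (2 * n + 1)} {t s : ℝ} (ht : t ∈ Set.Icc (P.α k) (P.β k))
    (hs : s ∈ Set.Icc (P.α j) (P.β j))
    (h : Complex.exp (t * Complex.I) = Complex.exp (s * Complex.I)) : k = j := by
  have h1 := P.arc_mem ht
  have h2 := P.arc_mem hs
  rw [← h] at h2
  have a1 := P.norm_sub_vertex_le h2 k
  have a2 := P.proj_le h1 j t
  rw [proj_add, proj_exp_self] at a2
  have e := eq_exp_of_proj_ge (t := t) a1 (by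
    rw [proj_sub, proj_add, proj_exp_self]; linarith)
  exact P.vertex_injective (by linear_combination -e)

/-- Opposite normals would force the vertex of the second arc to be the point of the first arc, in
its relative interior. But a vertex carries the normals of its two adjacent sides, and a unique
normal would give P_{j-1} = P_{j+1}. -/
theorem exp_ne_neg_exp {k j : ZMod (2 * n + 1)} {t s : ℝ} (ht : t ∈ Set.Ioo (P.α k) (P.β k))
    (hs : s ∈ Set.Icc (P.α j) (P.β j)) :
    Complex.exp (t * Complex.I) ≠ -Complex.exp (s * Complex.I) := by
  intro h
  have h1 := P.arc_mem (Set.Ioo_subset_Icc_self ht)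
  have h2 := P.arc_mem hs
  have h3 := P.isBody.norm_sub_le h1 h2
  have h4 := proj_le_norm t (P.vertex k + Complex.exp (t * Complex.I)
    - (P.vertex j + Complex.exp (s * Complex.I)))
  have e : Complex.exp (s * Complex.I) = -Complex.exp (t * Complex.I) := by rw [h]; ring
  have e' : P.vertex k + Complex.exp (t * Complex.I) - (P.vertex j + Complex.exp (s * Complex.I))
      = P.vertex k - P.vertex j + Complex.exp (t * Complex.I) + Complex.exp (t * Complex.I) := by
    rw [e]; ring
  rw [e', proj_add, proj_add, proj_sub, proj_exp_self] at h4
  rw [e'] at h3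
  have e2 := eq_exp_of_proj_ge (t := t) (P.norm_sub_vertex_le (P.vertex_mem j) k) (by
    rw [proj_sub]; linarith)
  have hv : P.vertex j = P.vertex k + Complex.exp (t * Complex.I) := by linear_combination e2
  have n1 := P.exp_eq_of_normal (s := P.β (j + 1)) ht (fun x hx => by
    rw [← hv, P.vertex_eq_add_beta j]; exact P.normal_arc hx)
  have n2 := P.exp_eq_of_normal (s := P.α (j - 1)) ht (fun x hx => by
    rw [← hv, P.vertex_eq_add_alpha j]; exact P.normal_arc hx)
  have m1 := P.vertex_eq_add_beta j
  have m2 := P.vertex_eq_add_alpha j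
  rw [n1] at m1
  rw [n2] at m2
  exact P.exp_alpha_ne_exp_beta j (by linear_combination m1 - m2)

theorem injOn_sector (a b : ℝ) (hab : b - a < Real.pi) :
    Set.InjOn (coneMap 0) (Set.Ioo 0 1 ×ˢ Set.Ioo a b) := by
  rintro ⟨s, t⟩ ⟨hs, ht⟩ ⟨s', t'⟩ ⟨hs', ht'⟩ h
  simp only [Set.mem_Ioo] at hs ht hs' ht'
  simp only [coneMap, zero_add] at h
  have h1 := congrArg norm h
  rw [norm_smul, norm_smul, Complex.norm_exp_ofReal_mul_I, Complex.norm_exp_ofReal_mul_I,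
    Real.norm_of_nonneg hs.1.le, Real.norm_of_nonneg hs'.1.le, mul_one, mul_one] at h1
  subst h1
  have h2 := smul_right_injective ℂ hs.1.ne' h
  have := eq_of_exp_eq h2 (by rw [abs_lt]; constructor <;> linarith [Real.pi_pos])
  rw [this]

theorem measurableSet_openCone {w : ℂ} {a b : ℝ}
    (h : Set.InjOn (coneMap w) (Set.Ioo 0 1 ×ˢ Set.Ioo a b)) :
    MeasurableSet (coneMap w '' (Set.Ioo 0 1 ×ˢ Set.Ioo a b)) := by
  refine (measurableSet_Ioo.prod measurableSet_Ioo).image_of_continuousOn_injOn ?_ h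
  apply Continuous.continuousOn
  unfold coneMap; fun_prop

/-- The open sectors spanned by the normals of the sides, together with the opposite sectors, are
pairwise disjoint in the unit disk. Each has area (β - α)/2 and the disk has area π. -/
theorem sum_beta_sub_alpha_le : ∑ k, (P.β k - P.α k) ≤ Real.pi := by
  let off : Bool → ℝ := fun b => if b then Real.pi else 0
  let S : ZMod (2 * n + 1) × Bool → Set ℂ := fun i =>
    coneMap 0 '' (Set.Ioo 0 1 ×ˢ Set.Ioo (P.α i.1 + off i.2) (P.β i.1 + off i.2))
  have hinj : ∀ i : ZMod (2 * n + 1) × Bool, Set.InjOn (coneMap 0)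
      (Set.Ioo 0 1 ×ˢ Set.Ioo (P.α i.1 + off i.2) (P.β i.1 + off i.2)) := fun i =>
    injOn_sector _ _ (by linarith [P.beta_sub_alpha_lt i.1])
  have hvol : ∀ i, volume (S i) = ENNReal.ofReal ((P.β i.1 - P.α i.1) / 2) := by
    intro i
    rw [volume_openCone (by linarith [P.α_lt_β i.1]) (by simp [proj]) (hinj i)]
    congr 1
    simp [coneArea]
  have hdisj : Pairwise (Function.onFun Disjoint S) := by
    rintro ⟨k, b⟩ ⟨j, b'⟩ hne
    rw [Function.onFun, Set.disjoint_left]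
    rintro x ⟨⟨s, t⟩, ⟨hs, ht⟩, rfl⟩ ⟨⟨s', t'⟩, ⟨hs', ht'⟩, h⟩
    apply hne
    simp only [Set.mem_Ioo] at hs ht hs' ht'
    simp only [coneMap, zero_add] at h
    have h1 := congrArg norm h
    rw [norm_smul, norm_smul, Complex.norm_exp_ofReal_mul_I, Complex.norm_exp_ofReal_mul_I,
      Real.norm_of_nonneg hs.1.le, Real.norm_of_nonneg hs'.1.le, mul_one, mul_one] at h1
    subst h1
    have h2 := smul_right_injective ℂ hs.1.ne' h
    have hoff : ∀ (b : Bool) (t : ℝ), Complex.exp (t * Complex.I) = (if b then -1 else 1) *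
        Complex.exp ((t - off b : ℝ) * Complex.I) := by
      intro b t
      cases b
      · simp [off]
      · simp only [off, if_true]
        push_cast
        rw [sub_mul, Complex.exp_sub, Complex.exp_pi_mul_I]; ring
    rw [hoff b t, hoff b' t'] at h2
    have m1 : t - off b ∈ Set.Ioo (P.α k) (P.β k) := ⟨by linarith, by linarith⟩
    have m2 : t' - off b' ∈ Set.Ioo (P.α j) (P.β j) := ⟨by linarith, by linarith⟩
    cases b <;> cases b'
    · simp only [Bool.false_eq_true, if_false, one_mul] at h2
      rw [P.eq_of_exp_eq_exp (Set.Ioo_subset_Icc_self m1) (Set.Ioo_subset_Icc_self m2) h2.symm]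
    · simp only [Bool.false_eq_true, if_false, if_true, one_mul, neg_one_mul] at h2
      exact absurd h2.symm (P.exp_ne_neg_exp m1 (Set.Ioo_subset_Icc_self m2))
    · simp only [Bool.false_eq_true, if_false, if_true, one_mul, neg_one_mul] at h2
      exact absurd h2 (P.exp_ne_neg_exp m2 (Set.Ioo_subset_Icc_self m1))
    · simp only [if_true, neg_one_mul, neg_inj] at h2
      rw [P.eq_of_exp_eq_exp (Set.Ioo_subset_Icc_self m1) (Set.Ioo_subset_Icc_self m2) h2.symm]
  have hsub : (⋃ i, S i) ⊆ Metric.ball 0 1 := by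
    refine Set.iUnion_subset fun i => ?_
    rintro x ⟨⟨s, t⟩, ⟨hs, -⟩, rfl⟩
    simp only [Set.mem_Ioo] at hs
    rw [mem_ball_zero_iff, coneMap, zero_add, norm_smul, Complex.norm_exp_ofReal_mul_I,
      Real.norm_of_nonneg hs.1.le, mul_one]
    exact hs.2
  have hle := measure_mono (μ := volume) hsub
  rw [measure_iUnion hdisj (fun i => measurableSet_openCone (hinj i)), tsum_fintype] at hle
  simp only [hvol] at hle
  rw [← ENNReal.ofReal_sum_of_nonneg (fun i _ => by linarith [P.α_lt_β i.1]), Complex.volume_ball] at hle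
  simp only [ENNReal.ofReal_one, one_pow, one_mul] at hle
  rw [Fintype.sum_prod_type] at hle
  simp only [Fintype.sum_bool, add_halves] at hle
  have hpi : ((NNReal.pi : NNReal) : ENNReal) = ENNReal.ofReal Real.pi := by
    rw [← NNReal.coe_real_pi, ENNReal.ofReal_coe_nnreal]
  rw [hpi, ENNReal.ofReal_le_ofReal_iff Real.pi_pos.le] at hle
  exact hle

end ReuleauxPolygon

/-- The edges of a chain with prescribed angles at the vertices. -/
theorem edge_eq_of_turn {Q : ℕ → ℂ} {p : ℕ → ℝ} (h : ∀ k, Q k - Q (k + 1)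
    = Complex.exp (p (k + 1) * Complex.I) * (Q (k + 2) - Q (k + 1))) (k : ℕ) :
    edge Q k = (-1) ^ k *
      Complex.exp (-((∑ j ∈ Finset.range k, p (j + 1) : ℝ) * Complex.I)) * edge Q 0 := by
  induction k with
  | zero => simp
  | succ k ih =>
    have h1 := h k
    have h2 : Q k - Q (k + 1) = -edge Q k := by rw [edge]; ring
    have h3 : Q (k + 2) - Q (k + 1) = edge Q (k + 1) := rfl
    rw [h2, h3, ih] at h1
    have h4 : Complex.exp (-(p (k + 1) * Complex.I)) *
        Complex.exp (p (k + 1) * Complex.I) = 1 := by rw [← Complex.exp_add]; simp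
    rw [Finset.sum_range_succ]
    push_cast at h1 ⊢
    rw [add_mul, neg_add, Complex.exp_add, pow_succ]
    linear_combination (-edge Q (k + 1)) * h4
      - Complex.exp (-(p (k + 1) * Complex.I)) * h1

/-! ### The star chain and the area of a Reuleaux polygon -/

namespace ReuleauxPolygon

variable {n : ℕ} (P : ReuleauxPolygon n)

/-- The vertices relative to the point `c`, indexed by the natural numbers. -/
def chain (c : ℂ) (k : ℕ) : ℂ := P.vertex (k : ZMod (2 * n + 1)) - c

/-- The angular lengths of the sides, indexed by the natural numbers. -/
def chainAngle (k : ℕ) : ℝ := P.β (k : ZMod (2 * n + 1)) - P.α (k : ZMod (2 * n + 1))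

theorem chainAngle_pos (k : ℕ) : 0 < P.chainAngle k := sub_pos.2 (P.α_lt_β _)

theorem natCast_add_period (n k : ℕ) : ((k + (2 * n + 1) : ℕ) : ZMod (2 * n + 1)) = k := by
  rw [Nat.cast_add, ZMod.natCast_self, add_zero]

theorem edge_chain (c : ℂ) (k : ℕ) :
    edge (P.chain c) k = Complex.exp (P.α (k : ZMod (2 * n + 1)) * Complex.I) := by
  rw [edge, chain, chain, Nat.cast_add, Nat.cast_one, P.vertex_succ]; ring

theorem turn_chain (c : ℂ) (k : ℕ) : P.chain c k - P.chain c (k + 1) =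
    Complex.exp (P.chainAngle (k + 1) * Complex.I) * (P.chain c (k + 2) - P.chain c (k + 1)) := by
  have h1 : P.chain c (k + 2) - P.chain c (k + 1)
      = Complex.exp (P.α ((k + 1 : ℕ) : ZMod (2 * n + 1)) * Complex.I) := P.edge_chain c (k + 1)
  rw [h1, ← Complex.exp_add, ← add_mul, chainAngle, chain, chain]
  have h2 := P.vertex_eq_add_beta (k : ZMod (2 * n + 1))
  have h3 : ((k + 1 : ℕ) : ZMod (2 * n + 1)) = k + 1 := by push_cast; ring
  rw [h3, h2]
  push_cast
  rw [sub_add_cancel]; ring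

/-- After an odd number of turns the first edge returns, so exp(-iS) = -1 for the total S. The area
bound S ≤ π leaves only S = π. -/
theorem sum_chainAngle : ∑ k ∈ Finset.range (2 * n + 1), P.chainAngle k = Real.pi := by
  have hle := P.sum_beta_sub_alpha_le
  rw [sum_zmod_eq_sum_range] at hle
  have hle' : ∑ k ∈ Finset.range (2 * n + 1), P.chainAngle k ≤ Real.pi := hle
  have hper : ∀ k, P.chainAngle (k + (2 * n + 1)) = P.chainAngle k := by
    intro k; simp only [chainAngle, natCast_add_period]
  have h1 := edge_eq_of_turn (P.turn_chain 0) (2 * n + 1)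
  have h2 : edge (P.chain 0) (2 * n + 1) = edge (P.chain 0) 0 := by
    rw [P.edge_chain, P.edge_chain]; simp
  have h3 : edge (P.chain 0) 0 ≠ 0 := by rw [P.edge_chain]; exact Complex.exp_ne_zero _
  rw [h2, sum_range_periodic_succ hper] at h1
  set S := ∑ k ∈ Finset.range (2 * n + 1), P.chainAngle k with hS
  have h4 : (-1 : ℂ) ^ (2 * n + 1) = -1 := Odd.neg_one_pow ⟨n, rfl⟩
  rw [h4] at h1
  have h5 : Complex.exp (-(S * Complex.I)) = -1 := by
    apply mul_right_cancel₀ h3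
    linear_combination h1
  rw [exp_neg_mul_I] at h5
  have h6 : Real.cos S = -1 := by
    have := congrArg Complex.re h5
    rw [Complex.sub_re, Complex.ofReal_re, Complex.re_ofReal_mul, Complex.I_re] at this
    simpa using this
  have hS0 : 0 ≤ S := Finset.sum_nonneg fun k _ => (P.chainAngle_pos k).le
  exact Real.injOn_cos ⟨hS0, hle'⟩ ⟨Real.pi_pos.le, le_rfl⟩ (by rw [h6, Real.cos_pi])

theorem isStarChain {c : ℂ} {R : ℝ} (h : ∀ k, ‖P.vertex k - c‖ ≤ R) :
    IsStarChain n R (P.chain c) P.chainAngle where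
  vertex_periodic k := by simp only [chain, natCast_add_period]
  angle_periodic k := by simp only [chainAngle, natCast_add_period]
  norm_edge k := by
    have := P.edge_chain c k
    rw [edge] at this
    rw [this, Complex.norm_exp_ofReal_mul_I]
  turn k := P.turn_chain c k
  angle_nonneg k := (P.chainAngle_pos k).le
  angle_sum := P.sum_chainAngle
  norm_le k := h _

theorem norm_vertex_sub_le {c : ℂ} {r : ℝ} (hr : 0 < r) (h : Metric.ball c r ⊆ P.body)
    (k : ZMod (2 * n + 1)) : ‖P.vertex k - c‖ ≤ 1 - r := by
  have := norm_add_le_of_ball_subset hr (v := P.vertex k) (fun x hx => by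
    rw [mem_closedBall_iff_norm]; exact P.norm_sub_vertex_le (h hx) k)
  linarith

/-- This is the angular factor of the Jacobian of the cone over Γ_k. It is positive because the
body, which lies in the unit disk about P_k, contains points beyond c in every direction. -/
theorem proj_pos {c : ℂ} {r : ℝ} (hr : 0 < r) (h : Metric.ball c r ⊆ P.body)
    (k : ZMod (2 * n + 1)) (t : ℝ) : 0 < 1 + proj t (P.vertex k - c) := by
  have hm : c + (r / 2) • Complex.exp (t * Complex.I) ∈ P.body := by
    apply h
    rw [mem_ball_iff_norm, add_sub_cancel_left, norm_smul, Complex.norm_exp_ofReal_mul_I, mul_one,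
      Real.norm_of_nonneg (by linarith)]
    linarith
  have := P.proj_le hm k t
  rw [proj_add, proj_smul, proj_exp_self] at this
  rw [proj_sub]; linarith

/-- A point outside the body is separated from c by a boundary point on some Γ_k. Along the ray the
projection on the normal there increases strictly, so the point is at distance more than 1 from P_k.
-/
theorem body_eq {c : ℂ} {r : ℝ} (hr : 0 < r) (h : Metric.ball c r ⊆ P.body) :
    P.body = ⋂ k, Metric.closedBall (P.vertex k) 1 := by
  apply Set.Subset.antisymm
  · intro x hx
    exact Set.mem_iInter.2 fun k => mem_closedBall_iff_norm.2 (P.norm_sub_vertex_le hx k)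
  · intro x hx
    have hc : c ∈ P.body := h (Metric.mem_ball_self hr)
    by_cases hxc : x = c
    · rwa [hxc]
    have hne : x - c ≠ 0 := sub_ne_zero.2 hxc
    obtain ⟨l, hl0, hl, hmax⟩ := exists_last_mem_ray P.isBody.isCompact hc hne
    rw [P.frontier_eq] at hl
    obtain ⟨k, t, ht, heq⟩ := Set.mem_iUnion.1 hl
    have heq : P.vertex k + Complex.exp (t * Complex.I) = c + l • (x - c) := heq
    rcases lt_or_ge l 1 with hl1 | hl1
    · exfalso
      have hpos := P.proj_pos hr h k t
      have e := congrArg (proj t) heq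
      rw [proj_add, proj_add, proj_exp_self, proj_smul] at e
      rw [proj_sub] at hpos
      have hxp : 0 < proj t (x - c) := by
        have : 0 < l * proj t (x - c) := by linarith
        exact pos_of_mul_pos_right this hl0
      have hb := mem_closedBall_iff_norm.1 (Set.mem_iInter.1 hx k)
      have hb2 := proj_le_norm t (x - P.vertex k)
      rw [proj_sub] at hb2 hxp
      rw [proj_sub] at e
      nlinarith
    · have hy : c + l • (x - c) ∈ P.body := heq ▸ P.arc_mem ht
      have := P.isBody.convex.add_smul_sub_mem hc hy (t := l⁻¹)
        ⟨inv_nonneg.2 hl0, inv_le_one_of_one_le₀ hl1⟩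
      rw [add_sub_cancel_left, smul_smul, inv_mul_cancel₀ (by linarith), one_smul,
        add_sub_cancel] at this
      exact this

/-- Projecting on the normal at either boundary point and using that it supports the body compares s
and s' both ways. Once s = s', the boundary points agree, and uniqueness of the normal inside an arc
identifies the sides. -/
theorem cone_injective {c : ℂ} {r : ℝ} (hr : 0 < r) (h : Metric.ball c r ⊆ P.body)
    {k j : ZMod (2 * n + 1)} {s s' t t' : ℝ} (hs : 0 < s) (hs' : 0 < s')
    (ht : t ∈ Set.Ioo (P.α k) (P.β k)) (ht' : t' ∈ Set.Ioo (P.α j) (P.β j))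
    (heq : coneMap (P.vertex k - c) (s, t) = coneMap (P.vertex j - c) (s', t')) :
    k = j ∧ s = s' ∧ t = t' := by
  have aux : ∀ {k j : ZMod (2 * n + 1)} {s s' t t' : ℝ}, 0 < s' →
      t' ∈ Set.Ioo (P.α j) (P.β j) →
      coneMap (P.vertex k - c) (s, t) = coneMap (P.vertex j - c) (s', t') → s ≤ s' := by
    intro k j s s' t t' hs' ht' heq
    have e := congrArg (proj t) heq
    simp only [coneMap, proj_smul, proj_add, proj_exp_self, proj_sub] at e
    have h1 := P.proj_le (P.arc_mem (Set.Ioo_subset_Icc_self ht')) k t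
    rw [proj_add] at h1
    have h2 := P.proj_pos hr h k t
    rw [proj_sub] at h2
    have h3 : s * (1 + (proj t (P.vertex k) - proj t c)) ≤ s' * (1 + (proj t (P.vertex k) - proj t c)) := by
      have : s' * (proj t (P.vertex j) - proj t c + proj t (Complex.exp (t' * Complex.I)))
          ≤ s' * (1 + (proj t (P.vertex k) - proj t c)) :=
        mul_le_mul_of_nonneg_left (by linarith) hs'.le
      linarith
    exact le_of_mul_le_mul_right h3 h2
  have hss : s = s' := le_antisymm (aux hs' ht' heq) (aux hs ht heq.symm)
  subst hss
  have hy := smul_right_injective ℂ hs.ne' heq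
  simp only at hy
  have hy' : P.vertex k + Complex.exp (t * Complex.I) = P.vertex j + Complex.exp (t' * Complex.I) := by
    linear_combination hy
  have hn := P.exp_eq_of_normal (s := t') ht (fun x hx => by rw [hy']; exact P.normal_arc hx)
  have hkj : k = j := P.vertex_injective (by rw [hn] at hy'; exact add_right_cancel hy')
  subst hkj
  refine ⟨rfl, rfl, (eq_of_exp_eq hn ?_).symm⟩
  have := P.beta_sub_alpha_lt k
  rw [abs_lt]; constructor <;> linarith [ht.1, ht.2, ht'.1, ht'.2, Real.pi_pos]

/-- Each cone area is half the angle of its side minus half the cross products of the two adjacent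
chain edges. Every cross product is counted twice around the cycle. -/
theorem sum_coneArea (c : ℂ) : ∑ k, coneArea (P.vertex k - c) (P.α k) (P.β k)
    = Real.pi / 2 - crossSum n (P.chain c) := by
  rw [sum_zmod_eq_sum_range]
  have hper : ∀ k, coneArea (P.vertex ((k + (2 * n + 1) : ℕ) : ZMod (2 * n + 1)) - c)
      (P.α ((k + (2 * n + 1) : ℕ) : ZMod (2 * n + 1))) (P.β ((k + (2 * n + 1) : ℕ) : ZMod (2 * n + 1)))
      = coneArea (P.vertex (k : ZMod (2 * n + 1)) - c) (P.α (k : ZMod (2 * n + 1)))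
        (P.β (k : ZMod (2 * n + 1))) := by
    intro k; rw [natCast_add_period]
  rw [← sum_range_periodic_succ (f := fun k : ℕ => coneArea (P.vertex (k : ZMod (2 * n + 1)) - c)
    (P.α (k : ZMod (2 * n + 1))) (P.β (k : ZMod (2 * n + 1)))) hper]
  have hterm : ∀ k : ℕ, coneArea (P.vertex ((k + 1 : ℕ) : ZMod (2 * n + 1)) - c)
      (P.α ((k + 1 : ℕ) : ZMod (2 * n + 1))) (P.β ((k + 1 : ℕ) : ZMod (2 * n + 1)))
      = (P.chainAngle (k + 1) - cross (P.chain c k) (P.chain c (k + 1))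
        - cross (P.chain c (k + 1)) (P.chain c (k + 2))) / 2 := by
    intro k
    have h1 : P.chain c (k + 2) = P.chain c (k + 1)
        + Complex.exp (P.α ((k + 1 : ℕ) : ZMod (2 * n + 1)) * Complex.I) := by
      rw [← P.edge_chain c (k + 1), edge]; ring
    have h2 : P.chain c k = P.chain c (k + 1)
        + Complex.exp (P.β ((k + 1 : ℕ) : ZMod (2 * n + 1)) * Complex.I) := by
      have h2 := P.vertex_eq_add_beta (k : ZMod (2 * n + 1))
      have h3 : ((k + 1 : ℕ) : ZMod (2 * n + 1)) = k + 1 := by push_cast; ring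
      rw [chain, chain, h3, h2]; ring
    have h4 : P.vertex ((k + 1 : ℕ) : ZMod (2 * n + 1)) - c = P.chain c (k + 1) := rfl
    rw [h4, h1, h2, coneArea, chainAngle, cross, cross]
    simp only [Complex.add_re, Complex.add_im, exp_mul_I_re, exp_mul_I_im]
    ring
  simp only [hterm]
  rw [← Finset.sum_div, Finset.sum_sub_distrib, Finset.sum_sub_distrib]
  have hp : ∀ k, P.chainAngle (k + (2 * n + 1)) = P.chainAngle k := by
    intro k; simp only [chainAngle, natCast_add_period]
  have hq : ∀ k, P.chain c (k + (2 * n + 1)) = P.chain c k := by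
    intro k; simp only [chain, natCast_add_period]
  rw [sum_range_periodic_succ hp, P.sum_chainAngle]
  have hs := sum_range_periodic_succ (m := 2 * n + 1)
    (f := fun k => cross (P.chain c k) (P.chain c (k + 1))) (by
      intro k
      simp only [hq]
      rw [show k + (2 * n + 1) + 1 = k + 1 + (2 * n + 1) by ring, hq])
  simp only [add_assoc, Nat.reduceAdd] at hs
  rw [hs, crossSum]; ring

theorem coneArea_nonneg {c : ℂ} {r : ℝ} (hr : 0 < r) (h : Metric.ball c r ⊆ P.body)
    (k : ZMod (2 * n + 1)) : 0 ≤ coneArea (P.vertex k - c) (P.α k) (P.β k) := by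
  have hcont : Continuous fun t : ℝ => 1 + proj t (P.vertex k - c) := by unfold proj; fun_prop
  have h1 : 0 ≤ ∫ t in (P.α k)..(P.β k), (1 + proj t (P.vertex k - c)) :=
    intervalIntegral.integral_nonneg (P.α_lt_β k).le fun t _ => (P.proj_pos hr h k t).le
  have h2 : ∫ t in (P.α k)..(P.β k), (1 + proj t (P.vertex k - c))
      = 2 * coneArea (P.vertex k - c) (P.α k) (P.β k) := by
    unfold proj
    rw [intervalIntegral.integral_add (by simp) (Continuous.intervalIntegrable (by fun_prop) _ _),
      intervalIntegral.integral_add (Continuous.intervalIntegrable (by fun_prop) _ _)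
        (Continuous.intervalIntegrable (by fun_prop) _ _)]
    simp [coneArea]
    ring
  linarith

/-- The area of a Reuleaux polygon in terms of its star polygon. -/
theorem volume_body {c : ℂ} {r : ℝ} (hr : 0 < r) (h : Metric.ball c r ⊆ P.body) :
    volume P.body = ENNReal.ofReal (Real.pi / 2 - crossSum n (P.chain c)) := by
  have hc : c ∈ P.body := h (Metric.mem_ball_self hr)
  have hT : volume P.body = volume ((fun x => c + x) ⁻¹' P.body) :=
    (measure_preimage_add volume c P.body).symm
  have hnn := fun k => P.coneArea_nonneg hr h k
  rw [hT, ← P.sum_coneArea c, ENNReal.ofReal_sum_of_nonneg (fun k _ => hnn k)]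
  apply le_antisymm
  -- Upper bound: the ray through any point of the body leaves it on some side, so closed cones
  -- cover the body.
  · have hsub : (fun x => c + x) ⁻¹' P.body ⊆
        ⋃ k, coneMap (P.vertex k - c) '' (Set.Icc 0 1 ×ˢ Set.Icc (P.α k) (P.β k)) := by
      intro x hx
      have hx : c + x ∈ P.body := hx
      by_cases hx0 : x = 0
      · refine Set.mem_iUnion.2 ⟨0, (0, P.α 0), ⟨by simp, ⟨le_rfl, (P.α_lt_β 0).le⟩⟩, ?_⟩
        simp [coneMap, hx0]
      · obtain ⟨l, hl0, hl, hmax⟩ := exists_last_mem_ray P.isBody.isCompact hc hx0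
        have hl1 : 1 ≤ l := hmax 1 zero_le_one (by rw [one_smul]; exact hx)
        rw [P.frontier_eq] at hl
        obtain ⟨k, t, ht, heq⟩ := Set.mem_iUnion.1 hl
        have heq : P.vertex k + Complex.exp (t * Complex.I) = c + l • x := heq
        refine Set.mem_iUnion.2 ⟨k, (l⁻¹, t), ⟨⟨inv_nonneg.2 hl0, inv_le_one_of_one_le₀ hl1⟩, ht⟩, ?_⟩
        simp only [coneMap]
        rw [show P.vertex k - c + Complex.exp (t * Complex.I) = l • x by linear_combination heq,
          smul_smul, inv_mul_cancel₀ (by linarith), one_smul]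
    refine (measure_mono hsub).trans ((measure_iUnion_le _).trans ?_)
    rw [tsum_fintype]
    exact Finset.sum_le_sum fun k _ => volume_cone_le (P.α_lt_β k).le
      fun t _ => (P.proj_pos hr h k t).le
  -- Lower bound: the open cones lie in the body by convexity, and they are pairwise disjoint.
  · have hinj : ∀ k, Set.InjOn (coneMap (P.vertex k - c))
        (Set.Ioo 0 1 ×ˢ Set.Ioo (P.α k) (P.β k)) := by
      rintro k ⟨s, t⟩ ⟨hs, ht⟩ ⟨s', t'⟩ ⟨hs', ht'⟩ heq
      obtain ⟨-, h1, h2⟩ := P.cone_injective hr h hs.1 hs'.1 ht ht' heq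
      simp only at h1 h2
      rw [h1, h2]
    have hsub : (⋃ k, coneMap (P.vertex k - c) '' (Set.Ioo 0 1 ×ˢ Set.Ioo (P.α k) (P.β k)))
        ⊆ (fun x => c + x) ⁻¹' P.body := by
      refine Set.iUnion_subset fun k => ?_
      rintro x ⟨⟨s, t⟩, ⟨hs, ht⟩, rfl⟩
      have := P.isBody.convex.add_smul_sub_mem hc
        (P.arc_mem (Set.Ioo_subset_Icc_self ht)) (t := s) ⟨hs.1.le, hs.2.le⟩
      show c + coneMap (P.vertex k - c) (s, t) ∈ P.body
      rw [coneMap, show P.vertex k - c + Complex.exp (t * Complex.I)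
        = P.vertex k + Complex.exp (t * Complex.I) - c by ring]
      exact this
    refine le_trans ?_ (measure_mono hsub)
    rw [measure_iUnion _ (fun k => measurableSet_openCone (hinj k)), tsum_fintype]
    · refine le_of_eq (Finset.sum_congr rfl fun k _ => ?_)
      exact (volume_openCone (P.α_lt_β k).le (fun t _ => (P.proj_pos hr h k t).le) (hinj k)).symm
    · intro k j hkj
      rw [Function.onFun, Set.disjoint_left]
      rintro x ⟨⟨s, t⟩, ⟨hs, ht⟩, rfl⟩ ⟨⟨s', t'⟩, ⟨hs', ht'⟩, heq⟩
      exact hkj (P.cone_injective hr h hs.1 hs'.1 ht ht' heq.symm).1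

end ReuleauxPolygon

/-! ### The Reuleaux polygon of a star chain -/

/-- The function W dominates the increments of f, as its positive variation does. Grouping the terms
in pairs after the first bounds the alternating sum by the growth of W. -/
theorem sum_alternating_le {f W : ℝ → ℝ} (hW : Monotone W)
    (hfW : ∀ a b, a ≤ b → f b - f a ≤ W b - W a) (φ : ℕ → ℝ) (M : ℕ)
    (hφ : ∀ l < 2 * M, φ l ≤ φ (l + 1)) :
    ∑ l ∈ Finset.range (2 * M + 1), (-1) ^ l * f (φ l) ≤ f (φ 0) + W (φ (2 * M)) - W (φ 0) := by
  induction M with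
  | zero => simp
  | succ M ih =>
    have ih := ih fun l hl => hφ l (by omega)
    rw [show 2 * (M + 1) + 1 = 2 * M + 1 + 1 + 1 by ring, Finset.sum_range_succ,
      Finset.sum_range_succ]
    have h1 := hφ (2 * M) (by omega)
    have h2 := hφ (2 * M + 1) (by omega)
    have h3 := hW h1
    have h4 := hfW _ _ h2
    have e1 : (-1 : ℝ) ^ (2 * M + 1) = -1 := Odd.neg_one_pow ⟨M, rfl⟩
    have e2 : (-1 : ℝ) ^ (2 * M + 1 + 1) = 1 := Even.neg_one_pow ⟨M + 1, by ring⟩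
    rw [e1, e2, show 2 * (M + 1) = 2 * M + 1 + 1 by ring]
    linarith

/-- An alternating sum of an odd number of unit vectors turning by at most `π` is in the unit
disk. -/
theorem norm_sum_alternating_exp_le (φ : ℕ → ℝ) (M : ℕ) (hφ : ∀ l < 2 * M, φ l ≤ φ (l + 1))
    (hM : φ (2 * M) ≤ φ 0 + Real.pi) :
    ‖∑ l ∈ Finset.range (2 * M + 1), (-1) ^ l * Complex.exp (-(φ l * Complex.I))‖ ≤ 1 := by
  set w := ∑ l ∈ Finset.range (2 * M + 1), (-1) ^ l * Complex.exp (-(φ l * Complex.I)) with hw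
  -- The norm is the real part after rotation, which turns the claim into a bound on an alternating
  -- sum of cosines.
  set ψ : ℝ := -Complex.arg w with hψ
  have h1 : (w * Complex.exp (ψ * Complex.I)).re = ‖w‖ := by
    conv_lhs => rw [← Complex.norm_mul_exp_arg_mul_I w]
    rw [mul_assoc, ← Complex.exp_add, hψ]
    simp
  have h2 : (w * Complex.exp (ψ * Complex.I)).re
      = ∑ l ∈ Finset.range (2 * M + 1), (-1) ^ l * Real.cos (φ l - ψ) := by
    rw [hw, Finset.sum_mul, Complex.re_sum]
    refine Finset.sum_congr rfl fun l _ => ?_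
    rw [mul_assoc, ← Complex.exp_add, show -((φ l : ℂ) * Complex.I) + ψ * Complex.I
      = ((-(φ l - ψ) : ℝ) : ℂ) * Complex.I by push_cast; ring,
      show ((-1 : ℂ) ^ l) = (((-1 : ℝ) ^ l : ℝ) : ℂ) by push_cast; rfl, Complex.re_ofReal_mul,
      exp_mul_I_re, Real.cos_neg]
  rw [← h1, h2]
  -- The positive part of the derivative of cos(y - ψ). Over a half-period its integral is (2 - 2
  -- cos(φ 0 - ψ))/2, exactly what completes cos(φ 0 - ψ) to 1.
  set g : ℝ → ℝ := fun y => (|Real.sin (y - ψ)| - Real.sin (y - ψ)) / 2 with hg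
  have hgc : Continuous g := by unfold g; fun_prop
  have hgi : ∀ a b, IntervalIntegrable g volume a b := fun a b => hgc.intervalIntegrable a b
  have hg0 : ∀ y, 0 ≤ g y := fun y => by
    have := le_abs_self (Real.sin (y - ψ)); simp only [hg]; linarith
  have hcos : ∀ a b, ∫ y in a..b, -Real.sin (y - ψ) = Real.cos (b - ψ) - Real.cos (a - ψ) := by
    intro a b
    rw [intervalIntegral.integral_neg, intervalIntegral.integral_comp_sub_right, integral_sin]; ring
  have hsub : ∀ a b, (∫ y in φ 0..b, g y) - ∫ y in φ 0..a, g y = ∫ y in a..b, g y := fun a b =>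
    intervalIntegral.integral_interval_sub_left (hgi _ _) (hgi _ _)
  have hmono : Monotone fun x => ∫ y in φ 0..x, g y := by
    intro a b hab
    have := hsub a b
    have h0 : 0 ≤ ∫ y in a..b, g y := intervalIntegral.integral_nonneg hab fun y _ => hg0 y
    simp only; linarith
  have hle := sum_alternating_le (f := fun x => Real.cos (x - ψ)) hmono (by
    intro a b hab
    rw [hsub a b, ← hcos a b]
    refine intervalIntegral.integral_mono_on hab (Continuous.intervalIntegrable (by fun_prop) _ _)
      (hgi _ _) fun y _ => ?_
    have := neg_le_abs (Real.sin (y - ψ)); simp only [hg]; linarith) φ M hφ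
  have htot : ∫ y in φ 0..(φ 0 + Real.pi), g y = 1 - Real.cos (φ 0 - ψ) := by
    have habs : ∫ y in φ 0..(φ 0 + Real.pi), |Real.sin (y - ψ)| = 2 := by
      have hper : Function.Periodic (fun y => |Real.sin (y - ψ)|) Real.pi := by
        intro y; simp only; rw [show y + Real.pi - ψ = y - ψ + Real.pi by ring, Real.sin_add_pi,
          abs_neg]
      rw [hper.intervalIntegral_add_eq (φ 0) ψ,
        intervalIntegral.integral_comp_sub_right (fun y => |Real.sin y|), sub_self,
        add_sub_cancel_left]
      have : ∫ y in (0 : ℝ)..Real.pi, |Real.sin y| = ∫ y in (0 : ℝ)..Real.pi, Real.sin y := by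
        refine intervalIntegral.integral_congr fun y hy => ?_
        rw [Set.uIcc_of_le Real.pi_pos.le] at hy
        exact abs_of_nonneg (Real.sin_nonneg_of_mem_Icc hy)
      rw [this, integral_sin]; norm_num
    have hc := hcos (φ 0) (φ 0 + Real.pi)
    rw [show φ 0 + Real.pi - ψ = φ 0 - ψ + Real.pi by ring, Real.cos_add_pi] at hc
    have e : ∀ y, g y = (1 / 2) * |Real.sin (y - ψ)| + (1 / 2) * -Real.sin (y - ψ) := by
      intro y; simp only [hg]; ring
    simp only [e]
    rw [intervalIntegral.integral_add (Continuous.intervalIntegrable (by fun_prop) _ _)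
      (Continuous.intervalIntegrable (by fun_prop) _ _), intervalIntegral.integral_const_mul,
      intervalIntegral.integral_const_mul, habs, hc]
    ring
  have hlast := hmono hM
  simp only [intervalIntegral.integral_same] at hle hlast
  rw [htot] at hlast
  linarith

namespace IsStarChain

variable {n : ℕ} {R : ℝ} {Q : ℕ → ℂ} {p : ℕ → ℝ}

theorem vertex_add_eq (Q : ℕ → ℂ) (k i : ℕ) :
    Q (k + i) = Q k + ∑ l ∈ Finset.range i, edge Q (k + l) := by
  induction i with
  | zero => simp
  | succ i ih => rw [Finset.sum_range_succ, ← add_assoc (Q k), ← ih, edge, ← add_assoc]; ring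

theorem exists_vertex_add_eq (h : IsStarChain n R Q p) (k j : ℕ) :
    ∃ i < 2 * n + 1, Q j = Q (k + i) := by
  refine ⟨(j + 2 * n * k) % (2 * n + 1), Nat.mod_lt _ (by omega), ?_⟩
  rw [← periodic_mod h.vertex_periodic j, ← periodic_mod h.vertex_periodic (k + _)]
  congr 1
  rw [Nat.add_mod_mod, show k + (j + 2 * n * k) = j + (2 * n + 1) * k by ring,
    Nat.add_mul_mod_self_left]

/-- From an arc point to a vertex the path consists of the radius and some edges, whose directions
alternate in sign and turn monotonically within π. The parity of i decides which way to go around,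
so that the number of vectors is odd. -/
theorem norm_arc_one_sub_le (h : IsStarChain n R Q p) {s : ℝ} (hs : 0 ≤ s) (hsp : s ≤ p 1)
    {i : ℕ} (hi : i < 2 * n + 1) :
    ‖Q 1 + Complex.exp (s * Complex.I) * edge Q 1 - Q (1 + i)‖ ≤ 1 := by
  set S : ℕ → ℝ := fun k => ∑ j ∈ Finset.range k, p (j + 1) with hS
  have hSmono : Monotone S := monotone_nat_of_le_succ fun k => by
    simp only [hS]; rw [Finset.sum_range_succ]; linarith [h.angle_nonneg (k + 1)]
  have hedge : ∀ k, edge Q k = (-1) ^ k * Complex.exp (-(S k * Complex.I)) * edge Q 0 :=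
    edge_eq_of_turn h.turn
  have hS0 : S 0 = 0 := by simp [hS]
  have hS1 : S 1 = p 1 := by simp [hS]
  have hSm : S (2 * n + 1) = Real.pi := by
    simp only [hS]; rw [sum_range_periodic_succ h.angle_periodic, h.angle_sum]
  set τ := p 1 - s with hτ
  have harc : Complex.exp (s * Complex.I) * edge Q 1
      = -Complex.exp (-(τ * Complex.I)) * edge Q 0 := by
    rw [hedge 1, hS1, show -((τ : ℂ) * Complex.I) = s * Complex.I + -(p 1 * Complex.I) by
      rw [hτ]; push_cast; ring, Complex.exp_add]
    ring
  rcases Nat.even_or_odd i with ⟨M, hM⟩ | ⟨a, ha⟩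
  · have hMi : i = 2 * M := by omega
    subst hMi
    set φ : ℕ → ℝ := fun l => if l = 0 then τ else S l with hφ
    have key := norm_sum_alternating_exp_le φ M (by
      intro l hl
      rcases l with _ | l
      · simp only [hφ]; simp only [↓reduceIte]; rw [if_neg (by omega), zero_add, hS1]; linarith
      · simp only [hφ]; rw [if_neg (by omega), if_neg (by omega)]; exact hSmono (by omega)) (by
      rcases M with _ | M
      · simp; exact Real.pi_pos.le
      · simp only [hφ]; rw [if_neg (by omega), if_pos trivial]
        have := hSmono (show 2 * (M + 1) ≤ 2 * n + 1 by omega)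
        linarith)
    have e : Q 1 + Complex.exp (s * Complex.I) * edge Q 1 - Q (1 + 2 * M)
        = -(∑ l ∈ Finset.range (2 * M + 1), (-1) ^ l * Complex.exp (-(φ l * Complex.I)))
          * edge Q 0 := by
      rw [vertex_add_eq Q, harc, Finset.sum_range_succ', Finset.sum_congr rfl (fun l _ => hedge (1 + l)),
        ← Finset.sum_mul]
      have : ∑ l ∈ Finset.range (2 * M), (-1) ^ (l + 1) * Complex.exp (-(φ (l + 1) * Complex.I))
          = ∑ l ∈ Finset.range (2 * M), (-1) ^ (1 + l) * Complex.exp (-(S (1 + l) * Complex.I)) := by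
        refine Finset.sum_congr rfl fun l _ => ?_
        simp only [hφ]; rw [if_neg (by omega), add_comm l 1]
      rw [this]
      simp only [hφ, ↓reduceIte, pow_zero, one_mul]
      ring
    rw [e, norm_mul, norm_neg, h.norm_edge', mul_one]; exact key
  · set j := 1 + i with hj
    -- For odd i the path runs from Q j to the next copy of Q 1. The final radius has its angle
    -- shifted by π, which supplies the sign needed by the alternation.
    obtain ⟨M, hM⟩ : ∃ M, j + 2 * M = 1 + (2 * n + 1) := ⟨n - a, by omega⟩
    have hM1 : 1 ≤ M := by omega
    set φ : ℕ → ℝ := fun l => if l = 2 * M then τ + Real.pi else S (j + l) with hφ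
    have key := norm_sum_alternating_exp_le φ M (by
      intro l hl
      simp only [hφ]; rw [if_neg (by omega)]
      split_ifs with hl'
      · have := hSmono (show j + l ≤ 2 * n + 1 by omega)
        linarith
      · exact hSmono (by omega)) (by
      simp only [hφ]; rw [if_pos trivial, if_neg (by omega)]
      have := hSmono (show 1 ≤ j + 0 by omega)
      linarith)
    have e : Q 1 + Complex.exp (s * Complex.I) * edge Q 1 - Q j
        = (∑ l ∈ Finset.range (2 * M + 1), (-1) ^ l * Complex.exp (-(φ l * Complex.I)))
          * edge Q 0 := by
      have h1 := vertex_add_eq Q j (2 * M)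
      rw [hM, h.vertex_periodic 1, Finset.sum_congr rfl (fun l _ => hedge (j + l)),
        ← Finset.sum_mul] at h1
      have : ∑ l ∈ Finset.range (2 * M), (-1) ^ l * Complex.exp (-(φ l * Complex.I))
          = ∑ l ∈ Finset.range (2 * M), (-1) ^ (j + l) * Complex.exp (-(S (j + l) * Complex.I)) := by
        refine Finset.sum_congr rfl fun l hl => ?_
        have hl := Finset.mem_range.1 hl
        simp only [hφ]; rw [if_neg (by omega), pow_add,
          Even.neg_one_pow (show Even j from ⟨a + 1, by omega⟩), one_mul]
      rw [Finset.sum_range_succ, this, h1, harc]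
      have e2 : Complex.exp (-(φ (2 * M) * Complex.I)) = -Complex.exp (-(τ * Complex.I)) := by
        simp only [hφ, ↓reduceIte]
        rw [show -(((τ + Real.pi : ℝ) : ℂ) * Complex.I) = -(τ * Complex.I) + -(Real.pi * Complex.I) by
          push_cast; ring, Complex.exp_add, Complex.exp_neg (Real.pi * Complex.I),
          Complex.exp_pi_mul_I]
        norm_num
      rw [e2, Even.neg_one_pow (show Even (2 * M) from ⟨M, by ring⟩)]
      ring
    rw [e, norm_mul, h.norm_edge', mul_one]; exact key

theorem norm_arc_sub_le (h : IsStarChain n R Q p) {k : ℕ} {s : ℝ} (hs : 0 ≤ s)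
    (hsp : s ≤ p (k + 1)) (j : ℕ) :
    ‖Q (k + 1) + Complex.exp (s * Complex.I) * edge Q (k + 1) - Q j‖ ≤ 1 := by
  obtain ⟨i, hi, hji⟩ := h.exists_vertex_add_eq (k + 1) j
  have := (h.shift k).norm_arc_one_sub_le hs (by rw [add_comm 1 k]; exact hsp) hi
  simp only [edge] at this ⊢
  rw [hji, show k + 1 + i = 1 + i + k by ring, add_comm k 1,
    show 1 + k + 1 = 1 + 1 + k by ring]
  exact this

/-- The squared norm is 1 - 8 cos((s+q)/2) sin(s/2) sin(q/2), and s < 0 < q makes the product of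
sines negative. It shows that a point beyond an end of a side is too far from a vertex. -/
theorem one_lt_norm_exp_sub_one_add {s q : ℝ} (hs : s < 0) (hs' : -(Real.pi / 3) ≤ s) (hq : 0 < q)
    (hq' : q ≤ Real.pi / 3) :
    1 < ‖Complex.exp (s * Complex.I) - 1 + Complex.exp (-(q * Complex.I))‖ := by
  have h1 : ‖Complex.exp (s * Complex.I) - 1 + Complex.exp (-(q * Complex.I))‖ ^ 2
      = 1 - 8 * Real.cos ((s + q) / 2) * Real.sin (s / 2) * Real.sin (q / 2) := by
    rw [exp_neg_mul_I, Complex.sq_norm_eq]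
    simp only [Complex.add_re, Complex.sub_re, Complex.add_im, Complex.sub_im, exp_mul_I_re,
      exp_mul_I_im, Complex.ofReal_re, Complex.ofReal_im, Complex.one_re, Complex.one_im,
      Complex.mul_re, Complex.mul_im, Complex.I_re, Complex.I_im]
    obtain ⟨a, rfl⟩ : ∃ a, s = 2 * a := ⟨s / 2, by ring⟩
    obtain ⟨b, rfl⟩ : ∃ b, q = 2 * b := ⟨q / 2, by ring⟩
    rw [show (2 * a + 2 * b) / 2 = a + b by ring, show 2 * a / 2 = a by ring,
      show 2 * b / 2 = b by ring, Real.cos_add]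
    simp only [Real.cos_two_mul, Real.sin_two_mul]
    have ha := Real.sin_sq_add_cos_sq a
    have hb := Real.sin_sq_add_cos_sq b
    have ha' : Real.sin a ^ 2 = 1 - Real.cos a ^ 2 := by linarith
    have hb' : Real.sin b ^ 2 = 1 - Real.cos b ^ 2 := by linarith
    ring_nf
    simp only [ha', hb']
    ring
  have hc : 0 < Real.cos ((s + q) / 2) :=
    Real.cos_pos_of_mem_Ioo ⟨by linarith [Real.pi_pos], by linarith [Real.pi_pos]⟩
  have hs1 : Real.sin (s / 2) < 0 :=
    Real.sin_neg_of_neg_of_neg_pi_lt (by linarith) (by linarith [Real.pi_pos])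
  have hq1 : 0 < Real.sin (q / 2) :=
    Real.sin_pos_of_pos_of_lt_pi (by linarith) (by linarith [Real.pi_pos])
  have h2 : 1 < ‖Complex.exp (s * Complex.I) - 1 + Complex.exp (-(q * Complex.I))‖ ^ 2 := by
    rw [h1]
    have := mul_pos (mul_pos hc (neg_pos.2 hs1)) hq1
    nlinarith
  nlinarith [norm_nonneg (Complex.exp (s * Complex.I) - 1 + Complex.exp (-(q * Complex.I)))]

end IsStarChain

namespace IsStarChain

variable {n : ℕ} {R : ℝ} {Q : ℕ → ℂ} {p : ℕ → ℝ}

theorem vertex_eq_add_exp (h : IsStarChain n R Q p) (k : ℕ) :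
    Q k = Q (k + 1) + Complex.exp (p (k + 1) * Complex.I) * edge Q (k + 1) := by
  have := h.turn k
  rw [edge]; linear_combination this

/-- Write the point as Q (k+1) plus the edge turned by s. The disk about Q (k+2) gives |s| ≤ π/3,
the one about Q (k+3) excludes s < 0, and by reflection the one about Q (k-1) excludes s > p (k+1).
-/
theorem exists_arc_of_norm_eq (h : IsStarChain n R Q p) (hR : 1 / 2 ≤ R) (hR3 : 3 * R ^ 2 ≤ 1)
    (hpos : ∀ k, 0 < p k) {x : ℂ} (hx : ∀ j, ‖x - Q j‖ ≤ 1) {k : ℕ} (hk : ‖x - Q (k + 1)‖ = 1) :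
    ∃ s, 0 ≤ s ∧ s ≤ p (k + 1) ∧ x = Q (k + 1) + Complex.exp (s * Complex.I) * edge Q (k + 1) := by
  have hpl : ∀ k, p k ≤ Real.pi / 3 := fun k => (h.angle_le hR hR3 k).trans (chordAngle_le hR hR3)
  set e := edge Q (k + 1) with he
  have he1 : ‖e‖ = 1 := h.norm_edge' _
  have he0 : e ≠ 0 := h.edge_ne_zero _
  set w := (x - Q (k + 1)) / e with hw
  have hxw : x = Q (k + 1) + w * e := by rw [hw, div_mul_cancel₀ _ he0]; ring
  have hw1 : ‖w‖ = 1 := by rw [hw, norm_div, he1, hk, div_one]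
  set s := Complex.arg w with hs
  have hws : Complex.exp (s * Complex.I) = w := by
    have := Complex.norm_mul_exp_arg_mul_I w
    rwa [hw1, Complex.ofReal_one, one_mul] at this
  have hcos : ∀ t : ℝ, ‖w - Complex.exp (t * Complex.I)‖ ≤ 1 → 1 / 2 ≤ Real.cos (s - t) := by
    intro t ht
    have := sq_norm_sub_exp t w
    rw [hw1, ← hws, proj_exp, hws] at this
    nlinarith [norm_nonneg (w - Complex.exp (t * Complex.I))]
  have habs : |s| ≤ Real.pi / 3 := by
    have h2 := hx (k + 2)
    have e2 : x - Q (k + 2) = (w - Complex.exp ((0 : ℝ) * Complex.I)) * e := by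
      have : Q (k + 2) = Q (k + 1) + e := by rw [he, edge]; ring
      rw [this, hxw]; simp; ring
    rw [e2, norm_mul, he1, mul_one] at h2
    have h3 := hcos 0 h2
    rw [sub_zero, ← Real.cos_abs, ← Real.cos_pi_div_three] at h3
    by_contra hlt
    push Not at hlt
    have := Real.cos_lt_cos_of_nonneg_of_le_pi (by linarith [Real.pi_pos]) (Complex.abs_arg_le_pi w) hlt
    linarith
  have hs' := abs_le.1 habs
  refine ⟨s, ?_, ?_, by rw [hws]; exact hxw⟩
  · by_contra hneg
    push Not at hneg
    have h3 := hx (k + 3)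
    have e3 : x - Q (k + 3)
        = (Complex.exp (s * Complex.I) - 1 + Complex.exp (-(p (k + 2) * Complex.I))) * e := by
      have h4 := h.edge_eq (k + 1)
      have h5 : Complex.exp (-(p (k + 2) * Complex.I)) * Complex.exp (p (k + 2) * Complex.I) = 1 := by
        rw [← Complex.exp_add]; simp
      have h6 : Q (k + 3) = Q (k + 1) + e + edge Q (k + 2) := by rw [he, edge, edge]; ring
      rw [← he] at h4
      rw [h6, hws, hxw]
      linear_combination (edge Q (k + 2)) * h5 - Complex.exp (-(p (k + 2) * Complex.I)) * h4
    rw [e3, norm_mul, he1, mul_one] at h3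
    exact absurd h3 (not_le.2 (one_lt_norm_exp_sub_one_add hneg hs'.1 (hpos _) (hpl _)))
  · by_contra hlt
    push Not at hlt
    obtain ⟨j, hj⟩ : ∃ j, Q j = Q (k + 1) + Complex.exp (p (k + 1) * Complex.I) * e
        - Complex.exp ((p k + p (k + 1) : ℝ) * Complex.I) * e := by
      refine ⟨k + 2 * n, ?_⟩
      have h1 := h.vertex_eq_add_exp k
      have h2 := h.vertex_eq_add_exp (k + 2 * n)
      have h3 := h.edge_eq k
      have h4 : edge Q (k + (2 * n + 1)) = edge Q k := by
        rw [edge, edge, h.vertex_periodic, add_right_comm, h.vertex_periodic]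
      rw [add_assoc k, h.vertex_periodic, h.angle_periodic, h4] at h2
      rw [← he] at h1 h3
      rw [h2, ← h1, h3, Complex.ofReal_add, add_mul, Complex.exp_add]
      ring
    have h3 := hx j
    have e3 : x - Q j = Complex.exp (p (k + 1) * Complex.I) * e * (starRingEnd ℂ)
        (Complex.exp ((p (k + 1) - s : ℝ) * Complex.I) - 1 + Complex.exp (-(p k * Complex.I))) := by
      have c1 : (starRingEnd ℂ) (Complex.exp ((p (k + 1) - s : ℝ) * Complex.I) - 1
          + Complex.exp (-(p k * Complex.I)))
          = Complex.exp (-((p (k + 1) - s : ℝ) * Complex.I)) - 1 + Complex.exp (p k * Complex.I) := by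
        simp [← Complex.exp_conj]
      have c2 : Complex.exp (p (k + 1) * Complex.I) * Complex.exp (-((p (k + 1) - s : ℝ) * Complex.I))
          = w := by
        rw [← hws, ← Complex.exp_add]; congr 1; push_cast; ring
      have c3 : Complex.exp ((p k + p (k + 1) : ℝ) * Complex.I)
          = Complex.exp (p (k + 1) * Complex.I) * Complex.exp (p k * Complex.I) := by
        rw [← Complex.exp_add]; congr 1; push_cast; ring
      rw [c1, hj, c3, hxw]
      linear_combination (-e) * c2
    rw [e3, norm_mul, norm_mul, he1, Complex.norm_exp_ofReal_mul_I, one_mul, one_mul,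
      Complex.norm_conj] at h3
    refine absurd h3 (not_le.2 (one_lt_norm_exp_sub_one_add (by linarith) ?_ (hpos _) (hpl _)))
    linarith [hpos (k + 1)]

theorem edge_periodic (h : IsStarChain n R Q p) (k : ℕ) : edge Q (k + (2 * n + 1)) = edge Q k := by
  rw [edge, edge, h.vertex_periodic, add_right_comm, h.vertex_periodic]

/-- Every direction is, up to sign, in the angle of the chain at some vertex. -/
theorem exists_direction (h : IsStarChain n R Q p) (hpos : ∀ k, 0 < p k)
    (hlt : ∀ k, p k < Real.pi) {ν : ℂ} (hν : ‖ν‖ = 1) :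
    ∃ k s, 0 ≤ s ∧ s ≤ p (k + 1) ∧ (ν = Complex.exp (s * Complex.I) * edge Q (k + 1) ∨
      -ν = Complex.exp (s * Complex.I) * edge Q (k + 1)) := by
  set f : ℕ → ℝ := fun k => (ν * (starRingEnd ℂ) (edge Q k)).im with hf
  have hfper : ∀ k, f (k + (2 * n + 1)) = f k := fun k => by simp only [hf, h.edge_periodic]
  -- The product of all f k * f (k+1) around the cycle is a square, whereas an odd number of
  -- negative factors would make it negative. For the resulting k, the line of ν meets the angle of
  -- the chain at Q (k+1).
  obtain ⟨k, hk⟩ : ∃ k, 0 ≤ f k * f (k + 1) := by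
    by_contra! hneg
    have h1 : ∏ k ∈ Finset.range (2 * n + 1), (f k * f (k + 1))
        = (∏ k ∈ Finset.range (2 * n + 1), f k) ^ 2 := by
      rw [Finset.prod_mul_distrib, sq]
      congr 1
      have e1 := Finset.prod_range_succ f (2 * n + 1)
      have e2 := Finset.prod_range_succ' f (2 * n + 1)
      have e3 := hfper 0
      rw [zero_add] at e3
      have hf0 : f 0 ≠ 0 := by
        intro h0; have := hneg 0; rw [h0, zero_mul] at this; exact lt_irrefl _ this
      rw [e1, e3] at e2
      exact (mul_right_cancel₀ hf0 e2).symm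
    have h2 : ∏ k ∈ Finset.range (2 * n + 1), (f k * f (k + 1))
        = -∏ k ∈ Finset.range (2 * n + 1), -(f k * f (k + 1)) := by
      rw [Finset.prod_neg, Finset.card_range, Odd.neg_one_pow ⟨n, rfl⟩]; ring
    have h3 : 0 < ∏ k ∈ Finset.range (2 * n + 1), -(f k * f (k + 1)) :=
      Finset.prod_pos fun k _ => neg_pos.2 (hneg k)
    have := sq_nonneg (∏ k ∈ Finset.range (2 * n + 1), f k)
    linarith
  set e := edge Q (k + 1) with he
  have hee : e * (starRingEnd ℂ) e = 1 := h.edge_mul_conj _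
  set w := ν * (starRingEnd ℂ) e with hw
  have hνw : ν = w * e := by rw [hw]; linear_combination (-ν) * hee
  have hw1 : ‖w‖ = 1 := by rw [hw, norm_mul, Complex.norm_conj, hν, h.norm_edge', mul_one]
  set s := Complex.arg w with hs
  have hws : w = Complex.exp (s * Complex.I) := by
    have := Complex.norm_mul_exp_arg_mul_I w
    rw [hw1, Complex.ofReal_one, one_mul] at this
    exact this.symm
  have f1 : f (k + 1) = Real.sin s := by
    rw [show f (k + 1) = w.im from rfl, hws, exp_mul_I_im]
  have f0 : f k = -Real.sin (s - p (k + 1)) := by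
    have : ν * (starRingEnd ℂ) (edge Q k) = -Complex.exp ((s - p (k + 1) : ℝ) * Complex.I) := by
      rw [h.edge_eq k, ← he, map_mul, map_neg, ← Complex.exp_conj]
      simp only [map_mul, Complex.conj_ofReal, Complex.conj_I]
      rw [Complex.ofReal_sub, sub_mul, sub_eq_add_neg, Complex.exp_add, ← hws, mul_neg, hw]
      ring
    simp only [hf]
    rw [this, Complex.neg_im, exp_mul_I_im]
  rw [f0, f1] at hk
  have hp := hpos (k + 1)
  have hp' := hlt (k + 1)
  have hsl := Complex.neg_pi_lt_arg w
  have hsu := Complex.arg_le_pi w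
  rw [← hs] at hsl hsu
  have hflip : -w = Complex.exp ((s + Real.pi : ℝ) * Complex.I) := by
    rw [Complex.ofReal_add, add_mul, Complex.exp_add, Complex.exp_pi_mul_I, ← hws]; ring
  have hflip' : -w = Complex.exp ((s - Real.pi : ℝ) * Complex.I) := by
    rw [Complex.ofReal_sub, sub_mul, Complex.exp_sub, Complex.exp_pi_mul_I, ← hws]; ring
  rcases lt_or_ge s 0 with hs0 | hs0
  · have h1 := Real.sin_neg_of_neg_of_neg_pi_lt hs0 hsl
    have h2 : s + Real.pi ≤ p (k + 1) := by
      by_contra hcon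
      push Not at hcon
      have h3 := Real.sin_neg_of_neg_of_neg_pi_lt (x := s - p (k + 1)) (by linarith) (by linarith)
      nlinarith
    exact ⟨k, s + Real.pi, by linarith, h2, Or.inr (by rw [hνw, ← hflip]; ring)⟩
  · rcases le_or_gt s (p (k + 1)) with hsp | hsp
    · exact ⟨k, s, hs0, hsp, Or.inl (by rw [hνw, hws])⟩
    · rcases hsu.lt_or_eq with hsu | hsu
      · have h1 := Real.sin_pos_of_pos_of_lt_pi (by linarith) hsu
        have h3 := Real.sin_pos_of_pos_of_lt_pi (x := s - p (k + 1)) (by linarith) (by linarith)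
        nlinarith
      · refine ⟨k, s - Real.pi, by linarith, by linarith, Or.inr ?_⟩
        rw [hνw, ← hflip']; ring

/-- The unit disks about Q (k+2) and Q k give the inequality for the two extreme directions of the
angle, and any direction between them is a nonnegative combination. Thus Q (k+1) supports the
intersection opposite to its arc. -/
theorem inner_direction_nonneg (h : IsStarChain n R Q p) (hpos : ∀ k, 0 < p k)
    (hlt : ∀ k, p k < Real.pi) {x : ℂ} (hx : ∀ j, ‖x - Q j‖ ≤ 1) {k : ℕ} {s : ℝ} (hs : 0 ≤ s)
    (hsp : s ≤ p (k + 1)) :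
    0 ≤ inner ℝ (Complex.exp (s * Complex.I) * edge Q (k + 1)) (x - Q (k + 1)) := by
  set e := edge Q (k + 1) with he
  set y := x - Q (k + 1) with hy
  have aux : ∀ v : ℂ, ‖v‖ = 1 → ‖y - v‖ ≤ 1 → 0 ≤ inner ℝ v y := by
    intro v hv hyv
    have := norm_sub_sq_real y v
    rw [hv, real_inner_comm] at this
    nlinarith [norm_nonneg (y - v), sq_nonneg ‖y‖]
  have h1 : 0 ≤ inner ℝ e y := by
    refine aux e (h.norm_edge' _) ?_
    have := hx (k + 2)
    rwa [show x - Q (k + 2) = y - e by rw [hy, he, edge]; ring] at this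
  have h2 : 0 ≤ inner ℝ (Complex.exp (p (k + 1) * Complex.I) * e) y := by
    refine aux _ (by rw [norm_mul, Complex.norm_exp_ofReal_mul_I, h.norm_edge', mul_one]) ?_
    have := hx k
    rwa [h.vertex_eq_add_exp k, ← he, ← sub_sub, ← hy] at this
  have hsin := Real.sin_pos_of_pos_of_lt_pi (hpos (k + 1)) (hlt (k + 1))
  have e1 : (Real.sin (p (k + 1))) • (Complex.exp (s * Complex.I) * e)
      = Real.sin (p (k + 1) - s) • e + Real.sin s • (Complex.exp (p (k + 1) * Complex.I) * e) := by
    have : (Real.sin (p (k + 1)) : ℂ) * Complex.exp (s * Complex.I)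
        = Real.sin (p (k + 1) - s) + Real.sin s * Complex.exp (p (k + 1) * Complex.I) := by
      apply Complex.ext
      · rw [Complex.re_ofReal_mul, Complex.add_re, Complex.re_ofReal_mul, Complex.ofReal_re,
          exp_mul_I_re, exp_mul_I_re, Real.sin_sub]; ring
      · rw [Complex.im_ofReal_mul, Complex.add_im, Complex.im_ofReal_mul, Complex.ofReal_im,
          exp_mul_I_im, exp_mul_I_im]; ring
    rw [Complex.real_smul, Complex.real_smul, Complex.real_smul]
    linear_combination e * this
  have e2 := congrArg (fun v => inner ℝ v y) e1
  simp only [inner_add_left, real_inner_smul_left] at e2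
  have h3 : 0 ≤ Real.sin (p (k + 1) - s) :=
    Real.sin_nonneg_of_nonneg_of_le_pi (by linarith) (by linarith [hlt (k + 1)])
  have h4 : 0 ≤ Real.sin s := Real.sin_nonneg_of_nonneg_of_le_pi hs (by linarith [hlt (k + 1)])
  have h5 := add_nonneg (mul_nonneg h3 h1) (mul_nonneg h4 h2)
  rw [← e2] at h5
  exact nonneg_of_mul_nonneg_right h5 hsin

end IsStarChain

/-! ### The intersection of the unit disks centered at the vertices -/

theorem widthIn_eq_one {K : Set ℂ} {ν : ℂ} {a : ℝ} (hle : ∀ x ∈ K, a ≤ inner ℝ ν x)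
    (hge : ∀ x ∈ K, inner ℝ ν x ≤ a + 1) (ha : ∃ x ∈ K, inner ℝ ν x = a)
    (ha' : ∃ x ∈ K, inner ℝ ν x = a + 1) : widthIn ν K = 1 := by
  have h1 : IsLeast ((fun x => inner ℝ ν x) '' K) a :=
    ⟨ha, by rintro _ ⟨x, hx, rfl⟩; exact hle x hx⟩
  have h2 : IsGreatest ((fun x => inner ℝ ν x) '' K) (a + 1) :=
    ⟨ha', by rintro _ ⟨x, hx, rfl⟩; exact hge x hx⟩
  rw [widthIn, h1.csInf_eq, h2.csSup_eq]; ring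

namespace IsStarChain

variable {n : ℕ} {R : ℝ} {Q : ℕ → ℂ} {p : ℕ → ℝ}

/-- The intersection of the unit disks centered at the points of `Q`. -/
def ballHull (Q : ℕ → ℂ) : Set ℂ := {x | ∀ j, ‖x - Q j‖ ≤ 1}

theorem ballHull_eq (Q : ℕ → ℂ) : ballHull Q = ⋂ j, Metric.closedBall (Q j) 1 := by
  ext x; simp [ballHull, dist_eq_norm]

theorem isClosed_ballHull (Q : ℕ → ℂ) : IsClosed (ballHull Q) := by
  rw [ballHull_eq]; exact isClosed_iInter fun _ => Metric.isClosed_closedBall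

theorem vertex_mem_ballHull (h : IsStarChain n R Q p) (k : ℕ) : Q k ∈ ballHull Q := by
  intro j
  have := h.norm_arc_sub_le (k := k) (h.angle_nonneg _) le_rfl j
  rwa [← h.vertex_eq_add_exp k] at this

theorem ball_subset_ballHull (h : IsStarChain n R Q p) : Metric.ball 0 (1 - R) ⊆ ballHull Q := by
  intro x hx j
  rw [mem_ball_zero_iff] at hx
  have := norm_sub_le x (Q j)
  linarith [h.norm_le j]

theorem isBodyOfWidthOne (h : IsStarChain n R Q p) (hR : 1 / 2 ≤ R) (hR3 : 3 * R ^ 2 ≤ 1)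
    (hpos : ∀ k, 0 < p k) : IsBodyOfWidthOne (ballHull Q) where
  isCompact := (isCompact_closedBall (Q 0) 1).of_isClosed_subset (isClosed_ballHull Q)
    fun x hx => mem_closedBall_iff_norm.2 (hx 0)
  convex := by rw [ballHull_eq]; exact convex_iInter fun _ => convex_closedBall _ _
  interior_nonempty := ⟨0, mem_interior.2 ⟨_, h.ball_subset_ballHull, Metric.isOpen_ball,
    Metric.mem_ball_self (by nlinarith)⟩⟩
  width_eq := by
    intro ν hν
    have hlt : ∀ k, p k < Real.pi := fun k =>
      ((h.angle_le hR hR3 k).trans (chordAngle_le hR hR3)).trans_lt (by linarith [Real.pi_pos])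
    obtain ⟨k, s, hs, hsp, hdir⟩ := h.exists_direction hpos hlt hν
    set v := Complex.exp (s * Complex.I) * edge Q (k + 1) with hv
    have hv1 : ‖v‖ = 1 := by rw [hv, norm_mul, Complex.norm_exp_ofReal_mul_I, h.norm_edge', mul_one]
    have hmem : Q (k + 1) + v ∈ ballHull Q := fun j => h.norm_arc_sub_le hs hsp j
    have hvert := h.vertex_mem_ballHull (k + 1)
    have hlow : ∀ x ∈ ballHull Q, inner ℝ v (Q (k + 1)) ≤ inner ℝ v x := by
      intro x hx
      have := h.inner_direction_nonneg hpos hlt hx hs hsp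
      rw [← hv, inner_sub_right] at this
      linarith
    have hup : ∀ x ∈ ballHull Q, inner ℝ v x ≤ inner ℝ v (Q (k + 1)) + 1 := by
      intro x hx
      have := real_inner_le_norm v (x - Q (k + 1))
      rw [hv1, one_mul, inner_sub_right] at this
      linarith [hx (k + 1)]
    have htop : inner ℝ v (Q (k + 1) + v) = inner ℝ v (Q (k + 1)) + 1 := by
      rw [inner_add_right, real_inner_self_eq_norm_sq, hv1]; norm_num
    rcases hdir with hdir | hdir
    · rw [hdir]
      exact widthIn_eq_one hlow hup ⟨_, hvert, rfl⟩ ⟨_, hmem, htop⟩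
    · rw [← neg_neg ν, hdir]
      refine widthIn_eq_one (a := -(inner ℝ v (Q (k + 1)) + 1)) ?_ ?_ ⟨_, hmem, ?_⟩ ⟨_, hvert, ?_⟩
      · intro x hx; rw [inner_neg_left]; linarith [hup x hx]
      · intro x hx; rw [inner_neg_left]; linarith [hlow x hx]
      · rw [inner_neg_left, htop]
      · rw [inner_neg_left]; ring

/-- If two vertices coincide, the next vertex after each lies on the arc of the other. The edges
then differ by nonnegative rotations in both orders, hence are equal; but between them the chain
turns by a sign times exp(-iS) with 0 < S < π, which is never 1. -/
theorem vertex_ne (h : IsStarChain n R Q p) (hR : 1 / 2 ≤ R) (hR3 : 3 * R ^ 2 ≤ 1)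
    (hpos : ∀ k, 0 < p k) {i d : ℕ} (hd : 0 < d) (hdn : d < 2 * n + 1) : Q (i + d) ≠ Q i := by
  intro heq
  have hpl : ∀ k, p k ≤ Real.pi / 3 := fun k => (h.angle_le hR hR3 k).trans (chordAngle_le hR hR3)
  have aux : ∀ i j, Q i = Q j → ∃ s, 0 ≤ s ∧ s ≤ Real.pi / 3 ∧
      edge Q i = Complex.exp (s * Complex.I) * edge Q j := by
    intro i j hij
    have e1 : Q (i + 1) - Q (j + 2 * n + 1) = edge Q i := by
      rw [add_assoc j, h.vertex_periodic, ← hij, edge]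
    obtain ⟨s, hs, hsp, hx⟩ := h.exists_arc_of_norm_eq hR hR3 hpos (h.vertex_mem_ballHull (i + 1))
      (k := j + 2 * n) (by rw [e1, h.norm_edge'])
    rw [add_assoc j, h.edge_periodic, h.vertex_periodic] at hx
    refine ⟨s, hs, hsp.trans (hpl _), ?_⟩
    rw [edge, hx, hij]; ring
  obtain ⟨s, hs, hsp, hx⟩ := aux _ _ heq
  obtain ⟨s', hs', hsp', hx'⟩ := aux _ _ heq.symm
  have hss : Complex.exp ((s + s' : ℝ) * Complex.I) = Complex.exp ((0 : ℝ) * Complex.I) := by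
    apply mul_right_cancel₀ (h.edge_ne_zero i)
    rw [Complex.ofReal_add, add_mul, Complex.exp_add]
    simp only [Complex.ofReal_zero, zero_mul, Complex.exp_zero, one_mul]
    rw [hx] at hx'
    linear_combination -hx'
  have h0 := eq_of_exp_eq hss (by rw [sub_zero, abs_of_nonneg (by linarith)]; linarith [Real.pi_pos])
  have hs0 : s = 0 := by linarith
  rw [hs0] at hx
  simp only [Complex.ofReal_zero, zero_mul, Complex.exp_zero, one_mul] at hx
  have hshift := h.shift i
  have hturn := edge_eq_of_turn (Q := fun k => Q (k + i)) (p := fun k => p (k + i)) hshift.turn d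
  have ed : ∀ k, edge (fun k => Q (k + i)) k = edge Q (k + i) := by
    intro k; simp only [edge]; rw [add_right_comm]
  rw [ed, ed, zero_add, add_comm d i, hx] at hturn
  set S := ∑ j ∈ Finset.range d, p (j + 1 + i) with hS
  have hSpos : 0 < S := Finset.sum_pos (fun j _ => hpos _) (Finset.nonempty_range_iff.2 hd.ne')
  have hSlt : S < Real.pi := by
    have h1 := hshift.angle_sum
    rw [← sum_range_periodic_succ hshift.angle_periodic] at h1
    rw [← h1]
    refine Finset.sum_lt_sum_of_subset (i := d) (Finset.range_mono hdn.le) (Finset.mem_range.2 hdn)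
      (by simp) (hpos _) fun j _ _ => (hpos _).le
  have h1 : (-1) ^ d * Complex.exp (-(S * Complex.I)) = 1 := by
    apply mul_right_cancel₀ (h.edge_ne_zero i)
    rw [one_mul]; exact hturn.symm
  have him := congrArg Complex.im h1
  rw [show ((-1 : ℂ) ^ d) = (((-1 : ℝ) ^ d : ℝ) : ℂ) by push_cast; rfl, Complex.im_ofReal_mul,
    show -((S : ℂ) * Complex.I) = ((-S : ℝ) : ℂ) * Complex.I by push_cast; ring, exp_mul_I_im,
    Real.sin_neg, Complex.one_im] at him
  have hsin := Real.sin_pos_of_pos_of_lt_pi hSpos hSlt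
  have hne : (-1 : ℝ) ^ d ≠ 0 := pow_ne_zero _ (by norm_num)
  exact mul_ne_zero hne (neg_ne_zero.2 hsin.ne') him

theorem frontier_ballHull (h : IsStarChain n R Q p) (hR : 1 / 2 ≤ R) (hR3 : 3 * R ^ 2 ≤ 1)
    (hpos : ∀ k, 0 < p k) {x : ℂ} : x ∈ frontier (ballHull Q) ↔ ∃ k s, 0 ≤ s ∧ s ≤ p (k + 1) ∧
      x = Q (k + 1) + Complex.exp (s * Complex.I) * edge Q (k + 1) := by
  rw [(isClosed_ballHull Q).frontier_eq]
  constructor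
  · rintro ⟨hx, hxi⟩
    obtain ⟨j, hj⟩ : ∃ j, ‖x - Q j‖ = 1 := by
      by_contra! hne
      refine hxi (mem_interior.2 ⟨⋂ j ∈ Finset.range (2 * n + 1), Metric.ball (Q j) 1, ?_, ?_, ?_⟩)
      · intro y hy j
        rw [← periodic_mod h.vertex_periodic j, ← mem_closedBall_iff_norm]
        exact Metric.ball_subset_closedBall
          (Set.mem_iInter₂.1 hy _ (Finset.mem_range.2 (Nat.mod_lt _ (by omega))))
      · exact isOpen_biInter_finset fun _ _ => Metric.isOpen_ball
      · exact Set.mem_iInter₂.2 fun j _ => mem_ball_iff_norm.2 (lt_of_le_of_ne (hx j) (hne j))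
    rw [← h.vertex_periodic j, ← add_assoc] at hj
    obtain ⟨s, hs⟩ := h.exists_arc_of_norm_eq hR hR3 hpos hx hj
    exact ⟨_, s, hs⟩
  · rintro ⟨k, s, hs, hsp, hx⟩
    refine ⟨fun j => by rw [hx]; exact h.norm_arc_sub_le hs hsp j, fun hxi => ?_⟩
    have hsub : ballHull Q ⊆ Metric.closedBall (Q (k + 1)) 1 := fun y hy =>
      mem_closedBall_iff_norm.2 (hy _)
    have := interior_mono hsub hxi
    rw [interior_closedBall _ one_ne_zero, mem_ball_iff_norm, hx, add_sub_cancel_left, norm_mul,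
      Complex.norm_exp_ofReal_mul_I, h.norm_edge', mul_one] at this
    exact lt_irrefl _ this

/-- A star chain with positive angles is the chain of vertices of a Reuleaux polygon. -/
theorem exists_reuleauxPolygon (h : IsStarChain n R Q p) (hR : 1 / 2 ≤ R) (hR3 : 3 * R ^ 2 ≤ 1)
    (hpos : ∀ k, 0 < p k) : ∃ P : ReuleauxPolygon n, P.body = ballHull Q ∧ P.chain 0 = Q ∧
      P.chainAngle = p := by
  have hval : ∀ k : ZMod (2 * n + 1), ∀ {M : Type} (f : ℕ → M),
      (∀ k, f (k + (2 * n + 1)) = f k) → f (k + 1).val = f (k.val + 1) := by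
    intro k M f hf
    rw [ZMod.val_add, ← periodic_mod hf (k.val + 1)]
    congr 1
    rw [ZMod.val_one_eq_one_mod, Nat.add_mod_mod]
  have hcast : ∀ (k : ℕ) {M : Type} (f : ℕ → M),
      (∀ k, f (k + (2 * n + 1)) = f k) → f (k : ZMod (2 * n + 1)).val = f k := by
    intro k M f hf
    rw [ZMod.val_natCast, periodic_mod hf]
  have hexp : ∀ k, Complex.exp (Complex.arg (edge Q k) * Complex.I) = edge Q k := by
    intro k
    have := Complex.norm_mul_exp_arg_mul_I (edge Q k)
    rwa [h.norm_edge', Complex.ofReal_one, one_mul] at this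
  have hexp' : ∀ k (s : ℝ), Complex.exp ((Complex.arg (edge Q k) + s : ℝ) * Complex.I)
      = Complex.exp (s * Complex.I) * edge Q k := by
    intro k s
    rw [Complex.ofReal_add, add_mul, Complex.exp_add, hexp, mul_comm]
  refine ⟨{ body := ballHull Q
            vertex := fun k => Q k.val
            α := fun k => Complex.arg (edge Q k.val)
            β := fun k => Complex.arg (edge Q k.val) + p k.val
            isBody := h.isBodyOfWidthOne hR hR3 hpos
            vertex_injective := ?_
            α_lt_β := fun k => by linarith [hpos k.val]
            vertex_succ := ?_
            vertex_pred := ?_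
            frontier_eq := ?_ }, rfl, ?_, ?_⟩
  · intro i j hij
    by_contra hne
    have hne' : i.val ≠ j.val := fun hv => hne (ZMod.val_injective _ hv)
    have hi := ZMod.val_lt i
    have hj := ZMod.val_lt j
    rcases lt_or_gt_of_ne hne' with hlt | hlt
    · obtain ⟨d, hd⟩ := Nat.exists_eq_add_of_lt hlt
      have := h.vertex_ne hR hR3 hpos (i := i.val) (d := d + 1) (by omega) (by omega)
      rw [← add_assoc, ← hd] at this
      exact this hij.symm
    · obtain ⟨d, hd⟩ := Nat.exists_eq_add_of_lt hlt
      have := h.vertex_ne hR hR3 hpos (i := j.val) (d := d + 1) (by omega) (by omega)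
      rw [← add_assoc, ← hd] at this
      exact this hij
  · intro k
    rw [hval k Q h.vertex_periodic, hexp, edge]; ring
  · intro k
    obtain ⟨j, rfl⟩ : ∃ j, k = j + 1 := ⟨k - 1, by ring⟩
    rw [add_sub_cancel_right, hexp', hval j Q h.vertex_periodic, hval j p h.angle_periodic,
      hval j (edge Q) h.edge_periodic]
    exact h.vertex_eq_add_exp _
  · ext x
    rw [h.frontier_ballHull hR hR3 hpos]
    simp only [Set.mem_iUnion, unitArc, Set.mem_image, Set.mem_Icc]
    constructor
    · rintro ⟨k, s, hs, hsp, hx⟩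
      refine ⟨((k + 1 : ℕ) : ZMod (2 * n + 1)), Complex.arg (edge Q (k + 1)) + s, ?_, ?_⟩
      · rw [hcast _ (edge Q) h.edge_periodic, hcast _ p h.angle_periodic]
        constructor <;> linarith
      · rw [hcast _ Q h.vertex_periodic, hexp', hx]
    · rintro ⟨k, t, ⟨ht, ht'⟩, rfl⟩
      refine ⟨k.val + 2 * n, t - Complex.arg (edge Q k.val), by linarith, ?_, ?_⟩
      · rw [add_assoc, h.angle_periodic]; linarith
      · rw [add_assoc, h.vertex_periodic, h.edge_periodic, ← hexp', add_sub_cancel]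
  · funext k
    simp only [ReuleauxPolygon.chain]
    rw [hcast _ Q h.vertex_periodic, sub_zero]
  · funext k
    simp only [ReuleauxPolygon.chainAngle]
    rw [hcast _ p h.angle_periodic, add_sub_cancel_left]

end IsStarChain

/-! ### The extremal chain -/

/-- Along the arc of the circle of radius R about 0 inside the lens, the defect goes continuously
from 0 on the real axis to ℓ at the corner. -/
theorem exists_lens_defect_eq {R e : ℝ} (hR : 1 / 2 < R) (hR3 : 3 * R ^ 2 ≤ 1) (he : 0 < e)
    (he' : e ≤ chordAngle R) : ∃ z ∈ lens R, ‖z‖ = R ∧ 0 < z.im ∧ defect z = e := by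
  have hl := chordAngle_pos hR
  have hl' := chordAngle_le hR.le hR3
  set Z : ℝ → ℂ := fun v => R * Complex.exp (v * Complex.I) with hZ
  have hnorm : ∀ v, ‖Z v‖ = R := by
    intro v
    simp only [hZ]
    rw [norm_mul, Complex.norm_exp_ofReal_mul_I, mul_one, Complex.norm_of_nonneg (by linarith)]
  have hre : ∀ v, (Z v).re = R * Real.cos v := by
    intro v; simp only [hZ]; rw [Complex.re_ofReal_mul, exp_mul_I_re]
  have him : ∀ v, (Z v).im = R * Real.sin v := by
    intro v; simp only [hZ]; rw [Complex.im_ofReal_mul, exp_mul_I_im]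
  have hlens : ∀ v ∈ Set.Icc 0 (chordAngle R / 2), Z v ∈ lens R := by
    intro v hv
    refine ⟨(hnorm v).le, ?_⟩
    have h1 := Complex.sq_norm_one_sub (Z v)
    have h2 := Real.cos_le_cos_of_nonneg_of_le_pi hv.1 (by linarith) hv.2
    rw [cos_half_chordAngle hR.le, div_le_iff₀ (by linarith)] at h2
    rw [hre, hnorm] at h1
    exact le_of_sq_le_sq (by nlinarith) (by linarith)
  have hcont : ContinuousOn (fun v => defect (Z v)) (Set.Icc 0 (chordAngle R / 2)) := by
    have hc : Continuous Z := by unfold Z; fun_prop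
    intro v hv
    have h1 := lens_re_pos hR3 (hlens v hv)
    have h2 := lens_re_pos hR3 (lens_one_sub (hlens v hv))
    have c1 := (Complex.continuousAt_arg (Complex.mem_slitPlane_iff.2 (Or.inl h1))).comp hc.continuousAt
    have c2 := (Complex.continuousAt_arg (x := 1 - Z v) (Complex.mem_slitPlane_iff.2 (Or.inl h2))).comp
      (f := fun v => 1 - Z v) (by fun_prop)
    exact (c1.sub c2).continuousWithinAt
  have hbot : defect (Z 0) = 0 := by
    have h1 : Z 0 = (R : ℂ) := by simp [hZ]
    have h2 : (1 : ℂ) - R = ((1 - R : ℝ) : ℂ) := by push_cast; rfl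
    rw [defect, h1, h2, Complex.arg_ofReal_of_nonneg (by linarith),
      Complex.arg_ofReal_of_nonneg (by nlinarith), sub_zero]
  have hsin : ∀ v, 0 < v → v ≤ chordAngle R / 2 → 0 < (Z v).im := by
    intro v hv hv'
    rw [him]
    exact mul_pos (by linarith) (Real.sin_pos_of_pos_of_lt_pi hv (by linarith))
  have htop : defect (Z (chordAngle R / 2)) = chordAngle R := by
    have h1 := Complex.sq_norm_one_sub (Z (chordAngle R / 2))
    rw [hre, hnorm, cos_half_chordAngle hR.le] at h1
    have h2 : ‖1 - Z (chordAngle R / 2)‖ = R := by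
      refine (pow_left_inj₀ (norm_nonneg _) (by linarith) two_ne_zero).1 ?_
      rw [h1]; field_simp; ring
    have h3 := defect_eq_of_norm_eq hR.le (hnorm _) h2 (hsin _ (by linarith) le_rfl)
    rw [defect, h3.1, h3.2]; ring
  obtain ⟨v, hv, hve⟩ := intermediate_value_Icc (by linarith) hcont
    (show e ∈ Set.Icc (defect (Z 0)) (defect (Z (chordAngle R / 2))) by
      rw [hbot, htop]; exact ⟨he.le, he'⟩)
  have hv0 : 0 < v := by
    refine lt_of_le_of_ne hv.1 fun h0 => ?_
    simp only [← h0, hbot] at hve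
    exact he.ne hve
  exact ⟨Z v, hlens v hv, hnorm v, hsin v hv0 hv.2, hve⟩

theorem arg_pos_of_im_pos {z : ℂ} (h : 0 < z.im) : 0 < Complex.arg z := by
  refine lt_of_le_of_ne (Complex.arg_nonneg_iff.2 h.le) fun h' => ?_
  have := Complex.norm_mul_sin_arg z
  rw [← h', Real.sin_zero, mul_zero] at this
  exact h.ne this

namespace IsStarChain

variable {n : ℕ} {R : ℝ} {Q : ℕ → ℂ} {p : ℕ → ℝ}

/-- A closed chain is determined, up to rotation, by the triangles over its edges. -/
theorem exists_of_apex {z : ℕ → ℂ} (hper : ∀ k, z (k + (2 * n + 1)) = z k)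
    (hlens : ∀ k, z k ∈ lens R) (him : ∀ k, 0 < (z k).im) (hz : ∀ k, ‖z (k + 1)‖ = ‖1 - z k‖)
    (hsum : ∑ k ∈ Finset.range (2 * n + 1), defect (z k) = Real.pi) :
    ∃ Q p, IsStarChain n R Q p ∧ (∀ k, 0 < p k) ∧ ∀ k, ‖Q k‖ = ‖z k‖ := by
  set p : ℕ → ℝ := fun k => Complex.arg (z k) - Complex.arg (1 - z (k + 2 * n)) with hp
  have hps : ∀ k, p (k + 1) = Complex.arg (z (k + 1)) - Complex.arg (1 - z k) := by
    intro k; simp only [hp]; rw [show k + 1 + 2 * n = k + (2 * n + 1) by ring, hper]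
  have hpper : ∀ k, p (k + (2 * n + 1)) = p k := by
    intro k; simp only [hp]
    rw [hper, show k + (2 * n + 1) + 2 * n = k + 2 * n + (2 * n + 1) by ring, hper]
  have hppos : ∀ k, 0 < p k := by
    intro k
    have h1 := arg_pos_of_im_pos (him k)
    have h2 : Complex.arg (1 - z (k + 2 * n)) < 0 :=
      Complex.arg_neg_iff.2 (by simpa using him (k + 2 * n))
    simp only [hp]; linarith
  have hpsum : ∑ k ∈ Finset.range (2 * n + 1), p k = Real.pi := by
    rw [← sum_range_periodic_succ hpper, ← hsum]
    simp only [hps, defect, Finset.sum_sub_distrib]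
    rw [sum_range_periodic_succ (f := fun k => Complex.arg (z k)) (fun k => by rw [hper])]
  have hstep : ∀ k, z (k + 1) = Complex.exp (p (k + 1) * Complex.I) * (1 - z k) := by
    intro k
    have h1 := Complex.norm_mul_exp_arg_mul_I (z (k + 1))
    have h2 := Complex.norm_mul_exp_arg_mul_I (1 - z k)
    conv_lhs => rw [← h1]
    conv_rhs => rw [← h2]
    rw [hps, hz, Complex.ofReal_sub, sub_mul, mul_left_comm, ← Complex.exp_add, sub_add_cancel]
  set E : ℕ → ℂ := fun k => (-1) ^ k *
    Complex.exp (-((∑ j ∈ Finset.range k, p (j + 1) : ℝ) * Complex.I)) with hE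
  have hEs : ∀ k, E k = -Complex.exp (p (k + 1) * Complex.I) * E (k + 1) := by
    intro k
    simp only [hE]
    have h4 : Complex.exp (p (k + 1) * Complex.I) * Complex.exp (-(p (k + 1) * Complex.I)) = 1 := by
      rw [← Complex.exp_add]; simp
    rw [Finset.sum_range_succ, Complex.ofReal_add, add_mul, neg_add, Complex.exp_add, pow_succ]
    linear_combination (-((-1) ^ k *
      Complex.exp (-((∑ j ∈ Finset.range k, p (j + 1) : ℝ) * Complex.I)))) * h4
  have hE1 : ∀ k, ‖E k‖ = 1 := by
    intro k
    simp only [hE]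
    rw [norm_mul, norm_pow, norm_neg, norm_one, one_pow, one_mul,
      show ∀ x : ℝ, -((x : ℂ) * Complex.I) = ((-x : ℝ) : ℂ) * Complex.I by intro x; push_cast; ring,
      Complex.norm_exp_ofReal_mul_I]
  -- A full turn multiplies the edge by (-1)^(2n+1) exp(-iπ) = 1; this is where the defect sum π and
  -- the odd number of edges are needed.
  have hEper : ∀ k, E (k + (2 * n + 1)) = E k := by
    intro k
    simp only [hE]
    have h1 : ∑ j ∈ Finset.range (k + (2 * n + 1)), p (j + 1)
        = ∑ j ∈ Finset.range k, p (j + 1) + Real.pi := by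
      rw [Finset.sum_range_add, ← hpsum, ← sum_range_periodic_add hpper (k + 1)]
      congr 1
      exact Finset.sum_congr rfl fun j _ => by congr 1; ring
    rw [h1, Complex.ofReal_add, add_mul, neg_add, Complex.exp_add,
      Complex.exp_neg (Real.pi * Complex.I), Complex.exp_pi_mul_I, pow_add,
      Odd.neg_one_pow (show Odd (2 * n + 1) from ⟨n, rfl⟩)]
    norm_num
  set Q : ℕ → ℂ := fun k => -z k * E k with hQ
  have hQs : ∀ k, Q (k + 1) - Q k = E k := by
    intro k
    have h1 := hEs k
    simp only [hQ]
    rw [hstep]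
    linear_combination (z k - 1) * h1
  have hQn : ∀ k, ‖Q k‖ = ‖z k‖ := by
    intro k; simp only [hQ]; rw [norm_mul, norm_neg, hE1, mul_one]
  refine ⟨Q, p, ⟨?_, hpper, ?_, ?_, fun k => (hppos k).le, hpsum, ?_⟩, hppos, hQn⟩
  · intro k; simp only [hQ]; rw [hper, hEper]
  · intro k; rw [hQs, hE1]
  · intro k
    have h1 := hQs k
    have h2 : Q (k + 2) - Q (k + 1) = E (k + 1) := hQs (k + 1)
    rw [h2]
    linear_combination -h1 - hEs k
  · intro k; rw [hQn]; exact (hlens k).1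

/-- All triangles are the isosceles one of defect ℓ, except two mirror images of defect e over the
edges at vertex 0. The defects add up to (2N - 1)ℓ + 2e = π. -/
theorem exists_extremal (hR : 1 / 2 < R) (hR3 : 3 * R ^ 2 ≤ 1) {N : ℕ} {e : ℝ} (hN1 : 1 ≤ N)
    (he : 0 < e) (he' : e ≤ chordAngle R)
    (hN : Real.pi + chordAngle R = 2 * N * chordAngle R + 2 * e) :
    ∃ Q p, IsStarChain N R Q p ∧ (∀ k, 0 < p k) ∧ HasAtMostOneInner N R Q 0 := by
  obtain ⟨z, hz, hzR, hzim, hze⟩ := exists_lens_defect_eq hR hR3 he he'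
  obtain ⟨b, hb, hbR, hbim, hbe⟩ := exists_lens_defect_eq hR hR3 (chordAngle_pos hR) le_rfl
  -- Maximal defect forces both legs to be R: a shorter leg would make the defect of the mirror
  -- image smaller than ℓ.
  have hb1 : ‖1 - b‖ = R := by
    by_contra hne
    have h1 := defect_lt hR.le hR3 (z := 1 - (starRingEnd ℂ) b) ?_ ?_
    · rw [defect_one_sub_conj (lens_re_pos hR3 hb) (lens_re_pos hR3 (lens_one_sub hb)), hbe] at h1
      exact lt_irrefl _ h1
    · rw [show (1 : ℂ) - (starRingEnd ℂ) b = (starRingEnd ℂ) (1 - b) by simp]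
      exact ⟨by rw [Complex.norm_conj]; exact hb.2, by
        rw [← map_one (starRingEnd ℂ), ← map_sub, map_one, Complex.norm_conj, sub_sub_cancel]
        exact hb.1⟩
    · rw [show (1 : ℂ) - (starRingEnd ℂ) b = (starRingEnd ℂ) (1 - b) by simp, Complex.norm_conj]
      exact lt_of_le_of_ne hb.2 hne
  set z' := 1 - (starRingEnd ℂ) z with hz'
  have hz'1 : ‖1 - z'‖ = R := by rw [hz', sub_sub_cancel, Complex.norm_conj, hzR]
  have hz'0 : ‖z'‖ = ‖1 - z‖ := by
    rw [hz', show (1 : ℂ) - (starRingEnd ℂ) z = (starRingEnd ℂ) (1 - z) by simp, Complex.norm_conj]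
  set Z : ℕ → ℂ := fun k => if k % (2 * N + 1) = 0 then z'
    else if k % (2 * N + 1) = 2 * N then z else b with hZ
  have hZ0 : ∀ k, k % (2 * N + 1) = 0 → Z k = z' := fun k hk => by simp only [hZ]; rw [if_pos hk]
  have hZ1 : ∀ k, k % (2 * N + 1) = 2 * N → Z k = z := fun k hk => by
    simp only [hZ]; rw [if_neg (by omega), if_pos hk]
  have hZ2 : ∀ k, k % (2 * N + 1) ≠ 0 → k % (2 * N + 1) ≠ 2 * N → Z k = b := fun k hk hk' => by
    simp only [hZ]; rw [if_neg hk, if_neg hk']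
  have hnorm : ∀ k, k % (2 * N + 1) ≠ 0 → ‖Z k‖ = R := by
    intro k hk
    by_cases hk' : k % (2 * N + 1) = 2 * N
    · rw [hZ1 k hk', hzR]
    · rw [hZ2 k hk hk', hbR]
  have hnorm' : ∀ k, k % (2 * N + 1) ≠ 2 * N → ‖1 - Z k‖ = R := by
    intro k hk'
    by_cases hk : k % (2 * N + 1) = 0
    · rw [hZ0 k hk, hz'1]
    · rw [hZ2 k hk hk', hb1]
  suffices hex : ∃ Q p, IsStarChain N R Q p ∧ (∀ k, 0 < p k) ∧ ∀ k, ‖Q k‖ = ‖Z k‖ by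
    obtain ⟨Q, p, h, hpos, hQ⟩ := hex
    refine ⟨Q, p, h, hpos, by omega, fun j hj => ?_⟩
    rw [hQ, hnorm j hj]
  refine exists_of_apex ?_ ?_ ?_ ?_ ?_
  · intro k; simp only [hZ, Nat.add_mod_right]
  · intro k
    simp only [hZ]
    split_ifs
    · exact ⟨by rw [hz'0]; exact hz.2, hz'1.le⟩
    · exact hz
    · exact hb
  · intro k
    simp only [hZ]
    split_ifs
    · rw [hz']; simpa using hzim
    · exact hzim
    · exact hbim
  · intro k
    have hlt := Nat.mod_lt k (show 0 < 2 * N + 1 by omega)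
    have hs : (k + 1) % (2 * N + 1) = (k % (2 * N + 1) + 1) % (2 * N + 1) := by simp
    by_cases hk : k % (2 * N + 1) = 2 * N
    · rw [hZ1 k hk, hZ0 (k + 1) (by rw [hs, hk, Nat.mod_self]), hz'0]
    · rw [hnorm' k hk, hnorm (k + 1)]
      rw [hs, Nat.mod_eq_of_lt (by omega)]
      omega
  · obtain ⟨M, rfl⟩ : ∃ M, N = M + 1 := ⟨N - 1, by omega⟩
    rw [Finset.sum_range_succ, show 2 * (M + 1) = 2 * M + 1 + 1 by ring, Finset.sum_range_succ',
      hZ0 0 (by simp), hZ1 (2 * M + 1 + 1) (by rw [Nat.mod_eq_of_lt] <;> omega),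
      Finset.sum_congr rfl (g := fun _ => chordAngle R) fun k hk => ?_, Finset.sum_const,
      Finset.card_range, nsmul_eq_mul, hz', defect_one_sub_conj (lens_re_pos hR3 hz)
        (lens_re_pos hR3 (lens_one_sub hz)), hze]
    · push_cast at hN ⊢; linarith
    · have hk := Finset.mem_range.1 hk
      have hk1 : (k + 1) % (2 * (M + 1) + 1) = k + 1 := Nat.mod_eq_of_lt (by omega)
      rw [hZ2 (k + 1) (by omega) (by omega), hbe]

/-- Since 1 - 2R² > 0, this is a linear relation with positive coefficients among three consecutive
vertices on the circle: the center lies in their convex hull. -/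
theorem vertex_add_vertex (h : IsStarChain n R Q p) (hR : 1 / 2 ≤ R) (hR3 : 3 * R ^ 2 ≤ 1)
    (hpos : ∀ k, 0 < p k) {k : ℕ} (h0 : ‖Q k‖ = R) (h1 : ‖Q (k + 1)‖ = R) (h2 : ‖Q (k + 2)‖ = R) :
    ((R ^ 2 : ℝ) : ℂ) * (Q k + Q (k + 2)) = -((1 - 2 * R ^ 2 : ℝ) : ℂ) * Q (k + 1) := by
  have i0 := h.im_apex_pos hR hR3 hpos (k := k) (Or.inl h0)
  have i1 := h.im_apex_pos hR hR3 hpos (k := k + 1) (Or.inl h1)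
  have hab : apex Q (k + 1) = apex Q k := by
    refine eq_of_norm_eq_of_im_pos ?_ ?_ i1 i0
    · rw [h.norm_apex, h.norm_apex, h0, h1]
    · rw [h.norm_one_sub_apex, h.norm_one_sub_apex, h1, h2]
  set b := apex Q k with hb
  have hbR : ‖b‖ = R := by rw [h.norm_apex, h0]
  have hb1 : ‖1 - b‖ = R := by rw [h.norm_one_sub_apex, h1]
  have hre : b.re = 1 / 2 := by
    have := Complex.sq_norm_one_sub b
    rw [hbR, hb1] at this; linarith
  have hconj : 1 - b = (starRingEnd ℂ) b := by
    apply Complex.ext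
    · simp [hre]; norm_num
    · simp
  have hbb : b * (1 - b) = ((R ^ 2 : ℝ) : ℂ) := by
    rw [hconj, Complex.mul_conj, Complex.normSq_eq_norm_sq, hbR]
  have e0 := h.vertex_eq k
  have e1 := h.vertex_succ_eq k
  have e2 := h.vertex_eq (k + 1)
  have e3 := h.vertex_succ_eq (k + 1)
  rw [hab] at e2 e3
  rw [← hb] at e0 e1
  have hR2 : ((1 - 2 * R ^ 2 : ℝ) : ℂ) = 1 - 2 * (b * (1 - b)) := by rw [hbb]; push_cast; ring
  rw [hR2, ← hbb]
  have e3' : Q (k + 2) = (1 - b) * edge Q (k + 1) := e3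
  linear_combination b * (1 - b) * e0 + b * (1 - b) * e3' + b ^ 2 * e1 + (1 - b) ^ 2 * e2

/-- The disk of radius `R` is the smallest one that contains the extremal chain. -/
theorem radius_le_of_norm_sub_le (h : IsStarChain n R Q p) (hR : 1 / 2 < R) (hR3 : 3 * R ^ 2 ≤ 1)
    (hpos : ∀ k, 0 < p k) {k₀ : ℕ} (h₀ : HasAtMostOneInner n R Q k₀) {w : ℂ} {R' : ℝ}
    (hw : ∀ k, ‖Q k - w‖ ≤ R') : R ≤ R' := by
  by_contra! hlt
  -- For n = 1 the index k₀ + 3 is k₀ again, but then no vertex is inside. For n ≥ 2 the three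
  -- indices avoid k₀.
  have hc : ∀ i, 0 < i → i ≤ 3 → ‖Q (k₀ + i)‖ = R := by
    intro i hi hi3
    rcases (h.norm_le (k₀ + i)).lt_or_eq with hl | hl
    · have hn := h.two_le_of_norm_lt hR.le hR3 hl
      refine h₀.norm_eq _ fun hmod => ?_
      have h1 : (k₀ + i) % (2 * n + 1) = (k₀ + 0) % (2 * n + 1) := by
        rw [hmod, add_zero, Nat.mod_eq_of_lt h₀.lt]
      have h2 : i ≡ 0 [MOD (2 * n + 1)] := Nat.ModEq.add_left_cancel' k₀ h1
      rw [Nat.ModEq, Nat.mod_eq_of_lt (by omega), Nat.zero_mod] at h2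
      omega
    · exact hl
  -- A vertex on the circle that is closer to w than R has positive inner product with w, which
  -- cannot hold for three vectors with a vanishing positive combination.
  have hpos' : ∀ k, ‖Q k‖ = R → 0 < inner ℝ (Q k) w := by
    intro k hk
    have h1 := norm_sub_sq_real (Q k) w
    have h2 := hw k
    rw [hk] at h1
    have h3 : ‖Q k - w‖ ^ 2 < R ^ 2 := by nlinarith [norm_nonneg (Q k - w)]
    nlinarith [sq_nonneg ‖w‖]
  have h1 := h.vertex_add_vertex hR.le hR3 hpos (hc 1 (by omega) (by omega))
    (hc 2 (by omega) (by omega)) (hc 3 (by omega) (by omega))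
  have a1 := hpos' _ (hc 1 (by omega) (by omega))
  have a2 := hpos' _ (hc 2 (by omega) (by omega))
  have a3 := hpos' _ (hc 3 (by omega) (by omega))
  rw [neg_mul, ← Complex.real_smul, ← Complex.real_smul, ← neg_smul] at h1
  have h2 := congrArg (fun v => inner ℝ v w) h1
  simp only [real_inner_smul_left, inner_add_left] at h2
  have a2' : 0 < inner ℝ (Q (k₀ + 1 + 1)) w := a2
  have a3' : 0 < inner ℝ (Q (k₀ + 1 + 2)) w := a3
  have h3 : 0 < R ^ 2 * (inner ℝ (Q (k₀ + 1)) w + inner ℝ (Q (k₀ + 1 + 2)) w) :=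
    mul_pos (by nlinarith) (by linarith)
  have h4 : 0 < (1 - 2 * R ^ 2) * inner ℝ (Q (k₀ + 1 + 1)) w := mul_pos (by nlinarith) a2'
  linarith

end IsStarChain

/-! ### Nearly inscribed Reuleaux polygons -/

namespace ReuleauxPolygon

variable {n : ℕ} (P : ReuleauxPolygon n)

theorem exists_ball_subset : ∃ (c : ℂ) (ρ : ℝ), 0 < ρ ∧ Metric.ball c ρ ⊆ P.body := by
  obtain ⟨c, hc⟩ := P.isBody.interior_nonempty
  obtain ⟨ρ, hρ, hsub⟩ := Metric.mem_nhds_iff.1 (mem_interior_iff_mem_nhds.1 hc)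
  exact ⟨c, ρ, hρ, hsub⟩

theorem mem_body_iff {x : ℂ} : x ∈ P.body ↔ ∀ k, ‖x - P.vertex k‖ ≤ 1 := by
  obtain ⟨c, ρ, hρ, hsub⟩ := P.exists_ball_subset
  rw [P.body_eq hρ hsub, Set.mem_iInter]
  simp only [mem_closedBall_iff_norm]

theorem ball_subset_body {c : ℂ} {r : ℝ} (h : ∀ k, ‖P.vertex k - c‖ ≤ 1 - r) :
    Metric.ball c r ⊆ P.body := by
  intro x hx
  rw [mem_body_iff]
  intro k
  rw [mem_ball_iff_norm] at hx
  have := norm_sub_le (x - c) (P.vertex k - c)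
  rw [sub_sub_sub_cancel_right] at this
  linarith [h k]

/-- The body contains the disk of center `c` and radius `r`, and all vertices but possibly `P_k`
are on the circle of center `c` and radius `1 - r`. -/
structure IsNearlyInscribed (c : ℂ) (r : ℝ) (k : ZMod (2 * n + 1)) : Prop where
  ball_subset : Metric.ball c r ⊆ P.body
  norm_eq : ∀ j, j ≠ k → ‖P.vertex j - c‖ = 1 - r

variable {P}

theorem hasAtMostOneInner_chain {c : ℂ} {R : ℝ} {k : ZMod (2 * n + 1)}
    (h : ∀ j, j ≠ k → ‖P.vertex j - c‖ = R) : HasAtMostOneInner n R (P.chain c) k.val := by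
  refine ⟨ZMod.val_lt k, fun j hj => h _ fun hjk => hj ?_⟩
  rw [← hjk, ZMod.val_natCast]

theorem isNearlyInscribed_of_chain {c : ℂ} {r : ℝ} {k₀ : ℕ} (hball : Metric.ball c r ⊆ P.body)
    (h : HasAtMostOneInner n (1 - r) (P.chain c) k₀) : P.IsNearlyInscribed c r k₀ := by
  refine ⟨hball, fun j hj => ?_⟩
  have := h.norm_eq j.val (fun hv => hj ?_)
  · rwa [chain, ZMod.natCast_zmod_val] at this
  · rw [Nat.mod_eq_of_lt (ZMod.val_lt j)] at hv
    rw [← hv, ZMod.natCast_zmod_val]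

/-- A contact point is at distance 1 from P_k and r from c, so the triangle inequality gives the
missing lower bound 1 - r. -/
theorem norm_eq_of_isTangentSide {c : ℂ} {r : ℝ} (hr : 0 < r) (hball : Metric.ball c r ⊆ P.body)
    {k : ZMod (2 * n + 1)} (h : P.IsTangentSide c r k) : ‖P.vertex k - c‖ = 1 - r := by
  obtain ⟨x, ⟨t, -, hx⟩, hxc⟩ := h
  have hx : P.vertex k + Complex.exp (t * Complex.I) = x := hx
  rw [mem_sphere_iff_norm] at hxc
  refine le_antisymm (P.norm_vertex_sub_le hr hball k) ?_
  have h1 := norm_sub_le (x - c) (P.vertex k - c)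
  rw [sub_sub_sub_cancel_right, ← hx, add_sub_cancel_left, Complex.norm_exp_ofReal_mul_I, hx,
    hxc] at h1
  linarith

/-- The contact point is opposite to P_k through c. Its direction is α + arg z, and positivity of
the heights of the two adjacent triangles places it between α and β. -/
theorem isTangentSide_of_norm_eq {c : ℂ} {r : ℝ} (hr : 0 < r) (hR : 1 / 2 ≤ 1 - r)
    (hR3 : 3 * (1 - r) ^ 2 ≤ 1) (hball : Metric.ball c r ⊆ P.body) {k : ZMod (2 * n + 1)}
    (h : ‖P.vertex k - c‖ = 1 - r) : P.IsTangentSide c r k := by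
  have hchain := P.isStarChain (P.norm_vertex_sub_le hr hball)
  obtain ⟨j, rfl⟩ : ∃ j : ℕ, ((j + 1 : ℕ) : ZMod (2 * n + 1)) = k :=
    ⟨k.val + 2 * n, by rw [add_assoc, natCast_add_period, ZMod.natCast_zmod_val]⟩
  have hQ : ‖P.chain c (j + 1)‖ = 1 - r := h
  have i0 := hchain.im_apex_pos hR hR3 P.chainAngle_pos (k := j) (Or.inr hQ)
  have i1 := hchain.im_apex_pos hR hR3 P.chainAngle_pos (k := j + 1) (Or.inl hQ)
  have hp := hchain.angle_succ_eq hR hR3 j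
  set z := apex (P.chain c) (j + 1) with hz
  have hzR : ‖z‖ = 1 - r := by rw [hz, hchain.norm_apex, hQ]
  have ha := arg_pos_of_im_pos i1
  have hb : Complex.arg (1 - apex (P.chain c) j) < 0 := Complex.arg_neg_iff.2 (by simpa using i0)
  rw [chainAngle] at hp
  have hexp : ((1 - r : ℝ) : ℂ) * Complex.exp ((P.α ((j + 1 : ℕ) : ZMod (2 * n + 1)) + Complex.arg z : ℝ)
      * Complex.I) = -P.chain c (j + 1) := by
    have h1 := Complex.norm_mul_exp_arg_mul_I z
    rw [hzR] at h1
    rw [hchain.vertex_eq, ← hz, P.edge_chain, Complex.ofReal_add, add_mul, Complex.exp_add]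
    linear_combination Complex.exp (P.α ((j + 1 : ℕ) : ZMod (2 * n + 1)) * Complex.I) * h1
  refine ⟨_, ⟨P.α ((j + 1 : ℕ) : ZMod (2 * n + 1)) + Complex.arg z, ⟨by linarith, by linarith⟩, rfl⟩, ?_⟩
  rw [mem_sphere_iff_norm]
  have e1 : P.vertex ((j + 1 : ℕ) : ZMod (2 * n + 1))
      + Complex.exp ((P.α ((j + 1 : ℕ) : ZMod (2 * n + 1)) + Complex.arg z : ℝ) * Complex.I) - c
      = (r : ℂ) * Complex.exp ((P.α ((j + 1 : ℕ) : ZMod (2 * n + 1)) + Complex.arg z : ℝ)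
        * Complex.I) := by
    have h2 : P.chain c (j + 1) = P.vertex ((j + 1 : ℕ) : ZMod (2 * n + 1)) - c := rfl
    rw [h2] at hexp
    rw [Complex.ofReal_sub, Complex.ofReal_one] at hexp
    linear_combination hexp
  simp only
  rw [e1, norm_mul, Complex.norm_exp_ofReal_mul_I, mul_one, Complex.norm_of_nonneg hr.le]

theorem IsNearlyInscribed.hasInradius {c : ℂ} {r : ℝ} {k : ZMod (2 * n + 1)}
    (h : P.IsNearlyInscribed c r k) (hr : 0 < r) (hR : 1 / 2 < 1 - r)
    (hR3 : 3 * (1 - r) ^ 2 ≤ 1) : HasInradius P.body r := by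
  refine ⟨⟨c, h.ball_subset⟩, ?_⟩
  rintro ρ ⟨w, hw⟩
  rcases le_or_gt ρ 0 with hρ | hρ
  · exact hρ.trans hr.le
  · have hchain := P.isStarChain (P.norm_vertex_sub_le hr h.ball_subset)
    have := hchain.radius_le_of_norm_sub_le hR hR3 P.chainAngle_pos
      (hasAtMostOneInner_chain h.norm_eq) (w := w - c) (R' := 1 - ρ) (fun j => by
        rw [chain, sub_sub_sub_cancel_right]
        exact P.norm_vertex_sub_le hρ hw _)
    linarith

/-- Two nearly inscribed polygons with the same number of sides and the same inradius are
congruent. -/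
theorem IsNearlyInscribed.isRigidMotionImage {P' : ReuleauxPolygon n} {c c' : ℂ} {r : ℝ}
    {k k' : ZMod (2 * n + 1)} (h : P.IsNearlyInscribed c r k) (h' : P'.IsNearlyInscribed c' r k')
    (hr : 0 < r) (hR : 1 / 2 < 1 - r) (hR3 : 3 * (1 - r) ^ 2 ≤ 1) :
    IsRigidMotionImage P.body P'.body := by
  have hchain := P.isStarChain (P.norm_vertex_sub_le hr h.ball_subset)
  have hchain' := P'.isStarChain (P'.norm_vertex_sub_le hr h'.ball_subset)
  obtain ⟨u, hu, hrot⟩ := hchain.exists_rotation hchain' hR hR3 P.chainAngle_pos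
    P'.chainAngle_pos (hasAtMostOneInner_chain h.norm_eq) (hasAtMostOneInner_chain h'.norm_eq)
  have hrot' : ∀ j, P'.vertex (j + k') - c' = u * (P.vertex (j + k) - c) := by
    intro j
    have := hrot j.val
    simpa [chain] using this
  have hu0 : u ≠ 0 := norm_ne_zero_iff.1 (by rw [hu]; exact one_ne_zero)
  have hmem : ∀ x, u * x + (c' - u * c) ∈ P'.body ↔ x ∈ P.body := by
    intro x
    rw [mem_body_iff, mem_body_iff]
    have key : ∀ j, ‖u * x + (c' - u * c) - P'.vertex (j + k')‖ = ‖x - P.vertex (j + k)‖ := by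
      intro j
      rw [show u * x + (c' - u * c) - P'.vertex (j + k') = u * (x - P.vertex (j + k)) by
        linear_combination -hrot' j, norm_mul, hu, one_mul]
    constructor
    · intro hx j
      have := key (j - k)
      rw [sub_add_cancel] at this
      rw [← this]; exact hx _
    · intro hx j
      have := key (j - k')
      rw [sub_add_cancel] at this
      rw [this]; exact hx _
  refine ⟨u, c' - u * c, hu, ?_⟩
  ext y
  constructor
  · intro hy
    refine ⟨u⁻¹ * (y - (c' - u * c)), ?_, ?_⟩
    · rw [← hmem, mul_inv_cancel_left₀ hu0, sub_add_cancel]; exact hy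
    · simp only; rw [mul_inv_cancel_left₀ hu0, sub_add_cancel]
  · rintro ⟨x, hx, rfl⟩
    exact (hmem x).2 hx

/-- The vertices of a regular polygon are on a circle. -/
theorem IsRegular.exists_isNearlyInscribed (h : P.IsRegular) {r : ℝ} (hR : 1 / 2 < 1 - r)
    (hl : (2 * n + 1) * chordAngle (1 - r) = Real.pi) : ∃ c, P.IsNearlyInscribed c r 0 := by
  have hp : ∀ k, P.chainAngle k = chordAngle (1 - r) := by
    intro k
    have h1 := P.sum_chainAngle
    rw [Finset.sum_congr rfl (g := fun _ => P.chainAngle k) (fun j _ => show P.chainAngle j = _ from h _ _), Finset.sum_const,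
      Finset.card_range, nsmul_eq_mul] at h1
    push_cast at h1
    rw [← hl] at h1
    exact mul_left_cancel₀ (by positivity) h1
  set ℓ := chordAngle (1 - r) with hℓ
  set b : ℂ := ((1 - r : ℝ) : ℂ) * Complex.exp ((ℓ / 2 : ℝ) * Complex.I) with hb
  have hbR : ‖b‖ = 1 - r := by
    rw [hb, norm_mul, Complex.norm_exp_ofReal_mul_I, mul_one, Complex.norm_of_nonneg (by linarith)]
  -- The apex b of the isosceles triangle is the fixed point of the recursion z ↦ exp(iℓ)(1 - z), so
  -- a center chosen from one edge serves all edges.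
  have hb1 : (1 - b) * Complex.exp (ℓ * Complex.I) = b := by
    have hcos : (((1 - r : ℝ) : ℂ) * (Complex.exp ((ℓ / 2 : ℝ) * Complex.I)
        + Complex.exp (-((ℓ / 2 : ℝ) * Complex.I)))) = 1 := by
      rw [exp_neg_mul_I, ← Complex.cos_add_sin_I, ← Complex.ofReal_cos, ← Complex.ofReal_sin,
        show ∀ x y : ℂ, x + y * Complex.I + (x - y * Complex.I) = 2 * x by intro x y; ring,
        cos_half_chordAngle hR.le]
      have : (1 - r : ℝ) ≠ 0 := by linarith
      have : ((1 - r : ℝ) : ℂ) ≠ 0 := by exact_mod_cast this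
      push_cast at this ⊢
      field_simp
    have e1 : Complex.exp (ℓ * Complex.I)
        = Complex.exp ((ℓ / 2 : ℝ) * Complex.I) * Complex.exp ((ℓ / 2 : ℝ) * Complex.I) := by
      rw [← Complex.exp_add]; congr 1; push_cast; ring
    have e2 : Complex.exp ((ℓ / 2 : ℝ) * Complex.I) * Complex.exp (-((ℓ / 2 : ℝ) * Complex.I)) = 1 := by
      rw [← Complex.exp_add]; simp
    rw [e1, hb]
    linear_combination (-Complex.exp ((ℓ / 2 : ℝ) * Complex.I) ^ 2) * hcos
      + ((1 - r : ℝ) : ℂ) * Complex.exp ((ℓ / 2 : ℝ) * Complex.I) * e2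
  refine ⟨P.vertex 0 + b * Complex.exp (P.α 0 * Complex.I), ?_⟩
  set c := P.vertex 0 + b * Complex.exp (P.α 0 * Complex.I) with hc
  have hQ : ∀ k, P.chain c k = -b * edge (P.chain c) k := by
    intro k
    induction k with
    | zero => rw [P.edge_chain, chain, hc]; simp
    | succ k ih =>
      have h1 := P.turn_chain c k
      have h2 : P.chain c (k + 1) = P.chain c k + edge (P.chain c) k := by rw [edge]; ring
      have h3 : P.chain c (k + 2) - P.chain c (k + 1) = edge (P.chain c) (k + 1) := rfl
      rw [h3, hp] at h1
      have h4 : edge (P.chain c) k = -Complex.exp (ℓ * Complex.I) * edge (P.chain c) (k + 1) := by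
        rw [edge]; linear_combination -h1
      rw [h2, ih, ← neg_mul_eq_neg_mul, h4]
      linear_combination (-edge (P.chain c) (k + 1)) * hb1
  have hnorm : ∀ j, ‖P.vertex j - c‖ = 1 - r := by
    intro j
    have h1 := hQ j.val
    rw [P.edge_chain, chain, ZMod.natCast_zmod_val] at h1
    rw [h1, norm_mul, norm_neg, hbR, Complex.norm_exp_ofReal_mul_I, mul_one]
  exact ⟨P.ball_subset_body fun k => (hnorm k).le, fun j _ => hnorm j⟩

theorem isRegular_of_sum_eq {c : ℂ} {r : ℝ} (hr : 0 < r) (hR : 1 / 2 ≤ 1 - r)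
    (hR3 : 3 * (1 - r) ^ 2 ≤ 1) (hball : Metric.ball c r ⊆ P.body)
    (hl : (2 * n + 1) * chordAngle (1 - r) = Real.pi) : P.IsRegular := by
  have hchain := P.isStarChain (P.norm_vertex_sub_le hr hball)
  have h1 : ∑ k ∈ Finset.range (2 * n + 1), P.chainAngle k
      = ∑ k ∈ Finset.range (2 * n + 1), chordAngle (1 - r) := by
    rw [P.sum_chainAngle, Finset.sum_const, Finset.card_range, nsmul_eq_mul, ← hl]; push_cast; ring
  have h2 := (Finset.sum_eq_sum_iff_of_le fun k _ => hchain.angle_le hR hR3 k).1 h1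
  have h3 : ∀ j, P.β j - P.α j = chordAngle (1 - r) := by
    intro j
    have := h2 j.val (Finset.mem_range.2 (ZMod.val_lt j))
    rwa [chainAngle, ZMod.natCast_zmod_val] at this
  intro j k
  rw [h3, h3]

theorem hasOneCluster_of_isNearlyInscribed {c : ℂ} {r : ℝ} {k : ZMod (2 * n + 1)}
    (h : P.IsNearlyInscribed c r k) (hr : 0 < r) (hR : 1 / 2 ≤ 1 - r)
    (hR3 : 3 * (1 - r) ^ 2 ≤ 1) (hk : ‖P.vertex k - c‖ < 1 - r) : P.HasOneCluster r := by
  have hchain := P.isStarChain (P.norm_vertex_sub_le hr h.ball_subset)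
  have hn := P.one_le
  have h1 : ((1 : ℕ) : ZMod (2 * n + 1)) ≠ 0 := by
    rw [Ne, ZMod.natCast_eq_zero_iff]; exact Nat.not_dvd_of_pos_of_lt (by omega) (by omega)
  have h2 : ((2 : ℕ) : ZMod (2 * n + 1)) ≠ 0 := by
    rw [Ne, ZMod.natCast_eq_zero_iff]; exact Nat.not_dvd_of_pos_of_lt (by omega) (by omega)
  push_cast at h1 h2
  have htan : ∀ j, j ≠ k → P.IsTangentSide c r j := fun j hj =>
    isTangentSide_of_norm_eq hr hR hR3 h.ball_subset (h.norm_eq j hj)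
  have hsph : ∀ j, j ≠ k → P.vertex j ∈ Metric.sphere c (1 - r) := fun j hj =>
    mem_sphere_iff_norm.2 (h.norm_eq j hj)
  refine ⟨c, h.ball_subset, k, ⟨htan _ ?_, htan _ ?_, ?_, ?_, hsph _ ?_, hsph _ ?_⟩, ?_, ?_⟩
  · simpa using h1
  · simpa using h1
  -- With ρ the distance of P_k to c, the apex has 2 re = 1 + ρ² - (1 - r)² and re < ρ because its
  -- height is positive. Hence (1 - ρ)² < (1 - r)², that is, ρ > r.
  · have hQ1 : ‖P.chain c (k.val + 1)‖ = 1 - r := by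
      rw [chain, Nat.cast_add, ZMod.natCast_zmod_val, Nat.cast_one]
      exact h.norm_eq _ (by simpa using h1)
    have him := hchain.im_apex_pos hR hR3 P.chainAngle_pos (k := k.val) (Or.inr hQ1)
    have e1 := Complex.sq_norm_one_sub (apex (P.chain c) k.val)
    have e2 := Complex.sq_norm_eq (apex (P.chain c) k.val)
    rw [hchain.norm_one_sub_apex, hQ1, hchain.norm_apex] at e1
    rw [hchain.norm_apex] at e2
    have e3 : ‖P.chain c k.val‖ = ‖P.vertex k - c‖ := by rw [chain, ZMod.natCast_zmod_val]
    rw [e3] at e1 e2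
    rw [dist_eq_norm]
    have h0 := norm_nonneg (P.vertex k - c)
    have h3 : (apex (P.chain c) k.val).re < ‖P.vertex k - c‖ :=
      lt_of_pow_lt_pow_left₀ 2 h0 (by rw [e2]; nlinarith)
    nlinarith
  · rw [dist_eq_norm]; exact hk
  · simpa using h2
  · simpa using h2
  · intro j hj
    by_contra hjk
    have := hj.2.2.2.1
    rw [dist_eq_norm, h.norm_eq j hjk] at this
    exact lt_irrefl _ this
  · intro j hj1 hj2 hj3
    exact ⟨htan j hj2, hsph _ fun h' => hj1 (by rw [← h']; ring),
      hsph _ fun h' => hj3 (by rw [← h']; ring)⟩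

theorem HasOneCluster.exists_isNearlyInscribed {r : ℝ} (h : P.HasOneCluster r) (hr : 0 < r) :
    ∃ c k, P.IsNearlyInscribed c r k := by
  obtain ⟨c, hball, k, hk, -, hext⟩ := h
  refine ⟨c, k, hball, fun j hj => ?_⟩
  apply norm_eq_of_isTangentSide hr hball
  by_cases h1 : j = k - 1
  · rw [h1]; exact hk.1
  by_cases h2 : j = k + 1
  · rw [h2]; exact hk.2.1
  exact (hext j h1 hj h2).1

end ReuleauxPolygon

/-! ### Area minimizers -/

/-- The remainder in the division of the total turning by the extremal length. -/
theorem exists_sideNumber_remainder {r : ℝ} (hR : 1 / 2 < 1 - r) (hR3 : 3 * (1 - r) ^ 2 ≤ 1) :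
    1 ≤ sideNumber r ∧ ∃ e, 0 < e ∧ e ≤ chordAngle (1 - r) ∧
      Real.pi + chordAngle (1 - r) = 2 * sideNumber r * chordAngle (1 - r) + 2 * e := by
  have hl := chordAngle_pos hR
  have hl' := chordAngle_le hR.le hR3
  set ℓ := chordAngle (1 - r) with hℓ
  have hdef : sideNumber r = ⌈Real.pi / (2 * ℓ) - 1 / 2⌉₊ := rfl
  have h1 : 3 / 2 ≤ Real.pi / (2 * ℓ) := by rw [le_div_iff₀ (by linarith)]; linarith
  have h2 := Nat.le_ceil (Real.pi / (2 * ℓ) - 1 / 2)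
  have h3 := Nat.ceil_lt_add_one (show 0 ≤ Real.pi / (2 * ℓ) - 1 / 2 by linarith)
  rw [← hdef] at h2 h3
  have e1 : Real.pi = Real.pi / (2 * ℓ) * (2 * ℓ) := by field_simp
  -- The two bounds defining the ceiling are exactly 0 < e ≤ ℓ.
  refine ⟨?_, (Real.pi + ℓ - 2 * sideNumber r * ℓ) / 2, ?_, ?_, by ring⟩
  · have : (0 : ℝ) < sideNumber r := by linarith
    exact_mod_cast this
  · nlinarith
  · nlinarith

theorem eq_regularInradius_iff {r : ℝ} (hR : 1 / 2 < 1 - r) {n : ℕ} (hn : 1 ≤ n) :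
    r = regularInradius n ↔ (2 * n + 1) * chordAngle (1 - r) = Real.pi := by
  have hcos := cos_half_chordAngle hR.le
  have hn' : (1 : ℝ) ≤ n := by exact_mod_cast hn
  have hx0 : 0 < Real.pi / (2 * (2 * n + 1)) := by positivity
  have hx1 : Real.pi / (2 * (2 * n + 1)) < Real.pi / 2 := by
    apply div_lt_div_of_pos_left Real.pi_pos (by norm_num); linarith
  have hcx := Real.cos_pos_of_mem_Ioo (x := Real.pi / (2 * (2 * n + 1)))
    ⟨by linarith [Real.pi_pos], hx1⟩
  have hiff : (2 * n + 1) * chordAngle (1 - r) = Real.pi ↔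
      chordAngle (1 - r) / 2 = Real.pi / (2 * (2 * n + 1)) := by
    rw [div_eq_div_iff two_ne_zero (by positivity)]
    constructor <;> intro h <;> linarith
  rw [hiff, regularInradius]
  constructor
  · intro h
    refine Real.injOn_cos ⟨by linarith [chordAngle_nonneg (1 - r)],
      by linarith [chordAngle_lt_pi (1 - r), chordAngle_nonneg (1 - r)]⟩ ⟨hx0.le, by linarith⟩ ?_
    rw [hcos, show (1 : ℝ) - r = 1 / (2 * Real.cos (Real.pi / (2 * (2 * n + 1)))) by linarith]
    field_simp
  · intro h
    rw [← h, hcos]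
    have : (1 - r : ℝ) ≠ 0 := by linarith
    field_simp
    ring

namespace ReuleauxPolygon

variable {n : ℕ} {P : ReuleauxPolygon n} {r : ℝ}

/-- The smallest area of a Reuleaux polygon of inradius `r`. -/
noncomputable def minArea (r e : ℝ) : ℝ :=
  Real.pi / 2 - ((2 * sideNumber r - 1) * height (1 - r) (chordAngle (1 - r))
    + 2 * height (1 - r) e)

theorem minArea_le_volume (hr : 0 < r) (hR : 1 / 2 < 1 - r) (hR3 : 3 * (1 - r) ^ 2 ≤ 1) {e : ℝ}
    (he : 0 < e) (he' : e ≤ chordAngle (1 - r))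
    (hN : Real.pi + chordAngle (1 - r) = 2 * sideNumber r * chordAngle (1 - r) + 2 * e)
    (h : HasInradius P.body r) : ENNReal.ofReal (minArea r e) ≤ volume P.body := by
  obtain ⟨c, hc⟩ := h.1
  rw [P.volume_body hr hc]
  have := IsStarChain.crossSum_le hR hR3 he.le he' hN _ _ _
    (P.isStarChain (P.norm_vertex_sub_le hr hc))
  exact ENNReal.ofReal_le_ofReal (by unfold minArea; linarith)

theorem volume_pos (P : ReuleauxPolygon n) : 0 < volume P.body :=
  (isOpen_interior.measure_pos volume P.isBody.interior_nonempty).trans_le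
    (measure_mono interior_subset)

theorem IsNearlyInscribed.volume_eq {P : ReuleauxPolygon (sideNumber r)} {c : ℂ}
    {k : ZMod (2 * sideNumber r + 1)} (h : P.IsNearlyInscribed c r k) (hr : 0 < r)
    (hR : 1 / 2 < 1 - r) (hR3 : 3 * (1 - r) ^ 2 ≤ 1) {e : ℝ}
    (hN : Real.pi + chordAngle (1 - r) = 2 * sideNumber r * chordAngle (1 - r) + 2 * e) :
    volume P.body = ENNReal.ofReal (minArea r e) := by
  rw [P.volume_body hr h.ball_subset,
    (P.isStarChain (P.norm_vertex_sub_le hr h.ball_subset)).crossSum_eq_of_hasAtMostOneInner hR hR3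
      P.chainAngle_pos hN (hasAtMostOneInner_chain h.norm_eq), minArea]

theorem exists_isNearlyInscribed (hR : 1 / 2 < 1 - r) (hR3 : 3 * (1 - r) ^ 2 ≤ 1) :
    ∃ (P : ReuleauxPolygon (sideNumber r)) (c : ℂ) (k : ZMod (2 * sideNumber r + 1)),
      P.IsNearlyInscribed c r k := by
  obtain ⟨hN1, e, he, he', hN⟩ := exists_sideNumber_remainder hR hR3
  obtain ⟨Q, p, h, hpos, h₀⟩ := IsStarChain.exists_extremal hR hR3 hN1 he he' hN
  obtain ⟨P, hbody, hQ, -⟩ := h.exists_reuleauxPolygon hR.le hR3 hpos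
  refine ⟨P, 0, _, isNearlyInscribed_of_chain (k₀ := 0) ?_ (by rw [hQ]; exact h₀)⟩
  have := h.ball_subset_ballHull
  rwa [← hbody, sub_sub_cancel] at this

theorem exists_isNearlyInscribed_of_volume_le (hr : 0 < r) (hR : 1 / 2 < 1 - r)
    (hR3 : 3 * (1 - r) ^ 2 ≤ 1) (h : HasInradius P.body r) {e : ℝ}
    (he : 0 < e) (he' : e ≤ chordAngle (1 - r))
    (hN : Real.pi + chordAngle (1 - r) = 2 * sideNumber r * chordAngle (1 - r) + 2 * e)
    (hvol : volume P.body ≤ ENNReal.ofReal (minArea r e)) :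
    n = sideNumber r ∧ ∃ c k, P.IsNearlyInscribed c r k := by
  obtain ⟨c, hc⟩ := h.1
  have hchain := P.isStarChain (P.norm_vertex_sub_le hr hc)
  have h1 := IsStarChain.crossSum_le hR hR3 he.le he' hN _ _ _ hchain
  -- Needed because `ENNReal.ofReal` truncates at 0; positivity comes from the positive volume of
  -- the body.
  have hpos : 0 < minArea r e := ENNReal.ofReal_pos.1 (P.volume_pos.trans_le hvol)
  rw [P.volume_body hr hc, ENNReal.ofReal_le_ofReal_iff hpos.le] at hvol
  obtain ⟨hn, k₀, h₀, -⟩ := hchain.exists_hasAtMostOneInner hR hR3 P.chainAngle_pos he he' hN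
    (le_antisymm h1 (by unfold minArea at hvol; linarith))
  exact ⟨hn, c, _, isNearlyInscribed_of_chain hc h₀⟩

/-- If r is the regular inradius, (2N(r)+1)ℓ = π and all angles are forced to be ℓ. Otherwise the
exceptional vertex is strictly inside, since e = ℓ would give that same equality, and it forms the
cluster. -/
theorem isOmega_iff (hr : 0 < r) (hR : 1 / 2 < 1 - r) (hR3 : 3 * (1 - r) ^ 2 ≤ 1) {Ω : Set ℂ} :
    IsOmega r Ω ↔ ∃ (P : ReuleauxPolygon (sideNumber r)) (c : ℂ)
      (k : ZMod (2 * sideNumber r + 1)), P.body = Ω ∧ P.IsNearlyInscribed c r k := by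
  obtain ⟨hN1, e, he, he', hN⟩ := exists_sideNumber_remainder hR hR3
  have hreg := eq_regularInradius_iff hR hN1
  constructor
  · rintro ⟨P, hP, ⟨hr', hP'⟩ | ⟨-, -, -, hP'⟩⟩
    · obtain ⟨c, hc⟩ := hP'.exists_isNearlyInscribed hR (hreg.1 hr')
      exact ⟨P, c, 0, hP, hc⟩
    · obtain ⟨c, k, hc⟩ := hP'.exists_isNearlyInscribed hr
      exact ⟨P, c, k, hP, hc⟩
  · rintro ⟨P, c, k, hP, h⟩
    refine ⟨P, hP, ?_⟩
    by_cases hr' : r = regularInradius (sideNumber r)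
    · exact Or.inl ⟨hr', isRegular_of_sum_eq hr hR.le hR3 h.ball_subset (hreg.1 hr')⟩
    · refine Or.inr ⟨hr', h.hasInradius hr hR hR3, fun P' j _ hP' => ?_, ?_⟩
      · rw [h.volume_eq hr hR hR3 hN]
        exact minArea_le_volume hr hR hR3 he he' hN hP'
      · have hchain := P.isStarChain (P.norm_vertex_sub_le hr h.ball_subset)
        refine hasOneCluster_of_isNearlyInscribed h hr hR.le hR3
          (lt_of_le_of_ne (P.norm_vertex_sub_le hr h.ball_subset k) fun hk => hr' (hreg.2 ?_))
        have hd := hchain.vertexDefect_eq_of_hasAtMostOneInner hR hR3 P.chainAngle_pos hN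
          (hasAtMostOneInner_chain h.norm_eq)
        rw [IsStarChain.vertexDefect_of_eq
          (by rw [chain, ZMod.natCast_zmod_val]; exact hk)] at hd
        rw [← hd] at hN
        linarith

theorem isAreaMinimizer_iff (hr : 0 < r) (hR : 1 / 2 < 1 - r) (hR3 : 3 * (1 - r) ^ 2 ≤ 1) {N : ℕ}
    (hN : sideNumber r ≤ N) {Ω : Set ℂ} : IsAreaMinimizer N r Ω ↔
      ∃ (P : ReuleauxPolygon (sideNumber r)) (c : ℂ) (k : ZMod (2 * sideNumber r + 1)),
        P.body = Ω ∧ P.IsNearlyInscribed c r k := by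
  obtain ⟨-, e, he, he', hNe⟩ := exists_sideNumber_remainder hR hR3
  constructor
  · rintro ⟨⟨hin, n, -, P, rfl⟩, hmin⟩
    obtain ⟨P₀, c₀, k₀, h₀⟩ := exists_isNearlyInscribed hR hR3
    have hvol := hmin P₀.body ⟨h₀.hasInradius hr hR hR3, _, hN, P₀, rfl⟩
    rw [h₀.volume_eq hr hR hR3 hNe] at hvol
    obtain ⟨rfl, c, k, h⟩ := exists_isNearlyInscribed_of_volume_le hr hR hR3 hin he he' hNe hvol
    exact ⟨P, c, k, rfl, h⟩
  · rintro ⟨P, c, k, rfl, h⟩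
    refine ⟨⟨h.hasInradius hr hR hR3, _, hN, P, rfl⟩, ?_⟩
    rintro _ ⟨hin, n, -, P', rfl⟩
    rw [h.volume_eq hr hR hR3 hNe]
    exact minArea_le_volume hr hR hR3 he he' hNe hin

end ReuleauxPolygon

theorem theorem4p1 (r : ℝ) (hr₁ : 1 - 1 / Real.sqrt 3 ≤ r) (hr₂ : r ≤ 1 / 2)
    (N : ℕ) (hN : 1 ≤ N) :
    -- no admissible shape if `N < N(r)`, where `N(1/2) = ∞`
    ((r = 1 / 2 ∨ N < sideNumber r) → ¬ ∃ Ω : Set ℂ, IsAdmissible N r Ω) ∧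
    -- if `N(r) ≤ N`, the minimizers are exactly the copies of `Ω(r)`, which exists and is unique
    -- up to rigid motion
    (r < 1 / 2 → sideNumber r ≤ N →
      (∃ Ω : Set ℂ, IsOmega r Ω) ∧
      (∀ Ω : Set ℂ, IsAreaMinimizer N r Ω ↔ IsOmega r Ω) ∧
      (∀ Ω Ω' : Set ℂ, IsAreaMinimizer N r Ω → IsAreaMinimizer N r Ω' →
        IsRigidMotionImage Ω Ω')) := by
  have h3 : (0 : ℝ) < Real.sqrt 3 := Real.sqrt_pos.2 (by norm_num)
  have h3' : Real.sqrt 3 ^ 2 = 3 := Real.sq_sqrt (by norm_num)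
  have hle : (1 - r) * Real.sqrt 3 ≤ 1 := by
    rw [← le_div_iff₀ h3]; linarith
  have hR3 : 3 * (1 - r) ^ 2 ≤ 1 := by
    have : ((1 - r) * Real.sqrt 3) ^ 2 ≤ 1 ^ 2 := pow_le_pow_left₀ (by
      have : 0 ≤ 1 - r := by linarith
      positivity) hle 2
    rw [mul_pow, h3'] at this
    linarith
  have hr : 0 < r := by nlinarith
  refine ⟨?_, fun hr' hNr => ?_⟩
  · rintro hcase ⟨Ω, hin, n, hn, P, rfl⟩
    obtain ⟨c, hc⟩ := hin.1
    have hpi := (P.isStarChain (P.norm_vertex_sub_le hr hc)).pi_le (by linarith) hR3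
    have hl0 : 0 < chordAngle (1 - r) := by
      refine lt_of_le_of_ne (chordAngle_nonneg _) fun h0 => ?_
      rw [← h0, mul_zero] at hpi
      exact absurd hpi (not_le.2 Real.pi_pos)
    -- At r = 1/2 one has ℓ = 0 and `sideNumber` takes a meaningless value, so this case is excluded
    -- by the positivity of ℓ alone.
    rcases hcase with rfl | hlt
    · rw [show (1 : ℝ) - 1 / 2 = 1 / 2 by norm_num, chordAngle_zero_half] at hl0
      exact lt_irrefl _ hl0
    -- Being below the ceiling means (2N + 1)ℓ < π, against π ≤ (2n + 1)ℓ with n ≤ N.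
    · have h1 := Nat.lt_ceil.1 hlt
      have h2 : (N : ℝ) < Real.pi / (2 * chordAngle (1 - r)) - 1 / 2 := h1
      have h4 : (N + 1 / 2 : ℝ) * (2 * chordAngle (1 - r)) < Real.pi := by
        rw [← lt_div_iff₀ (by linarith)]; linarith
      have h5 : (n : ℝ) ≤ N := by exact_mod_cast hn
      nlinarith
  · have hR : 1 / 2 < 1 - r := by linarith
    have hmin := fun Ω => ReuleauxPolygon.isAreaMinimizer_iff hr hR hR3 hNr (Ω := Ω)
    have homega := fun Ω => ReuleauxPolygon.isOmega_iff hr hR hR3 (Ω := Ω)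
    obtain ⟨P, c, k, h⟩ := ReuleauxPolygon.exists_isNearlyInscribed hR hR3
    refine ⟨⟨P.body, (homega _).2 ⟨P, c, k, rfl, h⟩⟩, fun Ω => (hmin Ω).trans (homega Ω).symm, ?_⟩
    intro Ω Ω' hΩ hΩ'
    obtain ⟨P, c, k, rfl, h⟩ := (hmin Ω).1 hΩ
    obtain ⟨P', c', k', rfl, h'⟩ := (hmin Ω').1 hΩ'
    exact h.isRigidMotionImage h' hr hR hR3
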